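/- All graphs are finite and simple. For a graph $G$ let $\chi(G)$ be its chromatic number and let $h(G)$ be its Hadwiger number, the largest $t$ such that the complete graph $K^{t}$ on $t$ vertices is a minor of $G$. A graph is called solid if it is one of the following. (1) A pyramid: a cycle $C$ together with one further vertex that has at least three neighbours on $C$. (2) A trihedron: the union of three internally disjoint paths of length at least $2$ between two distinct vertices. (3) A stamp: the union of a triangle and three paths of length at least $1$ that start at the three different vertices of the triangle, end at a common vertex $x$, and are disjoint apart from $x$. (4) A prism: the union of two vertex-disjoint triangles $x_1x_2x_3$ and $y_1y_2y_3$ and three pairwise vertex-disjoint paths, the $i$-th from $x_i$ to $y_i$. Let $C(G)$ be the set of induced cycles of $G$ (of length at least $3$), and let $S(G)$ be the set of induced subgraphs of $G$ that are isomorphic to a solid graph. Put $$\beth^{1}(G)=|E(G)|-|V(G)|,\qquad \beth^{2}(G)=|C(G)|-|E(G)|+|V(G)|,$$ $$\beth^{3}(G)=|S(G)|-|C(G)|+|E(G)|-|V(G)|.$$ Theorem. Let $G$ be a finite connected simple graph. If $\beth^{i}(K^{h(G)})=\beth^{i}(G)$ for some $i\in\{1,2,3\}$, then $\chi(G)\le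 h(G)$, that is, $G$ satisfies Hadwiger's conjecture. -/

import Mathlib

universe u v

namespace SimpleGraph

/-- `H` is a minor of `G`, given by branch sets: pairwise disjoint connected (in particular
nonempty) vertex sets of `G`, one for each vertex of `H`, such that adjacent vertices of `H` have
branch sets joined by an edge of `G`. Contracting the branch sets inside a subgraph of `G`
yields `H`. -/
def IsGraphMinor {W : Type u} {V : Type v} (H : SimpleGraph W) (G : SimpleGraph V) : Prop :=
  ∃ B : W → Set V,
    (∀ a, (G.induce (B a)).Connected) ∧
    (∀ a b, a ≠ b → Disjoint (B a) (B b)) ∧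
    (∀ a b, H.Adj a b → ∃ x ∈ B a, ∃ y ∈ B b, G.Adj x y)

/-- The Hadwiger number: the largest `t` such that the complete graph on `t` vertices is a minor
of `G`. For a finite graph the set is bounded by the number of vertices and contains `0`. -/
noncomputable def hadwigerNumber {V : Type u} (G : SimpleGraph V) : ℕ :=
  sSup {t : ℕ | IsGraphMinor (completeGraph (Fin t)) G}

/-- `G` is a cycle (of length at least three). -/
def IsCycleGraph {V : Type u} (G : SimpleGraph V) : Prop :=
  ∃ n : ℕ, 3 ≤ n ∧ Nonempty (G ≃g cycleGraph n)

/-- A pyramid: a cycle together with one further vertex `w`, the apex, which has at least three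
neighbours on the cycle. -/
def IsPyramid {V : Type u} (G : SimpleGraph V) : Prop :=
  ∃ w : V, (G.induce {w}ᶜ).IsCycleGraph ∧ 3 ≤ (G.neighborSet w).ncard

/-- A trihedron: the union of three internally disjoint paths, each of length at least two,
between two distinct vertices. -/
def IsTrihedron {V : Type u} (G : SimpleGraph V) : Prop :=
  ∃ (x y : V) (p : Fin 3 → G.Walk x y),
    x ≠ y ∧
    (∀ i, (p i).IsPath ∧ 2 ≤ (p i).length) ∧
    (∀ i j, i ≠ j → ∀ z ∈ (p i).support, z ∈ (p j).support → z = x ∨ z = y) ∧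
    (⨆ i, (p i).toSubgraph) = ⊤

/-- A stamp: the union of a triangle with vertices `a 0, a 1, a 2` and three paths of length at
least one from these vertices to a common vertex `x`, which are disjoint apart from `x`. -/
def IsStamp {V : Type u} (G : SimpleGraph V) : Prop :=
  ∃ (a : Fin 3 → V) (x : V) (p : ∀ i, G.Walk (a i) x),
    (∀ i j, i ≠ j → G.Adj (a i) (a j)) ∧
    (∀ i, (p i).IsPath ∧ 1 ≤ (p i).length) ∧
    (∀ i j, i ≠ j → ∀ z ∈ (p i).support, z ∈ (p j).support → z = x) ∧
    (⊤ : G.Subgraph).induce (Set.range a) ⊔ (⨆ i, (p i).toSubgraph) = ⊤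

/-- A prism: the union of two disjoint triangles `a 0, a 1, a 2` and `b 0, b 1, b 2` and three
disjoint paths from `a i` to `b i`. -/
def IsPrism {V : Type u} (G : SimpleGraph V) : Prop :=
  ∃ (a b : Fin 3 → V) (p : ∀ i, G.Walk (a i) (b i)),
    (∀ i j, i ≠ j → G.Adj (a i) (a j)) ∧
    (∀ i j, i ≠ j → G.Adj (b i) (b j)) ∧
    (∀ i j, a i ≠ b j) ∧
    (∀ i, (p i).IsPath) ∧
    (∀ i j, i ≠ j → ∀ z ∈ (p i).support, z ∉ (p j).support) ∧
    (⊤ : G.Subgraph).induce (Set.range a) ⊔ (⊤ : G.Subgraph).induce (Set.range b) ⊔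
      (⨆ i, (p i).toSubgraph) = ⊤

/-- The solid graphs. -/
def IsSolidGraph {V : Type u} (G : SimpleGraph V) : Prop :=
  G.IsPyramid ∨ G.IsTrihedron ∨ G.IsStamp ∨ G.IsPrism

/-- The induced cycles of `G`, each given by its vertex set (an induced subgraph is determined by
its vertex set). -/
def inducedCycles {V : Type u} (G : SimpleGraph V) : Set (Set V) :=
  {s | (G.induce s).IsCycleGraph}

/-- The solids in `G`, i.e. the induced subgraphs of `G` that are solid graphs, each given by its
vertex set. -/
def solids {V : Type u} (G : SimpleGraph V) : Set (Set V) :=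
  {s | (G.induce s).IsSolidGraph}

/-- The first graph characteristic `|E| - |V|` of a finite graph. -/
noncomputable def beth1 {V : Type u} (G : SimpleGraph V) : ℤ :=
  (G.edgeSet.ncard : ℤ) - (Nat.card V : ℤ)

/-- The second graph characteristic `|C| - |E| + |V|` of a finite graph. -/
noncomputable def beth2 {V : Type u} (G : SimpleGraph V) : ℤ :=
  (G.inducedCycles.ncard : ℤ) - (G.edgeSet.ncard : ℤ) + (Nat.card V : ℤ)

/-- The third graph characteristic `|S| - |C| + |E| - |V|` of a finite graph. -/
noncomputable def beth3 {V : Type u} (G : SimpleGraph V) : ℤ :=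
  (G.solids.ncard : ℤ) - (G.inducedCycles.ncard : ℤ) + (G.edgeSet.ncard : ℤ) - (Nat.card V : ℤ)

end SimpleGraph

/-!
A vertex `x` of `A` is avoidable if any two of its neighbours in `A` are joined by a path in `A`
that avoids `x` and its other neighbours. Every nonempty `A` has one: unless all vertices of `A`
are adjacent, take `x` of least degree in an inclusion-minimal component of the graphs left by
deleting a closed neighbourhood from `A`.

Deleting an avoidable vertex `x` of degree `d` from a connected set keeps it connected and lowers
`β¹`, `β²`, `β³` (that is, `beth1`, `beth2`, `beth3`) by at least `C(d - 1, 1)`, `C(d - 1, 2)`,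
`C(d - 1, 3)`. Indeed every pair of neighbours of `x` lies on an induced cycle through `x`, every
triple lies in a solid through `x`, and the induced paths joining a fixed pair are the vertices of
a connected graph whose edges give distinct solids, so that they outnumber these solids by at most
one.

If `A` is not `k`-colourable, then either `d < k` and `A \ {x}` is not `k`-colourable, or `d ≥ k`
and `A \ {x}` is not `(k - 1)`-colourable. By induction and Pascal's rule a connected graph `G`
that is not `k`-colourable has `βⁱ(G)` at least `C(k, i + 1)`, up to the additive constant `±1`
for which `βⁱ(Kᵏ)` is at most `C(k - 1, i + 1)`; these values differ as soon as `k ≥ 4`. For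
`k = h(G) ≤ 3` the colouring exists because minimum degree three forces a `K⁴` minor.
-/

namespace SolidGraph

open SimpleGraph

section ConnectedOn

variable {V : Type*} {G : SimpleGraph V}

/-- The vertex set `s` is connected: it is nonempty and induces a connected subgraph of `G`. -/
def ConnectedOn (G : SimpleGraph V) (s : Set V) : Prop :=
  (G.induce s).Connected

theorem ConnectedOn.nonempty {s : Set V} (hs : ConnectedOn G s) : s.Nonempty :=
  Set.nonempty_coe_sort.1 (Connected.nonempty hs)

theorem ConnectedOn.subset_of_closed {s : Set V} (hs : ConnectedOn G s) (U : Set V) {u : V}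
    (hus : u ∈ s) (huU : u ∈ U) (hclosed : ∀ x ∈ U, x ∈ s → ∀ y ∈ s, G.Adj x y → y ∈ U) :
    s ⊆ U := by
  intro v hv
  obtain ⟨w⟩ := hs.preconnected ⟨u, hus⟩ ⟨v, hv⟩
  have mem_of_walk : ∀ {a b : s}, (G.induce s).Walk a b → (a : V) ∈ U → (b : V) ∈ U := by
    intro a b w
    induction w with
    | nil => exact id
    | cons hadj _ ih => exact fun ha => ih (hclosed _ ha (Subtype.prop _) _ (Subtype.prop _) hadj)
  exact mem_of_walk w huU

theorem connectedOn_of_closed {s : Set V} {u : V} (hu : u ∈ s)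
    (h : ∀ U : Set V, u ∈ U → (∀ x ∈ U, x ∈ s → ∀ y ∈ s, G.Adj x y → y ∈ U) → s ⊆ U) :
    ConnectedOn G s := by
  have reach : s ⊆ {v | ∃ hv : v ∈ s, (G.induce s).Reachable ⟨u, hu⟩ ⟨v, hv⟩} := by
    refine h _ ⟨hu, Reachable.refl _⟩ ?_
    rintro x ⟨_, hr⟩ hx y hy hxy
    have hxy' : (G.induce s).Adj ⟨x, hx⟩ ⟨y, hy⟩ := hxy
    exact ⟨hy, hr.trans hxy'.reachable⟩
  exact (connected_iff_exists_forall_reachable (G.induce s)).2 ⟨⟨u, hu⟩, fun v => (reach v.2).2⟩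

theorem connectedOn_singleton (u : V) : ConnectedOn G {u} :=
  connectedOn_of_closed rfl fun _ hu _ _ hv => hv ▸ hu

theorem ConnectedOn.union_of_adj {s t : Set V} (hs : ConnectedOn G s) (ht : ConnectedOn G t)
    {u v : V} (hu : u ∈ s) (hv : v ∈ t) (h : G.Adj u v) : ConnectedOn G (s ∪ t) :=
  connected_induce_union hs.preconnected ht.preconnected hu hv h

theorem ConnectedOn.insert_of_adj {s : Set V} (hs : ConnectedOn G s) {u v : V} (hu : u ∈ s)
    (h : G.Adj u v) : ConnectedOn G (insert v s) := by
  rw [Set.insert_eq, Set.union_comm]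
  exact hs.union_of_adj (connectedOn_singleton v) hu rfl h

theorem connectedOn_image_Icc (p : ℕ → V) {l r : ℕ} (hlr : l ≤ r)
    (h : ∀ i, l ≤ i → i < r → G.Adj (p i) (p (i + 1))) : ConnectedOn G (p '' Set.Icc l r) := by
  induction r, hlr using Nat.le_induction with
  | base => simpa using connectedOn_singleton (p l)
  | succ r hr ih =>
    have hIcc : ConnectedOn G (p '' Set.Icc l r) := ih fun i hi hir => h i hi (by omega)
    have := hIcc.insert_of_adj ⟨r, ⟨hr, le_rfl⟩, rfl⟩ (h r hr (by omega))
    rwa [← Set.image_insert_eq, ← Order.succ_eq_add_one,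
      Set.insert_Icc_right_eq_Icc_succ (hr.trans (Order.le_succ r))] at this

/-- `K` is the vertex set of a connected component of the subgraph induced by `s`. -/
structure IsComponent (G : SimpleGraph V) (s K : Set V) : Prop where
  subset : K ⊆ s
  connectedOn : ConnectedOn G K
  closed : ∀ k ∈ K, ∀ v ∈ s, G.Adj k v → v ∈ K

theorem IsComponent.subset_of_mem {s K C : Set V} (hK : IsComponent G s K)
    (hC : ConnectedOn G C) (hCs : C ⊆ s) {u : V} (huC : u ∈ C) (huK : u ∈ K) : C ⊆ K :=
  hC.subset_of_closed K huC huK fun _ hk _ v hv => hK.closed _ hk v (hCs hv)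

theorem exists_isComponent (G : SimpleGraph V) {s : Set V} {u : V} (hu : u ∈ s) :
    ∃ K, IsComponent G s K ∧ u ∈ K := by
  set S : Set (Set V) := {C | C ⊆ s ∧ u ∈ C ∧ ConnectedOn G C}
  have singleton_mem : {u} ∈ S := ⟨by simpa using hu, rfl, connectedOn_singleton u⟩
  refine ⟨⋃₀ S, ⟨Set.sUnion_subset fun C hC => hC.1, ?_, ?_⟩, {u}, singleton_mem, rfl⟩
  · exact induce_sUnion_connected_of_pairwise_not_disjoint ⟨_, singleton_mem⟩
      (fun hC hC' => ⟨u, hC.2.1, hC'.2.1⟩) fun hC => hC.2.2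
  · rintro k ⟨C, ⟨hCs, huC, hC⟩, hkC⟩ v hv hkv
    exact ⟨insert v C, ⟨Set.insert_subset hv hCs, Or.inr huC, hC.insert_of_adj hkC hkv⟩, Or.inl rfl⟩

end ConnectedOn

section InducedPath

variable {V : Type*} {G : SimpleGraph V}

/-- `P` is the vertex set of an induced path from `a` to `b`, encoded as an inclusion-minimal
connected set containing `a` and `b`. -/
def IsPathSet (G : SimpleGraph V) (a b : V) (P : Set V) : Prop :=
  Minimal (fun P => a ∈ P ∧ b ∈ P ∧ ConnectedOn G P) P

theorem IsPathSet.left_mem {a b : V} {P : Set V} (h : IsPathSet G a b P) : a ∈ P := h.1.1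

theorem IsPathSet.right_mem {a b : V} {P : Set V} (h : IsPathSet G a b P) : b ∈ P := h.1.2.1

theorem IsPathSet.connectedOn {a b : V} {P : Set V} (h : IsPathSet G a b P) : ConnectedOn G P :=
  h.1.2.2

theorem IsPathSet.eq_of_subset {a b : V} {P Q : Set V} (h : IsPathSet G a b P) (ha : a ∈ Q)
    (hb : b ∈ Q) (hQ : ConnectedOn G Q) (hQP : Q ⊆ P) : Q = P :=
  hQP.antisymm (h.2 ⟨ha, hb, hQ⟩ hQP)

theorem IsPathSet.symm {a b : V} {P : Set V} (h : IsPathSet G a b P) : IsPathSet G b a P :=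
  ⟨⟨h.right_mem, h.left_mem, h.connectedOn⟩, fun _ hQ hQP => h.2 ⟨hQ.2.1, hQ.1, hQ.2.2⟩ hQP⟩

theorem ConnectedOn.exists_isPathSet [Finite V] {C : Set V} (hC : ConnectedOn G C) {a b : V}
    (ha : a ∈ C) (hb : b ∈ C) : ∃ P ⊆ C, IsPathSet G a b P :=
  Finite.exists_le_minimal (p := fun P => a ∈ P ∧ b ∈ P ∧ ConnectedOn G P) ⟨ha, hb, hC⟩

/-- The initial segment `p 0, …, p n` of `p` is an induced path of length `n`. The values of `p`
beyond `n` are irrelevant. -/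
structure IsIndPath (G : SimpleGraph V) (n : ℕ) (p : ℕ → V) : Prop where
  inj : ∀ i ≤ n, ∀ j ≤ n, p i = p j → i = j
  adj : ∀ i ≤ n, ∀ j ≤ n, (G.Adj (p i) (p j) ↔ j = i + 1 ∨ i = j + 1)

theorem IsIndPath.reverse {n : ℕ} {p : ℕ → V} (h : IsIndPath G n p) :
    IsIndPath G n (fun i => p (n - i)) where
  inj i hi j hj hij := by
    have := h.inj _ (Nat.sub_le n i) _ (Nat.sub_le n j) hij
    omega
  adj i hi j hj := by
    rw [h.adj _ (Nat.sub_le n i) _ (Nat.sub_le n j)]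
    omega

theorem image_sub_Iic (n : ℕ) (p : ℕ → V) : (fun i => p (n - i)) '' Set.Iic n = p '' Set.Iic n := by
  ext v
  constructor
  · rintro ⟨i, -, rfl⟩
    exact ⟨n - i, Nat.sub_le n i, rfl⟩
  · rintro ⟨i, hi, rfl⟩
    exact ⟨n - i, Nat.sub_le n i, congrArg p (Nat.sub_sub_self hi)⟩

theorem IsIndPath.connectedOn_Icc {n : ℕ} {p : ℕ → V} (h : IsIndPath G n p) {l r : ℕ}
    (hlr : l ≤ r) (hr : r ≤ n) : ConnectedOn G (p '' Set.Icc l r) :=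
  connectedOn_image_Icc p hlr fun i _ hir => (h.adj i (by omega) (i + 1) (by omega)).2 (Or.inl rfl)

theorem dist_getVert_of_length_eq_dist (hG : G.Connected) {a b : V} {w : G.Walk a b}
    (hw : w.length = G.dist a b) {i : ℕ} (hi : i ≤ w.length) : G.dist a (w.getVert i) = i := by
  have htake : G.dist a (w.getVert i) ≤ i := by
    simpa [Walk.take_length, hi] using dist_le (w.take i)
  have hdrop : G.dist (w.getVert i) b ≤ w.length - i := by
    simpa [Walk.drop_length] using dist_le (w.drop i)
  have := hG.dist_triangle (u := a) (v := w.getVert i) (w := b)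
  omega

-- Along a shortest path the distance from the start is the index, so adjacent vertices are
-- consecutive.
theorem isIndPath_getVert_of_length_eq_dist (hG : G.Connected) {a b : V} {w : G.Walk a b}
    (hw : w.length = G.dist a b) : IsIndPath G w.length w.getVert := by
  have hdist : ∀ i ≤ w.length, G.dist a (w.getVert i) = i := fun i hi =>
    dist_getVert_of_length_eq_dist hG hw hi
  have hinj : ∀ i ≤ w.length, ∀ j ≤ w.length, w.getVert i = w.getVert j → i = j := by
    intro i hi j hj hij
    rw [← hdist i hi, hij, hdist j hj]
  refine ⟨hinj, fun i hi j hj => ⟨fun hadj => ?_, ?_⟩⟩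
  · have hij : i ≠ j := fun h => hadj.ne (congrArg _ h)
    have hji := hadj.symm.diff_dist_adj (u := a)
    have hij' := hadj.diff_dist_adj (u := a)
    rw [hdist i hi, hdist j hj] at hji hij'
    omega
  · rintro (rfl | rfl)
    · exact w.adj_getVert_succ (by omega)
    · exact (w.adj_getVert_succ (by omega)).symm

theorem ConnectedOn.exists_isIndPath {C : Set V} (hC : ConnectedOn G C) {a b : V} (ha : a ∈ C)
    (hb : b ∈ C) : ∃ (n : ℕ) (p : ℕ → V), p 0 = a ∧ p n = b ∧ (∀ i, p i ∈ C) ∧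
      IsIndPath G n p := by
  obtain ⟨w, hw⟩ := hC.exists_walk_length_eq_dist ⟨a, ha⟩ ⟨b, hb⟩
  have hind := isIndPath_getVert_of_length_eq_dist hC hw
  exact ⟨w.length, fun i => w.getVert i, by simp, by simp, fun i => (w.getVert i).2,
    fun i hi j hj hij => hind.inj i hi j hj (Subtype.ext hij), hind.adj⟩

theorem IsIndPath.isPathSet {n : ℕ} {p : ℕ → V} (h : IsIndPath G n p) :
    IsPathSet G (p 0) (p n) (p '' Set.Iic n) := by
  have hconn : ConnectedOn G (p '' Set.Iic n) :=
    Set.Icc_bot (a := n) ▸ h.connectedOn_Icc n.zero_le le_rfl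
  refine ⟨⟨⟨0, n.zero_le, rfl⟩, ⟨n, le_refl n, rfl⟩, hconn⟩, ?_⟩
  rintro Q ⟨h0, hn, hQ⟩ hQP _ ⟨l, hl : l ≤ n, rfl⟩
  by_contra hlQ
  have hl0 : 0 < l := Nat.pos_of_ne_zero fun h => hlQ (h ▸ h0)
  have hQl : Q ⊆ p '' Set.Iio l := by
    refine hQ.subset_of_closed _ h0 ⟨0, hl0, rfl⟩ ?_
    rintro _ ⟨i, hi : i < l, rfl⟩ - y hy hiy
    obtain ⟨j, hj : j ≤ n, rfl⟩ := hQP hy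
    have hjl : j ≠ l := fun h => hlQ (h ▸ hy)
    have := (h.adj i (by omega) j hj).1 hiy
    exact ⟨j, by simp only [Set.mem_Iio]; omega, rfl⟩
  obtain ⟨i, hi : i < l, hin⟩ := hQl hn
  have := h.inj i (by omega) n le_rfl hin
  omega

theorem IsPathSet.exists_isIndPath {a b : V} {P : Set V} (h : IsPathSet G a b P) :
    ∃ (n : ℕ) (p : ℕ → V), p 0 = a ∧ p n = b ∧ P = p '' Set.Iic n ∧ IsIndPath G n p := by
  obtain ⟨n, p, rfl, rfl, hmem, hp⟩ := h.connectedOn.exists_isIndPath h.left_mem h.right_mem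
  refine ⟨n, p, rfl, rfl, (h.eq_of_subset ?_ ?_ hp.isPathSet.connectedOn ?_).symm, hp⟩
  · exact hp.isPathSet.left_mem
  · exact hp.isPathSet.right_mem
  · exact Set.image_subset_iff.2 fun i _ => hmem i

end InducedPath

section InducedCycle

variable {V : Type*} {G : SimpleGraph V}

/-- The initial segment `f 0, …, f (n - 1)` of `f` lists the vertices of an induced cycle of length
`n` in cyclic order. The values of `f` from `n` on are irrelevant. -/
structure IsIndCycle (G : SimpleGraph V) (n : ℕ) (f : ℕ → V) : Prop where
  three_le : 3 ≤ n
  inj : ∀ i < n, ∀ j < n, f i = f j → i = j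
  adj : ∀ i < n, ∀ j < n, (G.Adj (f i) (f j) ↔
    j = i + 1 ∨ i = j + 1 ∨ (i = 0 ∧ j + 1 = n) ∨ (j = 0 ∧ i + 1 = n))

theorem IsIndCycle.index_of_eq_or_adj {n : ℕ} {f : ℕ → V} (hf : IsIndCycle G n f) {i j : ℕ}
    (hi : i < n) (hj : j < n) (h : f i = f j ∨ G.Adj (f i) (f j)) :
    i = j ∨ j = i + 1 ∨ i = j + 1 ∨ (i = 0 ∧ j + 1 = n) ∨ (j = 0 ∧ i + 1 = n) :=
  h.imp (hf.inj i hi j hj) (hf.adj i hi j hj).1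

theorem cycleGraph_adj_iff_val {n : ℕ} (hn : 3 ≤ n) (i j : Fin n) : (cycleGraph n).Adj i j ↔
    (j : ℕ) = i + 1 ∨ (i : ℕ) = j + 1 ∨ ((i : ℕ) = 0 ∧ j + 1 = n) ∨ ((j : ℕ) = 0 ∧ i + 1 = n) := by
  have val_sub_eq_one : ∀ a b : Fin n, ((a - b : Fin n) : ℕ) = 1 ↔
      (a : ℕ) = b + 1 ∨ ((a : ℕ) = 0 ∧ b + 1 = n) := by
    intro a b
    rcases le_or_gt b a with h | h
    · rw [Fin.sub_val_of_le h]
      omega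
    · rw [Fin.coe_sub_iff_lt.2 h]
      omega
  rw [cycleGraph_adj', val_sub_eq_one, val_sub_eq_one]
  tauto

/-- The rotation of a cycle that moves `k` to the vertex `0`. -/
def cycleGraphRotation {n : ℕ} [NeZero n] (k : Fin n) : cycleGraph n ≃g cycleGraph n where
  toEquiv := Equiv.subRight k
  map_rel_iff' := by simp [cycleGraph_adj']

/-- The reflection of a cycle that fixes the vertex `0`. -/
def cycleGraphReflection (n : ℕ) [NeZero n] : cycleGraph n ≃g cycleGraph n where
  toEquiv := Equiv.neg (Fin n)
  map_rel_iff' {a b} := by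
    simp only [cycleGraph_adj', Equiv.neg_apply, neg_sub_neg]
    exact or_comm

theorem exists_isIndCycle_of_iso {s : Set V} {n : ℕ} (hn : 3 ≤ n)
    (e : G.induce s ≃g cycleGraph n) :
    ∃ f : ℕ → V, IsIndCycle G n f ∧ s = f '' Set.Iio n ∧ ∀ v : s, f (e v) = v := by
  have : NeZero n := ⟨by omega⟩
  have hval : ∀ i (hi : i < n), Fin.ofNat n i = ⟨i, hi⟩ := fun i hi => Fin.ext (Nat.mod_eq_of_lt hi)
  have hfe : ∀ v : s, (e.symm (Fin.ofNat n (e v)) : V) = v := fun v => by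
    rw [hval _ (e v).2, Fin.eta, e.symm_apply_apply]
  refine ⟨fun i => e.symm (Fin.ofNat n i), ⟨hn, fun i hi j hj hij => ?_, fun i hi j hj => ?_⟩, ?_,
    hfe⟩
  · simpa only [hval i hi, hval j hj, Subtype.coe_inj, EmbeddingLike.apply_eq_iff_eq,
      Fin.mk.injEq] using hij
  · rw [← cycleGraph_adj_iff_val hn ⟨i, hi⟩ ⟨j, hj⟩, ← e.symm.map_adj_iff, hval i hi, hval j hj]
    rfl
  · ext v
    constructor
    · intro hv
      exact ⟨e ⟨v, hv⟩, (e ⟨v, hv⟩).2, hfe ⟨v, hv⟩⟩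
    · rintro ⟨i, -, rfl⟩
      exact Subtype.prop _

theorem IsIndCycle.mem_inducedCycles {n : ℕ} {f : ℕ → V} (h : IsIndCycle G n f) :
    f '' Set.Iio n ∈ G.inducedCycles := by
  have hbij : Function.Bijective fun i : Fin n => (⟨f i, i, i.2, rfl⟩ : f '' Set.Iio n) := by
    refine ⟨fun i j hij => Fin.ext (h.inj i i.2 j j.2 (congrArg Subtype.val hij)), ?_⟩
    rintro ⟨_, i, hi, rfl⟩
    exact ⟨⟨i, hi⟩, rfl⟩
  refine ⟨n, h.three_le, ⟨RelIso.symm ⟨Equiv.ofBijective _ hbij, fun {i j} => ?_⟩⟩⟩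
  rw [cycleGraph_adj_iff_val h.three_le, ← h.adj i i.2 j j.2]
  rfl

theorem exists_isIndCycle_start {s : Set V} (hs : s ∈ G.inducedCycles) {x : V} (hx : x ∈ s) :
    ∃ (n : ℕ) (f : ℕ → V), IsIndCycle G n f ∧ s = f '' Set.Iio n ∧ f 0 = x := by
  obtain ⟨n, hn, ⟨e⟩⟩ := hs
  have : NeZero n := ⟨by omega⟩
  obtain ⟨f, hf, hsf, hfe⟩ := exists_isIndCycle_of_iso hn (e.trans (cycleGraphRotation (e ⟨x, hx⟩)))
  exact ⟨n, f, hf, hsf, by simpa [cycleGraphRotation] using hfe ⟨x, hx⟩⟩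

theorem exists_isIndCycle_start_end {s : Set V} (hs : s ∈ G.inducedCycles) {x z : V} (hx : x ∈ s)
    (hz : z ∈ s) (hxz : G.Adj x z) :
    ∃ (n : ℕ) (f : ℕ → V), IsIndCycle G n f ∧ s = f '' Set.Iio n ∧ f 0 = x ∧ f (n - 1) = z := by
  obtain ⟨n, hn, ⟨e⟩⟩ := hs
  have : NeZero n := ⟨by omega⟩
  let e' : G.induce s ≃g cycleGraph n := e.trans (cycleGraphRotation (e ⟨x, hx⟩))
  have he'x : e' ⟨x, hx⟩ = 0 := sub_self _
  have he'z : (e' ⟨z, hz⟩ : ℕ) = 1 ∨ (e' ⟨z, hz⟩ : ℕ) = n - 1 := by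
    have hadj : (cycleGraph n).Adj (e' ⟨z, hz⟩) (e' ⟨x, hx⟩) := e'.map_adj_iff.2 hxz.symm
    rw [he'x, cycleGraph_adj_iff_val hn, Fin.val_zero] at hadj
    omega
  rcases he'z with hone | hlast
  · obtain ⟨f, hf, hsf, hfe⟩ := exists_isIndCycle_of_iso hn (e'.trans (cycleGraphReflection n))
    have hfx := hfe ⟨x, hx⟩
    have hfz := hfe ⟨z, hz⟩
    have hne : e' ⟨z, hz⟩ ≠ 0 := fun h => by simp [h] at hone
    simp only [RelIso.trans_apply, cycleGraphReflection, RelIso.coe_fn_mk, Equiv.neg_apply, he'x,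
      neg_zero, Fin.val_zero] at hfx
    simp only [RelIso.trans_apply, cycleGraphReflection, RelIso.coe_fn_mk, Equiv.neg_apply,
      Fin.val_neg, hne, if_false, hone] at hfz
    exact ⟨n, f, hf, hsf, hfx, hfz⟩
  · obtain ⟨f, hf, hsf, hfe⟩ := exists_isIndCycle_of_iso hn e'
    have hfx := hfe ⟨x, hx⟩
    have hfz := hfe ⟨z, hz⟩
    rw [he'x] at hfx
    rw [hlast] at hfz
    exact ⟨n, f, hf, hsf, hfx, hfz⟩

theorem exists_isIndCycle {s : Set V} (hs : s ∈ G.inducedCycles) :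
    ∃ (n : ℕ) (f : ℕ → V), IsIndCycle G n f ∧ s = f '' Set.Iio n := by
  obtain ⟨n, hn, ⟨e⟩⟩ := hs
  obtain ⟨f, hf, hsf, -⟩ := exists_isIndCycle_of_iso hn e
  exact ⟨n, f, hf, hsf⟩

/-- The sequence `p 0, …, p (n - 1), q 0, q 1, …`. -/
def appendSeq (n : ℕ) (p q : ℕ → V) (i : ℕ) : V :=
  if i < n then p i else q (i - n)

theorem appendSeq_image_Iio (n m : ℕ) (p q : ℕ → V) :
    appendSeq n p q '' Set.Iio (n + m + 1) = p '' Set.Iio n ∪ q '' Set.Iic m := by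
  ext v
  constructor
  · rintro ⟨i, hi : i < n + m + 1, rfl⟩
    by_cases h : i < n
    · exact Or.inl ⟨i, h, by simp [appendSeq, h]⟩
    · exact Or.inr ⟨i - n, by simp only [Set.mem_Iic]; omega, by simp [appendSeq, h]⟩
  · rintro (⟨i, hi : i < n, rfl⟩ | ⟨i, hi : i ≤ m, rfl⟩)
    · exact ⟨i, by simp only [Set.mem_Iio]; omega, by simp [appendSeq, hi]⟩
    · exact ⟨n + i, by simp only [Set.mem_Iio]; omega, by simp [appendSeq]⟩

theorem appendSeq_injOn {n m : ℕ} {p q : ℕ → V} (hp : ∀ i < n, ∀ j < n, p i = p j → i = j)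
    (hq : ∀ i ≤ m, ∀ j ≤ m, q i = q j → i = j) (hpq : ∀ i < n, ∀ j ≤ m, p i ≠ q j) :
    ∀ i < n + m + 1, ∀ j < n + m + 1, appendSeq n p q i = appendSeq n p q j → i = j := by
  intro i hi j hj hij
  unfold appendSeq at hij
  split_ifs at hij with h h' h'
  · exact hp i h j h' hij
  · exact absurd hij (hpq i h _ (by omega))
  · exact absurd hij.symm (hpq j h' _ (by omega))
  · have := hq _ (by omega) _ (by omega) hij
    omega

theorem IsIndPath.append {a b : ℕ} {p q : ℕ → V} (hp : IsIndPath G a p) (hq : IsIndPath G b q)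
    (hab : 1 ≤ a + b) (hpq : ∀ i ≤ a, ∀ j ≤ b, p i ≠ q j)
    (hadj : ∀ i ≤ a, ∀ j ≤ b, (G.Adj (p i) (q j) ↔ (i = a ∧ j = 0) ∨ (i = 0 ∧ j = b))) :
    IsIndCycle G (a + 1 + b + 1) (appendSeq (a + 1) p q) where
  three_le := by omega
  inj := appendSeq_injOn (fun i hi j hj => hp.inj i (by omega) j (by omega)) hq.inj
    fun i hi => hpq i (by omega)
  adj i hi j hj := by
    unfold appendSeq
    split_ifs with h h' h'
    · rw [hp.adj _ (by omega) _ (by omega)]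
      omega
    · rw [hadj _ (by omega) _ (by omega)]
      omega
    · rw [G.adj_comm, hadj _ (by omega) _ (by omega)]
      omega
    · rw [hq.adj _ (by omega) _ (by omega)]
      omega

theorem IsIndPath.union_mem_inducedCycles {a b : ℕ} {p q : ℕ → V} (hp : IsIndPath G a p)
    (hq : IsIndPath G b q) (hab : 1 ≤ a + b) (hpq : ∀ i ≤ a, ∀ j ≤ b, p i ≠ q j)
    (hadj : ∀ i ≤ a, ∀ j ≤ b, (G.Adj (p i) (q j) ↔ (i = a ∧ j = 0) ∨ (i = 0 ∧ j = b))) :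
    p '' Set.Iic a ∪ q '' Set.Iic b ∈ G.inducedCycles := by
  have hIic : Set.Iic a = Set.Iio (a + 1) := Set.ext fun _ => Nat.lt_succ_iff.symm
  rw [hIic, ← appendSeq_image_Iio]
  exact (hp.append hq hab hpq hadj).mem_inducedCycles

theorem isIndPath_zero (p : ℕ → V) : IsIndPath G 0 p where
  inj i hi j hj _ := by omega
  adj i hi j hj := by
    rw [Nat.le_zero.1 hi, Nat.le_zero.1 hj]
    simp

theorem IsIndCycle.isIndPath_tail {n : ℕ} {f : ℕ → V} (h : IsIndCycle G n f) :
    IsIndPath G (n - 2) (fun i => f (i + 1)) where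
  inj i hi j hj hij := by
    have := h.three_le
    have := h.inj _ (by omega) _ (by omega) hij
    omega
  adj i hi j hj := by
    have := h.three_le
    rw [h.adj _ (by omega) _ (by omega)]
    omega

theorem IsIndCycle.image_tail {n : ℕ} {f : ℕ → V} (h : IsIndCycle G n f) :
    (fun i => f (i + 1)) '' Set.Iic (n - 2) = f '' Set.Iio n \ {f 0} := by
  have hn := h.three_le
  ext v
  constructor
  · rintro ⟨i, hi : i ≤ n - 2, rfl⟩
    refine ⟨⟨i + 1, by simp only [Set.mem_Iio]; omega, rfl⟩, fun hi0 => ?_⟩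
    have := h.inj _ (by omega) _ (by omega) hi0
    omega
  · rintro ⟨⟨i, hi : i < n, rfl⟩, hi0⟩
    have hi0' : i ≠ 0 := fun h => hi0 (congrArg f h)
    exact ⟨i - 1, by simp only [Set.mem_Iic]; omega, congrArg f (by omega)⟩

theorem IsPathSet.insert_mem_inducedCycles {a b x : V} {P : Set V} (hP : IsPathSet G a b P)
    (hab : a ≠ b) (hx : ∀ v ∈ P, (G.Adj x v ↔ v = a ∨ v = b)) (hxP : x ∉ P) :
    insert x P ∈ G.inducedCycles := by
  obtain ⟨n, p, rfl, rfl, rfl, hp⟩ := hP.exists_isIndPath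
  have hn : n ≠ 0 := fun h => hab (congrArg p h.symm)
  have hunion := (isIndPath_zero (G := G) fun _ => x).union_mem_inducedCycles hp (by omega)
    (fun _ _ j hj h => hxP ⟨j, hj, h.symm⟩) fun i hi j hj => by
      rw [hx _ ⟨j, hj, rfl⟩]
      have hj0 : p j = p 0 ↔ j = 0 := ⟨hp.inj j hj 0 (by omega), congrArg p⟩
      have hjn : p j = p n ↔ j = n := ⟨hp.inj j hj n le_rfl, congrArg p⟩
      rw [hj0, hjn]
      omega
  rwa [show (Set.Iic 0 : Set ℕ) = {0} from Set.Iic_bot, Set.image_singleton,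
    Set.singleton_union] at hunion

theorem exists_isPathSet_of_mem_inducedCycles {s : Set V} (hs : s ∈ G.inducedCycles) {x : V}
    (hx : x ∈ s) : ∃ a b, a ≠ b ∧ IsPathSet G a b (s \ {x}) ∧
      ∀ v ∈ s \ {x}, (G.Adj x v ↔ v = a ∨ v = b) := by
  obtain ⟨n, f, hf, rfl, rfl⟩ := exists_isIndCycle_start hs hx
  have hn := hf.three_le
  have hpath := hf.isIndPath_tail.isPathSet
  rw [hf.image_tail, Nat.zero_add, show n - 2 + 1 = n - 1 by omega] at hpath
  refine ⟨f 1, f (n - 1), fun h => ?_, hpath, ?_⟩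
  · have := hf.inj _ (by omega) _ (by omega) h
    omega
  · rintro v ⟨⟨i, hi : i < n, rfl⟩, -⟩
    have hi1 : f i = f 1 ↔ i = 1 := ⟨hf.inj i hi 1 (by omega), congrArg f⟩
    have hin : f i = f (n - 1) ↔ i = n - 1 := ⟨hf.inj i hi _ (by omega), congrArg f⟩
    rw [hf.adj _ (by omega) _ hi, hi1, hin]
    omega

end InducedCycle

section ThreePath

variable {V W : Type*} {G : SimpleGraph V} {H : SimpleGraph W}

/-- The union of the paths `g i 0, …, g i (L i)` for `i = 0, 1, 2` is `s`, these paths are disjoint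
except that initial vertices may coincide and terminal vertices may coincide, and every edge of
`G` inside `s` lies on one of them or joins two initial or two terminal vertices. This is the common
shape of the trihedra, the stamps and the prisms. -/
structure IsThreePath (G : SimpleGraph V) (s : Set V) (L : Fin 3 → ℕ) (g : Fin 3 → ℕ → V) :
    Prop where
  mem : ∀ i, ∀ t ≤ L i, g i t ∈ s
  adj : ∀ i, ∀ t < L i, G.Adj (g i t) (g i (t + 1))
  inj : ∀ i, ∀ t ≤ L i, ∀ t' ≤ L i, g i t = g i t' → t = t'
  meet : ∀ i j, i ≠ j → ∀ t ≤ L i, ∀ t' ≤ L j, g i t = g j t' →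
    (t = 0 ∧ t' = 0) ∨ (t = L i ∧ t' = L j)
  cover : ∀ v ∈ s, ∃ i, ∃ t ≤ L i, g i t = v
  edge : ∀ u ∈ s, ∀ v ∈ s, G.Adj u v →
    (∃ i, ∃ t < L i, s(g i t, g i (t + 1)) = s(u, v)) ∨
    (∃ i j, g i 0 = u ∧ g j 0 = v) ∨ ∃ i j, g i (L i) = u ∧ g j (L j) = v

theorem exists_walk_getVert_eq {L : ℕ} {g : ℕ → W} (hadj : ∀ t < L, H.Adj (g t) (g (t + 1))) :
    ∃ w : H.Walk (g 0) (g L), w.length = L ∧ ∀ t ≤ L, w.getVert t = g t := by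
  induction L with
  | zero => exact ⟨Walk.nil, rfl, fun t ht => by simp [Nat.le_zero.1 ht]⟩
  | succ L ih =>
    obtain ⟨w, hlen, hget⟩ := ih fun t ht => hadj t (ht.trans L.lt_succ_self)
    refine ⟨w.concat (hadj L L.lt_succ_self), by simp [hlen], fun t ht => ?_⟩
    rcases ht.lt_or_eq with h | rfl
    · rw [Walk.concat_eq_append, Walk.getVert_append, hlen]
      split_ifs with htL
      · exact hget t htL.le
      · obtain rfl : t = L := by omega
        simp
    · exact Walk.getVert_of_length_le _ (by simp [hlen])

theorem IsThreePath.exists_walk {s : Set V} {L : Fin 3 → ℕ} {g : Fin 3 → ℕ → V}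
    (h : IsThreePath G s L g) (i : Fin 3) {a b : s} (ha : g i 0 = a) (hb : g i (L i) = b) :
    ∃ w : (G.induce s).Walk a b, w.length = L i ∧ ∀ t ≤ L i, (w.getVert t : V) = g i t := by
  let g' : ℕ → s := fun t => if ht : t ≤ L i then ⟨g i t, h.mem i t ht⟩ else a
  have hg' : ∀ t ≤ L i, (g' t : V) = g i t := fun t ht => by simp [g', ht]
  obtain ⟨w, hlen, hget⟩ := exists_walk_getVert_eq (H := G.induce s) (L := L i) (g := g')
    fun t ht => by simpa [hg' t ht.le, hg' (t + 1) ht] using h.adj i t ht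
  refine ⟨w.copy (Subtype.ext ?_) (Subtype.ext ?_), by simpa using hlen, fun t ht => ?_⟩
  · rw [hg' 0 (Nat.zero_le _), ha]
  · rw [hg' _ le_rfl, hb]
  · rw [Walk.getVert_copy, hget t ht, hg' t ht]

theorem IsThreePath.exists_isPath {s : Set V} {L : Fin 3 → ℕ} {g : Fin 3 → ℕ → V}
    (h : IsThreePath G s L g) (i : Fin 3) {a b : s} (ha : g i 0 = a) (hb : g i (L i) = b) :
    ∃ w : (G.induce s).Walk a b, w.IsPath ∧ w.length = L i ∧
      (∀ z : s, z ∈ w.support ↔ ∃ t ≤ L i, g i t = z) ∧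
      ∀ t < L i, ∀ u v : s, s(g i t, g i (t + 1)) = s(↑u, ↑v) → w.toSubgraph.Adj u v := by
  obtain ⟨w, hlen, hget⟩ := h.exists_walk i ha hb
  refine ⟨w, ?_, hlen, fun z => ?_, fun t ht u v htuv => ?_⟩
  · rw [← Walk.IsPath.getVert_injOn_iff]
    intro t ht t' ht' htt'
    rw [Set.mem_ofPred_eq, hlen] at ht ht'
    refine h.inj i t ht t' ht' ?_
    rw [← hget t ht, ← hget t' ht', htt']
  · rw [Walk.mem_support_iff_exists_getVert]
    constructor
    · rintro ⟨t, rfl, ht⟩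
      exact ⟨t, hlen ▸ ht, (hget t (hlen ▸ ht)).symm⟩
    · rintro ⟨t, ht, hz⟩
      exact ⟨t, Subtype.ext ((hget t ht).trans hz), hlen.symm ▸ ht⟩
  · refine (Walk.toSubgraph_adj_iff _).2 ⟨t, ?_, by rwa [hlen]⟩
    rw [← hget t ht.le, ← hget (t + 1) ht] at htuv
    simpa [Subtype.ext_iff] using htuv

theorem IsThreePath.exists_walks {s : Set V} {L : Fin 3 → ℕ} {g : Fin 3 → ℕ → V}
    (h : IsThreePath G s L g) {a b : Fin 3 → s} (ha : ∀ i, g i 0 = a i)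
    (hb : ∀ i, g i (L i) = b i) :
    ∃ p : ∀ i, (G.induce s).Walk (a i) (b i),
      (∀ i, (p i).IsPath ∧ (p i).length = L i) ∧
      (∀ i j, i ≠ j → ∀ z ∈ (p i).support, z ∈ (p j).support →
        (z = a i ∧ z = a j) ∨ (z = b i ∧ z = b j)) ∧
      (⊤ : (G.induce s).Subgraph).induce (Set.range a) ⊔
        (⊤ : (G.induce s).Subgraph).induce (Set.range b) ⊔ (⨆ i, (p i).toSubgraph) = ⊤ := by
  choose p hpath hlen hsupp hedge using fun i => h.exists_isPath i (ha i) (hb i)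
  refine ⟨p, fun i => ⟨hpath i, hlen i⟩, ?_, ?_⟩
  · intro i j hij z hzi hzj
    obtain ⟨t, ht, htz⟩ := (hsupp i z).1 hzi
    obtain ⟨t', ht', htz'⟩ := (hsupp j z).1 hzj
    simp only [Subtype.ext_iff, ← ha, ← hb, ← htz]
    rcases h.meet i j hij t ht t' ht' (htz.trans htz'.symm) with ⟨rfl, rfl⟩ | ⟨rfl, rfl⟩
    · exact Or.inl ⟨rfl, htz.trans htz'.symm⟩
    · exact Or.inr ⟨rfl, htz.trans htz'.symm⟩
  · refine eq_top_iff.2 ⟨fun z _ => ?_, fun u v huv => ?_⟩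
    · simp only [Subgraph.verts_sup, Subgraph.verts_iSup, Set.mem_union, Set.mem_iUnion]
      obtain ⟨i, hi⟩ := h.cover z z.2
      exact Or.inr ⟨i, (Walk.mem_verts_toSubgraph _).2 ((hsupp i z).2 hi)⟩
    · simp only [Subgraph.sup_adj, Subgraph.iSup_adj, Subgraph.induce_adj, Subgraph.top_adj]
      rcases h.edge u u.2 v v.2 huv with ⟨i, t, ht, htuv⟩ | ⟨i, j, hiu, hjv⟩ | ⟨i, j, hiu, hjv⟩
      · exact Or.inr ⟨i, hedge i t ht u v htuv⟩
      · rw [ha] at hiu hjv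
        exact Or.inl (Or.inl ⟨⟨i, Subtype.ext hiu⟩, ⟨j, Subtype.ext hjv⟩, huv⟩)
      · rw [hb] at hiu hjv
        exact Or.inl (Or.inr ⟨⟨i, Subtype.ext hiu⟩, ⟨j, Subtype.ext hjv⟩, huv⟩)

theorem induce_range_const_le_iSup {K : W} {ι : Type*} [Nonempty ι] {P : ι → H.Subgraph}
    (hK : ∀ i, K ∈ (P i).verts) :
    (⊤ : H.Subgraph).induce (Set.range fun _ : ι => K) ≤ ⨆ i, P i := by
  rw [Set.range_const, ← Subgraph.singletonSubgraph_eq_induce, singletonSubgraph_le_iff,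
    Subgraph.verts_iSup, Set.mem_iUnion]
  exact ⟨Classical.arbitrary ι, hK _⟩

theorem IsThreePath.mem_solids_of_trihedron {s : Set V} {L : Fin 3 → ℕ} {g : Fin 3 → ℕ → V}
    (h : IsThreePath G s L g) (hL : ∀ i, 2 ≤ L i) (hstart : ∀ i, g i 0 = g 0 0)
    (hend : ∀ i, g i (L i) = g 0 (L 0)) : s ∈ G.solids := by
  let x : s := ⟨g 0 0, h.mem 0 0 (Nat.zero_le _)⟩
  let y : s := ⟨g 0 (L 0), h.mem 0 _ le_rfl⟩
  have hxy : x ≠ y := fun hxy => by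
    have := h.inj 0 0 (Nat.zero_le _) (L 0) le_rfl (congrArg Subtype.val hxy)
    have := hL 0
    omega
  obtain ⟨p, hp, hmeet, htop⟩ := h.exists_walks (a := fun _ => x) (b := fun _ => y) hstart hend
  rw [sup_eq_right.2 (sup_le (induce_range_const_le_iSup fun i => (p i).start_mem_verts_toSubgraph)
    (induce_range_const_le_iSup fun i => (p i).end_mem_verts_toSubgraph))] at htop
  exact Or.inr (Or.inl ⟨x, y, p, hxy, fun i => ⟨(hp i).1, (hp i).2.symm ▸ hL i⟩,
    fun i j hij z hi hj => (hmeet i j hij z hi hj).imp And.left And.left, htop⟩)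

theorem IsThreePath.mem_solids_of_stamp {s : Set V} {L : Fin 3 → ℕ} {g : Fin 3 → ℕ → V}
    (h : IsThreePath G s L g) (hL : ∀ i, 1 ≤ L i)
    (hstart : ∀ i j, i ≠ j → G.Adj (g i 0) (g j 0))
    (hend : ∀ i, g i (L i) = g 0 (L 0)) : s ∈ G.solids := by
  let a : Fin 3 → s := fun i => ⟨g i 0, h.mem i 0 (Nat.zero_le _)⟩
  let x : s := ⟨g 0 (L 0), h.mem 0 _ le_rfl⟩
  obtain ⟨p, hp, hmeet, htop⟩ := h.exists_walks (a := a) (b := fun _ => x) (fun _ => rfl) hend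
  rw [sup_assoc,
    sup_eq_right.2 (induce_range_const_le_iSup fun i => (p i).end_mem_verts_toSubgraph)] at htop
  refine Or.inr (Or.inr (Or.inl ⟨a, x, p, hstart, fun i => ⟨(hp i).1, (hp i).2.symm ▸ hL i⟩,
    fun i j hij z hi hj => ?_, htop⟩))
  rcases hmeet i j hij z hi hj with ⟨hzi, hzj⟩ | ⟨hzx, -⟩
  · exact absurd (congrArg Subtype.val (hzi.symm.trans hzj)) (hstart i j hij).ne
  · exact hzx

theorem IsThreePath.mem_solids_of_prism {s : Set V} {L : Fin 3 → ℕ} {g : Fin 3 → ℕ → V}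
    (h : IsThreePath G s L g) (hL : ∀ i, 1 ≤ L i)
    (hstart : ∀ i j, i ≠ j → G.Adj (g i 0) (g j 0))
    (hend : ∀ i j, i ≠ j → G.Adj (g i (L i)) (g j (L j))) : s ∈ G.solids := by
  let a : Fin 3 → s := fun i => ⟨g i 0, h.mem i 0 (Nat.zero_le _)⟩
  let b : Fin 3 → s := fun i => ⟨g i (L i), h.mem i _ le_rfl⟩
  have hab : ∀ i j, a i ≠ b j := by
    intro i j hij
    have hij' : g i 0 = g j (L j) := congrArg Subtype.val hij
    have := hL i
    have := hL j
    rcases eq_or_ne i j with rfl | hne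
    · have := h.inj i 0 (Nat.zero_le _) (L i) le_rfl hij'
      omega
    · have := h.meet i j hne 0 (Nat.zero_le _) (L j) le_rfl hij'
      omega
  obtain ⟨p, hp, hmeet, htop⟩ := h.exists_walks (a := a) (b := b) (fun _ => rfl) fun _ => rfl
  refine Or.inr (Or.inr (Or.inr ⟨a, b, p, hstart, hend, hab, fun i => (hp i).1,
    fun i j hij z hi hj => ?_, htop⟩))
  rcases hmeet i j hij z hi hj with ⟨hzi, hzj⟩ | ⟨hzi, hzj⟩
  · exact (hstart i j hij).ne (congrArg Subtype.val (hzi.symm.trans hzj))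
  · exact (hend i j hij).ne (congrArg Subtype.val (hzi.symm.trans hzj))

end ThreePath

theorem insert_mem_solids_of_pyramid {V : Type*} {G : SimpleGraph V} {D : Set V}
    (hD : D ∈ G.inducedCycles) {w : V} (hw : w ∉ D) {a b c : V} (ha : a ∈ D) (hb : b ∈ D)
    (hc : c ∈ D) (hab : a ≠ b) (hac : a ≠ c) (hbc : b ≠ c) (hwa : G.Adj w a) (hwb : G.Adj w b)
    (hwc : G.Adj w c) : insert w D ∈ G.solids := by
  let w' : (insert w D : Set V) := ⟨w, Or.inl rfl⟩
  obtain ⟨n, hn, ⟨e⟩⟩ := hD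
  have hfin : Finite D := Finite.of_equiv _ e.symm.toEquiv
  have hmem : ∀ v : ({w'}ᶜ : Set (insert w D : Set V)), v.1.1 ∈ D := fun v =>
    v.1.2.resolve_left fun h => v.2 (Subtype.ext h)
  have hne : ∀ v : D, (⟨v, Or.inr v.2⟩ : (insert w D : Set V)) ∈ ({w'}ᶜ : Set _) := fun v h =>
    hw (have hvw : (v : V) = w := congrArg Subtype.val h
      hvw ▸ v.2)
  let e' : ({w'}ᶜ : Set (insert w D : Set V)) ≃ D :=
    ⟨fun v => ⟨v.1.1, hmem v⟩, fun v => ⟨⟨v, Or.inr v.2⟩, hne v⟩, fun _ => rfl, fun _ => rfl⟩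
  refine Or.inl ⟨w', ⟨n, hn, ⟨RelIso.trans ⟨e', Iff.rfl⟩ e⟩⟩, ?_⟩
  have hsub : ({⟨a, Or.inr ha⟩, ⟨b, Or.inr hb⟩, ⟨c, Or.inr hc⟩} : Set (insert w D : Set V)) ⊆
      (G.induce (insert w D)).neighborSet w' := by
    rintro v (rfl | rfl | rfl)
    exacts [hwa, hwb, hwc]
  refine le_trans (Set.ncard_eq_three.2 ⟨_, _, _, ?_, ?_, ?_, rfl⟩).symm.le
    (Set.ncard_le_ncard hsub (Set.toFinite _))
  exacts [fun h => hab (congrArg Subtype.val h), fun h => hac (congrArg Subtype.val h),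
    fun h => hbc (congrArg Subtype.val h)]

section CyclePath

variable {V : Type*} {G : SimpleGraph V}

/-- The induced subgraph of `G` on `c 0, …, c (N - 1)` is a copy of the induced subgraph of `H` on
`0, …, N - 1`. It transfers subdivisions found among natural numbers, where they can be verified
by arithmetic, to `G`. -/
structure IsListing (G : SimpleGraph V) (H : SimpleGraph ℕ) (N : ℕ) (c : ℕ → V) : Prop where
  inj : ∀ i < N, ∀ j < N, c i = c j → i = j
  adj : ∀ i < N, ∀ j < N, (G.Adj (c i) (c j) ↔ H.Adj i j)

theorem IsListing.map_isThreePath {H : SimpleGraph ℕ} {N : ℕ} {c : ℕ → V} {L : Fin 3 → ℕ}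
    {g : Fin 3 → ℕ → ℕ} (hc : IsListing G H N c) (h : IsThreePath H (Set.Iio N) L g) :
    IsThreePath G (c '' Set.Iio N) L fun i t => c (g i t) where
  mem i t ht := ⟨g i t, h.mem i t ht, rfl⟩
  adj i t ht := (hc.adj _ (h.mem i t ht.le) _ (h.mem i _ ht)).2 (h.adj i t ht)
  inj i t ht t' ht' htt' :=
    h.inj i t ht t' ht' (hc.inj _ (h.mem i t ht) _ (h.mem i t' ht') htt')
  meet i j hij t ht t' ht' htt' :=
    h.meet i j hij t ht t' ht' (hc.inj _ (h.mem i t ht) _ (h.mem j t' ht') htt')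
  cover := by
    rintro _ ⟨v, hv, rfl⟩
    obtain ⟨i, t, ht, rfl⟩ := h.cover v hv
    exact ⟨i, t, ht, rfl⟩
  edge := by
    rintro _ ⟨u, hu, rfl⟩ _ ⟨v, hv, rfl⟩ huv
    rcases h.edge u hu v hv ((hc.adj u hu v hv).1 huv) with
      ⟨i, t, ht, htuv⟩ | ⟨i, j, rfl, rfl⟩ | ⟨i, j, rfl, rfl⟩
    · exact Or.inl ⟨i, t, ht, by simpa using congrArg (Sym2.map c) htuv⟩
    · exact Or.inr (Or.inl ⟨i, j, rfl, rfl⟩)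
    · exact Or.inr (Or.inr ⟨i, j, rfl, rfl⟩)

/-- The cycle `0, …, n - 1` and the path `n, n + 1, …` with the cross edges between the vertex `i`
of the cycle and the vertex `n + j` of the path for all `i` and `j` with `X i j`. -/
def cyclePathGraph (n : ℕ) (X : ℕ → ℕ → Prop) : SimpleGraph ℕ :=
  fromRel fun i j => (i + 1 = j ∧ j ≠ n) ∨ (i = 0 ∧ j + 1 = n) ∨ (i < n ∧ n ≤ j ∧ X i (j - n))

theorem cyclePathGraph_adj_of_lt {n : ℕ} (hn : 3 ≤ n) {X : ℕ → ℕ → Prop} {i j : ℕ} (hij : i < j) :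
    (cyclePathGraph n X).Adj i j ↔
      (i + 1 = j ∧ j ≠ n) ∨ (i = 0 ∧ j + 1 = n) ∨ (i < n ∧ n ≤ j ∧ X i (j - n)) := by
  rw [cyclePathGraph, fromRel_adj]
  grind

theorem isListing_cyclePathGraph {n m : ℕ} {f y : ℕ → V} {X : ℕ → ℕ → Prop}
    (hf : IsIndCycle G n f) (hy : IsIndPath G m y) (hd : ∀ i < n, ∀ j ≤ m, f i ≠ y j)
    (hX : ∀ i < n, ∀ j ≤ m, (G.Adj (f i) (y j) ↔ X i j)) :
    IsListing G (cyclePathGraph n X) (n + m + 1) (appendSeq n f y) := by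
  have hn := hf.three_le
  refine ⟨appendSeq_injOn hf.inj hy.inj hd, fun i hi j hj => ?_⟩
  wlog hij : i < j generalizing i j
  · rcases (not_lt.1 hij).eq_or_lt with rfl | hji
    · simp
    · rw [G.adj_comm, (cyclePathGraph n X).adj_comm, this j hj i hi hji]
  rw [cyclePathGraph_adj_of_lt hn hij]
  unfold appendSeq
  split_ifs with h1 h2 h2
  · rw [hf.adj i h1 j h2]
    omega
  · rw [hX i h1 _ (by omega)]
    grind
  · omega
  · rw [hy.adj _ (by omega) _ (by omega)]
    omega

theorem isThreePath_of_lt {H : SimpleGraph ℕ} {N L₀ L₁ L₂ : ℕ} {g₀ g₁ g₂ : ℕ → ℕ}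
    (mem : (∀ t ≤ L₀, g₀ t < N) ∧ (∀ t ≤ L₁, g₁ t < N) ∧ ∀ t ≤ L₂, g₂ t < N)
    (adj : (∀ t < L₀, H.Adj (g₀ t) (g₀ (t + 1))) ∧ (∀ t < L₁, H.Adj (g₁ t) (g₁ (t + 1))) ∧
      ∀ t < L₂, H.Adj (g₂ t) (g₂ (t + 1)))
    (inj : (∀ t ≤ L₀, ∀ t' ≤ L₀, g₀ t = g₀ t' → t = t') ∧
      (∀ t ≤ L₁, ∀ t' ≤ L₁, g₁ t = g₁ t' → t = t') ∧ ∀ t ≤ L₂, ∀ t' ≤ L₂, g₂ t = g₂ t' → t = t')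
    (meet : (∀ t ≤ L₀, ∀ t' ≤ L₁, g₀ t = g₁ t' → t = 0 ∧ t' = 0 ∨ t = L₀ ∧ t' = L₁) ∧
      (∀ t ≤ L₀, ∀ t' ≤ L₂, g₀ t = g₂ t' → t = 0 ∧ t' = 0 ∨ t = L₀ ∧ t' = L₂) ∧
      ∀ t ≤ L₁, ∀ t' ≤ L₂, g₁ t = g₂ t' → t = 0 ∧ t' = 0 ∨ t = L₁ ∧ t' = L₂)
    (cover : ∀ v < N, (∃ t ≤ L₀, g₀ t = v) ∨ (∃ t ≤ L₁, g₁ t = v) ∨ ∃ t ≤ L₂, g₂ t = v)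
    (edge : ∀ u v, u < v → v < N → H.Adj u v →
      (∃ t < L₀, s(g₀ t, g₀ (t + 1)) = s(u, v)) ∨ (∃ t < L₁, s(g₁ t, g₁ (t + 1)) = s(u, v)) ∨
      (∃ t < L₂, s(g₂ t, g₂ (t + 1)) = s(u, v)) ∨
      ((g₀ 0 = u ∨ g₁ 0 = u ∨ g₂ 0 = u) ∧ (g₀ 0 = v ∨ g₁ 0 = v ∨ g₂ 0 = v)) ∨
      (g₀ L₀ = u ∨ g₁ L₁ = u ∨ g₂ L₂ = u) ∧ (g₀ L₀ = v ∨ g₁ L₁ = v ∨ g₂ L₂ = v)) :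
    IsThreePath H (Set.Iio N) ![L₀, L₁, L₂] ![g₀, g₁, g₂] := by
  have edge' : ∀ u v, u < v → v < N → H.Adj u v →
      (∃ i, ∃ t < ![L₀, L₁, L₂] i, s(![g₀, g₁, g₂] i t, ![g₀, g₁, g₂] i (t + 1)) = s(u, v)) ∨
      (∃ i j, ![g₀, g₁, g₂] i 0 = u ∧ ![g₀, g₁, g₂] j 0 = v) ∨
      ∃ i j, ![g₀, g₁, g₂] i (![L₀, L₁, L₂] i) = u ∧ ![g₀, g₁, g₂] j (![L₀, L₁, L₂] j) = v := by
    simpa [Fin.exists_fin_succ, or_assoc, ← and_or_left, ← or_and_right] using edge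
  refine ⟨by simpa [Fin.forall_fin_succ] using mem, by simpa [Fin.forall_fin_succ] using adj,
    by simpa [Fin.forall_fin_succ] using inj, ?_, by simpa [Fin.exists_fin_succ] using cover,
    fun u hu v hv huv => ?_⟩
  · simp [Fin.forall_fin_succ]
    grind
  · rcases huv.ne.lt_or_gt with huv' | hvu
    · exact edge' u v huv' hv huv
    · rcases edge' v u hvu hu huv.symm with ⟨i, t, ht, h⟩ | ⟨i, j, h⟩ | ⟨i, j, h⟩
      · exact Or.inl ⟨i, t, ht, h.trans Sym2.eq_swap⟩
      · exact Or.inr (Or.inl ⟨j, i, h.symm⟩)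
      · exact Or.inr (Or.inr ⟨j, i, h.symm⟩)

theorem isThreePath_single_single {n m k : ℕ} (hk : 2 ≤ k) (hkn : k + 2 ≤ n) :
    IsThreePath (cyclePathGraph n fun i j => (i = 0 ∧ j = 0) ∨ (i = k ∧ j = m))
      (Set.Iio (n + m + 1)) ![k, n - k, m + 2]
      ![fun t => t, fun t => if t = 0 then 0 else n - t,
        fun t => if t = 0 then 0 else if t ≤ m + 1 then n + t - 1 else k] := by
  refine isThreePath_of_lt (by grind) (by grind [cyclePathGraph, fromRel_adj]) (by grind)
    (by grind) (fun v hv => ?_) fun u v huv hv hadj => ?_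
  · rcases (show v ≤ k ∨ (k < v ∧ v < n) ∨ n ≤ v by omega) with h | h | h
    · exact Or.inl ⟨v, h, rfl⟩
    · exact Or.inr (Or.inl ⟨n - v, by grind⟩)
    · exact Or.inr (Or.inr ⟨v - n + 1, by grind⟩)
  · rw [cyclePathGraph_adj_of_lt (by omega) huv] at hadj
    rcases (show (u + 1 ≤ k ∧ v = u + 1) ∨ (k ≤ u ∧ v = u + 1 ∧ v < n) ∨ (u = 0 ∧ v + 1 = n) ∨
      (n ≤ u ∧ v = u + 1) ∨ (u = 0 ∧ v = n) ∨ (u = k ∧ v = n + m) by omega)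
      with h | h | h | h | h | h
    · exact Or.inl ⟨u, by grind⟩
    · exact Or.inr (Or.inl ⟨n - v, by grind⟩)
    · exact Or.inr (Or.inl ⟨0, by grind⟩)
    · exact Or.inr (Or.inr (Or.inl ⟨u - n + 1, by grind⟩))
    · exact Or.inr (Or.inr (Or.inl ⟨0, by grind⟩))
    · exact Or.inr (Or.inr (Or.inl ⟨m + 1, by grind⟩))

theorem isThreePath_edge_single {n m k : ℕ} (hk : 1 ≤ k) (hkn : k + 2 ≤ n) :
    IsThreePath (cyclePathGraph n fun i j => (j = 0 ∧ (i = 0 ∨ i + 1 = n)) ∨ (j = m ∧ i = k))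
      (Set.Iio (n + m + 1)) ![m + 1, k, n - 1 - k]
      ![fun t => if t ≤ m then n + t else k, fun t => t, fun t => n - 1 - t] := by
  refine isThreePath_of_lt (by grind) (by grind [cyclePathGraph, fromRel_adj]) (by grind)
    (by grind) (fun v hv => ?_) fun u v huv hv hadj => ?_
  · rcases (show v ≤ k ∨ (k < v ∧ v < n) ∨ n ≤ v by omega) with h | h | h
    · exact Or.inr (Or.inl ⟨v, h, rfl⟩)
    · exact Or.inr (Or.inr ⟨n - 1 - v, by grind⟩)
    · exact Or.inl ⟨v - n, by grind⟩
  · rw [cyclePathGraph_adj_of_lt (by omega) huv] at hadj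
    rcases (show (u + 1 ≤ k ∧ v = u + 1) ∨ (k ≤ u ∧ v = u + 1 ∧ v < n) ∨
      ((u = 0 ∨ u + 1 = n) ∧ v = n ∨ u = 0 ∧ v + 1 = n) ∨ (n ≤ u ∧ v = u + 1) ∨
      (u = k ∧ v = n + m) by omega) with h | h | h | h | h
    · exact Or.inr (Or.inl ⟨u, by grind⟩)
    · exact Or.inr (Or.inr (Or.inl ⟨n - 1 - v, by grind⟩))
    · exact Or.inr (Or.inr (Or.inr (Or.inl (by grind))))
    · exact Or.inl ⟨u - n, by grind⟩
    · exact Or.inl ⟨m, by grind⟩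

theorem isThreePath_edge_edge {n m k : ℕ} (hm : 1 ≤ m) (hk : 1 ≤ k) (hkn : k + 3 ≤ n) :
    IsThreePath (cyclePathGraph n fun i j =>
        (j = 0 ∧ (i = 0 ∨ i + 1 = n)) ∨ (j = m ∧ (i = k ∨ i = k + 1)))
      (Set.Iio (n + m + 1)) ![m, k, n - 2 - k]
      ![fun t => n + t, fun t => t, fun t => n - 1 - t] := by
  refine isThreePath_of_lt (by grind) (by grind [cyclePathGraph, fromRel_adj]) (by grind)
    (by grind) (fun v hv => ?_) fun u v huv hv hadj => ?_
  · rcases (show v ≤ k ∨ (k < v ∧ v < n) ∨ n ≤ v by omega) with h | h | h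
    · exact Or.inr (Or.inl ⟨v, h, rfl⟩)
    · exact Or.inr (Or.inr ⟨n - 1 - v, by grind⟩)
    · exact Or.inl ⟨v - n, by grind⟩
  · rw [cyclePathGraph_adj_of_lt (by omega) huv] at hadj
    rcases (show (u + 1 ≤ k ∧ v = u + 1) ∨ (k + 1 ≤ u ∧ v = u + 1 ∧ v < n) ∨
      ((u = 0 ∨ u + 1 = n) ∧ v = n ∨ u = 0 ∧ v + 1 = n) ∨ (n ≤ u ∧ v = u + 1) ∨
      ((u = k ∨ u = k + 1) ∧ v = n + m ∨ u = k ∧ v = k + 1) by omega) with h | h | h | h | h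
    · exact Or.inr (Or.inl ⟨u, by grind⟩)
    · exact Or.inr (Or.inr (Or.inl ⟨n - 1 - v, by grind⟩))
    · exact Or.inr (Or.inr (Or.inr (Or.inl (by grind))))
    · exact Or.inl ⟨u - n, by grind⟩
    · exact Or.inr (Or.inr (Or.inr (Or.inr (by grind))))

variable {n m k : ℕ} {f y : ℕ → V}

theorem union_mem_solids_of_single_single (hf : IsIndCycle G n f) (hy : IsIndPath G m y)
    (hd : ∀ i < n, ∀ j ≤ m, f i ≠ y j) (hk : 2 ≤ k) (hkn : k + 2 ≤ n)
    (hX : ∀ i < n, ∀ j ≤ m, (G.Adj (f i) (y j) ↔ (i = 0 ∧ j = 0) ∨ (i = k ∧ j = m))) :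
    f '' Set.Iio n ∪ y '' Set.Iic m ∈ G.solids := by
  have hc := isListing_cyclePathGraph hf hy hd hX
  rw [← appendSeq_image_Iio]
  refine (hc.map_isThreePath (isThreePath_single_single hk hkn)).mem_solids_of_trihedron ?_ ?_ ?_
  · simpa [Fin.forall_fin_succ] using ⟨hk, by omega⟩
  · simp [Fin.forall_fin_succ]
  · simp [Fin.forall_fin_succ, show n - k ≠ 0 by omega,
      show n - (n - k) = k by omega]

theorem forall_adj_of_fin_three {a : Fin 3 → V} (h₀₁ : G.Adj (a 0) (a 1))
    (h₀₂ : G.Adj (a 0) (a 2)) (h₁₂ : G.Adj (a 1) (a 2)) : ∀ i j, i ≠ j → G.Adj (a i) (a j) := by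
  simp [Fin.forall_fin_succ, *, G.adj_comm (a 2), G.adj_comm (a 1) (a 0)]

theorem union_mem_solids_of_edge_single (hf : IsIndCycle G n f) (hy : IsIndPath G m y)
    (hd : ∀ i < n, ∀ j ≤ m, f i ≠ y j) (hk : 1 ≤ k) (hkn : k + 2 ≤ n)
    (hX : ∀ i < n, ∀ j ≤ m, (G.Adj (f i) (y j) ↔
      (j = 0 ∧ (i = 0 ∨ i + 1 = n)) ∨ (j = m ∧ i = k))) :
    f '' Set.Iio n ∪ y '' Set.Iic m ∈ G.solids := by
  have hc := isListing_cyclePathGraph hf hy hd hX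
  have hadj : ∀ i j, i < n + m + 1 → j < n + m + 1 → i ≠ j →
      (i = n ∨ i = 0 ∨ i + 1 = n) ∧ (j = n ∨ j = 0 ∨ j + 1 = n) →
      G.Adj (appendSeq n f y i) (appendSeq n f y j) := fun i j hi hj hij h =>
    (hc.adj i hi j hj).2 (by grind [cyclePathGraph, fromRel_adj])
  rw [← appendSeq_image_Iio]
  refine (hc.map_isThreePath (isThreePath_edge_single hk hkn)).mem_solids_of_stamp ?_ ?_ ?_
  · simpa [Fin.forall_fin_succ] using ⟨hk, by omega⟩
  · exact forall_adj_of_fin_three (hadj n 0 (by omega) (by omega) (by omega) (by omega))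
      (hadj n (n - 1) (by omega) (by omega) (by omega) (by omega))
      (hadj 0 (n - 1) (by omega) (by omega) (by omega) (by omega))
  · simp [Fin.forall_fin_succ, show n - 1 - (n - 1 - k) = k by omega]

theorem union_mem_solids_of_edge_edge (hf : IsIndCycle G n f) (hy : IsIndPath G m y)
    (hd : ∀ i < n, ∀ j ≤ m, f i ≠ y j) (hm : 1 ≤ m) (hk : 1 ≤ k) (hkn : k + 3 ≤ n)
    (hX : ∀ i < n, ∀ j ≤ m, (G.Adj (f i) (y j) ↔
      (j = 0 ∧ (i = 0 ∨ i + 1 = n)) ∨ (j = m ∧ (i = k ∨ i = k + 1)))) :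
    f '' Set.Iio n ∪ y '' Set.Iic m ∈ G.solids := by
  have hc := isListing_cyclePathGraph hf hy hd hX
  have hadj : ∀ i j, i < n + m + 1 → j < n + m + 1 → i ≠ j →
      (i = n ∨ i = 0 ∨ i + 1 = n) ∧ (j = n ∨ j = 0 ∨ j + 1 = n) ∨
      (i = n + m ∨ i = k ∨ i = k + 1) ∧ (j = n + m ∨ j = k ∨ j = k + 1) →
      G.Adj (appendSeq n f y i) (appendSeq n f y j) := fun i j hi hj hij h =>
    (hc.adj i hi j hj).2 (by grind [cyclePathGraph, fromRel_adj])
  rw [← appendSeq_image_Iio]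
  refine (hc.map_isThreePath (isThreePath_edge_edge hm hk hkn)).mem_solids_of_prism ?_ ?_ ?_
  · simpa [Fin.forall_fin_succ] using ⟨hm, hk, by omega⟩
  · exact forall_adj_of_fin_three (hadj n 0 (by omega) (by omega) (by omega) (by omega))
      (hadj n (n - 1) (by omega) (by omega) (by omega) (by omega))
      (hadj 0 (n - 1) (by omega) (by omega) (by omega) (by omega))
  · exact forall_adj_of_fin_three (hadj (n + m) k (by omega) (by omega) (by omega) (by omega))
      (hadj (n + m) (n - 1 - (n - 2 - k)) (by omega) (by omega) (by omega) (by omega))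
      (hadj k (n - 1 - (n - 2 - k)) (by omega) (by omega) (by omega) (by omega))

theorem union_mem_solids_of_apex (hf : IsIndCycle G n f) (hy : IsIndPath G m y)
    (hd : ∀ i < n, ∀ j ≤ m, f i ≠ y j) {j₀ : ℕ} (hj₀ : j₀ ≤ m) (h₀ : G.Adj (f 0) (y j₀))
    (hX : ∀ i < n, 1 ≤ i → ∀ j ≤ m,
      (G.Adj (f i) (y j) ↔ (i + 1 = n ∧ j = 0) ∨ (i = 1 ∧ j = m))) :
    f '' Set.Iio n ∪ y '' Set.Iic m ∈ G.solids := by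
  have hn := hf.three_le
  have hf0 : f 0 ∈ f '' Set.Iio n := ⟨0, by grind, rfl⟩
  have hcyc : f '' Set.Iio n \ {f 0} ∪ y '' Set.Iic m ∈ G.inducedCycles := by
    rw [← hf.image_tail]
    exact hf.isIndPath_tail.union_mem_inducedCycles hy (by omega)
      (fun i hi j hj => hd _ (by omega) j hj)
      fun i hi j hj => by rw [hX (i + 1) (by omega) (by omega) j hj]; omega
  have hmem : ∀ i < n, i ≠ 0 → f i ∈ f '' Set.Iio n \ {f 0} ∪ y '' Set.Iic m := fun i hi hi0 =>
    Or.inl ⟨⟨i, hi, rfl⟩, fun h => hi0 (hf.inj i hi 0 (by omega) h)⟩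
  have hnew : f 0 ∉ f '' Set.Iio n \ {f 0} ∪ y '' Set.Iic m := by
    rintro (⟨-, h⟩ | ⟨j, hj, h⟩)
    exacts [h rfl, hd 0 (by omega) j hj h.symm]
  have hunion : f '' Set.Iio n ∪ y '' Set.Iic m =
      insert (f 0) (f '' Set.Iio n \ {f 0} ∪ y '' Set.Iic m) := by
    rw [← Set.insert_union, Set.insert_sdiff_singleton, Set.insert_eq_of_mem hf0]
  rw [hunion]
  refine insert_mem_solids_of_pyramid hcyc hnew (hmem 1 (by omega) one_ne_zero)
    (hmem (n - 1) (by omega) (by omega)) (Or.inr ⟨j₀, hj₀, rfl⟩) (fun h => ?_)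
    (hd 1 (by omega) j₀ hj₀) (hd (n - 1) (by omega) j₀ hj₀) ?_ ?_ h₀
  · have := hf.inj 1 (by omega) (n - 1) (by omega) h
    omega
  · rw [hf.adj 0 (by omega) 1 (by omega)]
    omega
  · rw [hf.adj 0 (by omega) (n - 1) (by omega)]
    omega

end CyclePath

section Spread

variable {V : Type*} {G : SimpleGraph V} {D Y : Set V}

/-- The set `Y` has neighbours at two distinct nonadjacent vertices of `D`. -/
def Spread (G : SimpleGraph V) (D Y : Set V) : Prop :=
  ∃ d₁ ∈ D, ∃ d₂ ∈ D, d₁ ≠ d₂ ∧ ¬ G.Adj d₁ d₂ ∧ (∃ y ∈ Y, G.Adj d₁ y) ∧ ∃ y ∈ Y, G.Adj d₂ y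

theorem Spread.mono {D' Y' : Set V} (h : Spread G D Y) (hD : D ⊆ D') (hY : Y ⊆ Y') :
    Spread G D' Y' := by
  obtain ⟨d₁, h₁, d₂, h₂, hne, hadj, ⟨y₁, hy₁, e₁⟩, y₂, hy₂, e₂⟩ := h
  exact ⟨d₁, hD h₁, d₂, hD h₂, hne, hadj, ⟨y₁, hY hy₁, e₁⟩, y₂, hY hy₂, e₂⟩

theorem eq_or_adj_of_not_spread (h : ¬ Spread G D Y) {d e y z : V} (hd : d ∈ D) (he : e ∈ D)
    (hy : y ∈ Y) (hz : z ∈ Y) (hdy : G.Adj d y) (hez : G.Adj e z) : d = e ∨ G.Adj d e := by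
  by_contra hc
  rw [not_or] at hc
  exact h ⟨d, hd, e, he, hc.1, hc.2, ⟨y, hy, hdy⟩, z, hz, hez⟩

/-- The induced path `y 0, …, y m` outside `D` joins the nonadjacent vertices `a` and `b` of `D`,
and neither it without `y m` nor it without `y 0` has neighbours at two nonadjacent vertices of
`D`. -/
structure IsConnector (G : SimpleGraph V) (D : Set V) (m : ℕ) (y : ℕ → V) (a b : V) : Prop where
  isIndPath : IsIndPath G m y
  disj : ∀ d ∈ D, ∀ j ≤ m, d ≠ y j
  left_mem : a ∈ D
  right_mem : b ∈ D
  ne : a ≠ b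
  not_adj : ¬ G.Adj a b
  left_adj : G.Adj a (y 0)
  right_adj : G.Adj b (y m)
  init : ∀ d ∈ D, ∀ e ∈ D, ∀ i < m, ∀ j < m, G.Adj d (y i) → G.Adj e (y j) → d = e ∨ G.Adj d e
  tail : ∀ d ∈ D, ∀ e ∈ D, ∀ i ≤ m, 1 ≤ i → ∀ j ≤ m, 1 ≤ j → G.Adj d (y i) → G.Adj e (y j) →
    d = e ∨ G.Adj d e

theorem exists_isConnector_of_minimal [Finite V] (hdis : Disjoint D Y)
    (hY : Minimal (fun Y => ConnectedOn G Y ∧ Spread G D Y) Y) :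
    ∃ m y a b, IsConnector G D m y a b ∧ Y = y '' Set.Iic m := by
  obtain ⟨⟨hYc, a, ha, b, hb, hne, hnadj, ⟨y₁, hy₁, e₁⟩, y₂, hy₂, e₂⟩, hmin⟩ := hY
  obtain ⟨P, hPY, hP⟩ := hYc.exists_isPathSet hy₁ hy₂
  obtain rfl : P = Y := hPY.antisymm (hmin ⟨hP.connectedOn, a, ha, b, hb, hne, hnadj,
    ⟨y₁, hP.left_mem, e₁⟩, y₂, hP.right_mem, e₂⟩ hPY)
  obtain ⟨m, y, rfl, rfl, rfl, hy⟩ := hP.exists_isIndPath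
  have hsub : ∀ l r, l ≤ r → r ≤ m → (l ≠ 0 ∨ r ≠ m) → ¬ Spread G D (y '' Set.Icc l r) := by
    intro l r hlr hr hne hsp
    have hmin' := hmin ⟨hy.connectedOn_Icc hlr hr, hsp⟩ (Set.image_mono fun i hi => hi.2.trans hr)
    have hIcc : ∀ j ≤ m, l ≤ j ∧ j ≤ r := fun j hj => by
      obtain ⟨i, hi, hij⟩ := hmin' ⟨j, hj, rfl⟩
      exact hy.inj i (hi.2.trans hr) j hj hij ▸ hi
    have := hIcc 0 (Nat.zero_le m)
    have := hIcc m le_rfl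
    omega
  refine ⟨m, y, a, b, ⟨hy, fun d hd j hj h => Set.disjoint_left.1 hdis hd ⟨j, hj, h.symm⟩, ha, hb,
    hne, hnadj, e₁, e₂, fun d hd e he i hi j hj => ?_, fun d hd e he i hi hi' j hj hj' => ?_⟩, rfl⟩
  · exact eq_or_adj_of_not_spread (hsub 0 (m - 1) (by omega) (by omega) (by omega)) hd he
      ⟨i, ⟨by omega, by omega⟩, rfl⟩ ⟨j, ⟨by omega, by omega⟩, rfl⟩
  · exact eq_or_adj_of_not_spread (hsub 1 m (by omega) (by omega) (by omega)) hd he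
      ⟨i, ⟨hi', hi⟩, rfl⟩ ⟨j, ⟨hj', hj⟩, rfl⟩

namespace IsConnector

variable {m : ℕ} {y : ℕ → V} {a b : V}

theorem reverse (h : IsConnector G D m y a b) :
    IsConnector G D m (fun i => y (m - i)) b a where
  isIndPath := h.isIndPath.reverse
  disj d hd j _ := h.disj d hd _ (Nat.sub_le m j)
  left_mem := h.right_mem
  right_mem := h.left_mem
  ne := h.ne.symm
  not_adj := fun hba => h.not_adj hba.symm
  left_adj := h.right_adj
  right_adj := by simpa using h.left_adj
  init d hd e he i hi j hj := h.tail d hd e he _ (by omega) (by omega) _ (by omega) (by omega)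
  tail d hd e he i hi hi' j hj hj' := h.init d hd e he _ (by omega) _ (by omega)

theorem eq_zero_of_left_adj (h : IsConnector G D m y a b) {j : ℕ} (hj : j ≤ m)
    (haj : G.Adj a (y j)) : j = 0 := by
  by_contra hj0
  exact (h.tail a h.left_mem b h.right_mem j hj (by omega) m le_rfl (by omega) haj
    h.right_adj).elim h.ne h.not_adj

theorem eq_of_right_adj (h : IsConnector G D m y a b) {j : ℕ} (hj : j ≤ m)
    (hbj : G.Adj b (y j)) : j = m := by
  have := h.reverse.eq_zero_of_left_adj (Nat.sub_le m j) (by rwa [Nat.sub_sub_self hj])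
  omega

theorem exists_right_eq {n : ℕ} {f : ℕ → V} (h : IsConnector G (f '' Set.Iio n) m y (f 0) b)
    (hf : IsIndCycle G n f) : ∃ k, 2 ≤ k ∧ k + 2 ≤ n ∧ f k = b := by
  obtain ⟨k, hk : k < n, rfl⟩ := h.right_mem
  have hk0 : k ≠ 0 := fun hk0 => h.ne (by rw [hk0])
  have hnadj := h.not_adj
  rw [hf.adj 0 (by omega) k hk] at hnadj
  exact ⟨k, by omega, by omega, rfl⟩

theorem union_mem_solids_of_zero (h : IsConnector G D 0 y a b) (hD : D ∈ G.inducedCycles) :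
    D ∪ y '' Set.Iic 0 ∈ G.solids := by
  by_cases hthird : ∃ c ∈ D, c ≠ a ∧ c ≠ b ∧ G.Adj c (y 0)
  · obtain ⟨c, hc, hca, hcb, hcy⟩ := hthird
    rw [show Set.Iic 0 = {0} from Set.Iic_bot, Set.image_singleton, Set.union_singleton]
    exact insert_mem_solids_of_pyramid hD (fun hD => h.disj _ hD 0 le_rfl rfl) h.left_mem
      h.right_mem hc h.ne hca.symm hcb.symm h.left_adj.symm h.right_adj.symm hcy.symm
  · obtain ⟨n, f, hf, rfl, rfl⟩ := exists_isIndCycle_start hD h.left_mem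
    obtain ⟨k, hk, hkn, rfl⟩ := h.exists_right_eq hf
    refine union_mem_solids_of_single_single hf h.isIndPath (fun i hi => h.disj _ ⟨i, hi, rfl⟩)
      hk hkn fun i hi j hj => ?_
    obtain rfl : j = 0 := Nat.le_zero.1 hj
    refine ⟨fun hiy => ?_, ?_⟩
    · by_contra hc
      exact hthird ⟨f i, ⟨i, hi, rfl⟩, fun h => hc (Or.inl ⟨hf.inj i hi 0 (by omega) h, rfl⟩),
        fun h => hc (Or.inr ⟨hf.inj i hi k (by omega) h, rfl⟩), hiy⟩
    · rintro (⟨rfl, -⟩ | ⟨rfl, -⟩)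
      exacts [h.left_adj, h.right_adj]

theorem adj_left_of_common (h : IsConnector G D m y a b) {c : V} (hc : c ∈ D) {i₀ j₀ : ℕ}
    (hi₀ : i₀ < m) (hj₀ : j₀ ≤ m) (hj₀' : 1 ≤ j₀) (hci : G.Adj c (y i₀))
    (hcj : G.Adj c (y j₀)) : G.Adj c a := by
  refine (h.init c hc a h.left_mem i₀ hi₀ 0 (by omega) hci h.left_adj).resolve_left ?_
  rintro rfl
  exact (Nat.one_le_iff_ne_zero.1 hj₀') (h.eq_zero_of_left_adj hj₀ hcj)

/-- The ends `a` and `b` are the neighbours on `D` of the common neighbour `c` of both parts of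
the path, so `D` without `c` and the path form an induced cycle. -/
theorem union_mem_solids_of_common (h : IsConnector G D m y a b) (hD : D ∈ G.inducedCycles)
    {c : V} (hc : c ∈ D) {i₀ j₀ : ℕ} (hi₀ : i₀ < m) (hj₀ : j₀ ≤ m) (hj₀' : 1 ≤ j₀)
    (hci : G.Adj c (y i₀)) (hcj : G.Adj c (y j₀)) : D ∪ y '' Set.Iic m ∈ G.solids := by
  have hca : G.Adj c a := h.adj_left_of_common hc hi₀ hj₀ hj₀' hci hcj
  have hcb : G.Adj c b := h.reverse.adj_left_of_common (i₀ := m - j₀) (j₀ := m - i₀) hc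
    (by omega) (by omega) (by omega) (by rwa [Nat.sub_sub_self hj₀])
    (by rwa [Nat.sub_sub_self hi₀.le])
  obtain ⟨n, f, hf, rfl, rfl, rfl⟩ :=
    exists_isIndCycle_start_end hD hc h.left_mem hca
  have hn := hf.three_le
  obtain ⟨k, hk : k < n, rfl⟩ := h.right_mem
  obtain rfl : k = 1 := by
    have hk1 := (hf.adj 0 (by omega) k hk).1 hcb
    have hkn : k ≠ n - 1 := fun hkn => h.ne (by rw [hkn])
    omega
  refine union_mem_solids_of_apex hf h.isIndPath (fun i hi => h.disj _ ⟨i, hi, rfl⟩) hi₀.le hci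
    fun i hi hi1 j hj => ⟨fun hij => ?_, ?_⟩
  · have hor : f 0 = f i ∨ G.Adj (f 0) (f i) := by
      by_cases hjm : j < m
      · exact h.init _ hc _ ⟨i, hi, rfl⟩ i₀ hi₀ j hjm hci hij
      · exact h.tail _ hc _ ⟨i, hi, rfl⟩ j₀ hj₀ hj₀' j hj (by omega) hcj hij
    have hi0 : f 0 ≠ f i := fun hi0 => by
      have := hf.inj 0 (by omega) i hi hi0
      omega
    rcases (hf.adj 0 (by omega) i hi).1 (hor.resolve_left hi0) with h' | h' | h' | h'
    · obtain rfl : i = 1 := h'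
      exact Or.inr ⟨rfl, h.eq_of_right_adj hj hij⟩
    · omega
    · obtain rfl : i = n - 1 := by omega
      exact Or.inl ⟨by omega, h.eq_zero_of_left_adj hj hij⟩
    · omega
  · rintro (⟨hin, rfl⟩ | ⟨rfl, rfl⟩)
    · rw [show i = n - 1 by omega]
      exact h.left_adj
    · exact h.right_adj

theorem eq_zero_or_eq_of_adj
    (hno : ∀ c ∈ D, ∀ i < m, ∀ j ≤ m, 1 ≤ j → G.Adj c (y i) → ¬ G.Adj c (y j)) {d : V} (hd : d ∈ D)
    {j : ℕ} (hj : j ≤ m) (hdj : G.Adj d (y j)) : j = 0 ∨ j = m := by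
  by_contra hj0
  exact hno d hd j (by omega) j hj (by omega) hdj hdj

theorem adj_left_iff {n : ℕ} {f : ℕ → V} (h : IsConnector G (f '' Set.Iio n) m y (f 0) b)
    (hf : IsIndCycle G n f) (hm : 1 ≤ m) (hlast : G.Adj (f (n - 1)) (y 0)) {i : ℕ} (hi : i < n) :
    G.Adj (f i) (y 0) ↔ i = 0 ∨ i + 1 = n := by
  obtain ⟨k, hk, hkn, -⟩ := h.exists_right_eq hf
  refine ⟨fun hiy => ?_, ?_⟩
  · have := hf.index_of_eq_or_adj hi (Nat.zero_lt_of_lt hi)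
      (h.init _ ⟨i, hi, rfl⟩ _ h.left_mem 0 hm 0 hm hiy h.left_adj)
    have := hf.index_of_eq_or_adj hi (Nat.sub_one_lt_of_lt hi)
      (h.init _ ⟨i, hi, rfl⟩ _ ⟨n - 1, Nat.sub_one_lt_of_lt hi, rfl⟩ 0 hm 0 hm hiy hlast)
    omega
  · rintro (rfl | rfl)
    exacts [h.left_adj, hlast]

theorem index_of_right_adj {n : ℕ} {f : ℕ → V}
    (h : IsConnector G (f '' Set.Iio n) m y (f 0) b) (hf : IsIndCycle G n f) (hm : 1 ≤ m)
    (hno : ∀ c ∈ f '' Set.Iio n, ∀ i < m, ∀ j ≤ m, 1 ≤ j → G.Adj c (y i) → ¬ G.Adj c (y j))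
    (hlast : G.Adj (f (n - 1)) (y 0)) {i j : ℕ} (hi : i < n) (hj : j < n)
    (hiy : G.Adj (f i) (y m)) (hjy : G.Adj (f j) (y m)) :
    i ≠ 0 ∧ i + 1 ≠ n ∧ (i = j ∨ j = i + 1 ∨ i = j + 1) := by
  have := mt (h.adj_left_iff hf hm hlast hi).2 fun hi0 =>
    hno _ ⟨i, hi, rfl⟩ 0 hm m le_rfl hm hi0 hiy
  have := mt (h.adj_left_iff hf hm hlast hj).2 fun hj0 =>
    hno _ ⟨j, hj, rfl⟩ 0 hm m le_rfl hm hj0 hjy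
  have := hf.index_of_eq_or_adj hi hj
    (h.tail _ ⟨i, hi, rfl⟩ _ ⟨j, hj, rfl⟩ m le_rfl hm m le_rfl hm hiy hjy)
  omega

theorem union_mem_solids_of_edge (h : IsConnector G D m y a b) (hD : D ∈ G.inducedCycles)
    (hm : 1 ≤ m) (hno : ∀ c ∈ D, ∀ i < m, ∀ j ≤ m, 1 ≤ j → G.Adj c (y i) → ¬ G.Adj c (y j))
    {z : V} (hz : z ∈ D) (hza : z ≠ a) (hzy : G.Adj z (y 0)) : D ∪ y '' Set.Iic m ∈ G.solids := by
  have haz : G.Adj a z :=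
    (h.init a h.left_mem z hz 0 hm 0 hm h.left_adj hzy).resolve_left hza.symm
  obtain ⟨n, f, hf, rfl, rfl, rfl⟩ := exists_isIndCycle_start_end hD h.left_mem hz haz
  obtain ⟨k, hk, hkn, rfl⟩ := h.exists_right_eq hf
  have hmem : ∀ i < n, f i ∈ f '' Set.Iio n := fun i hi => ⟨i, hi, rfl⟩
  by_cases hother : ∃ l < n, l ≠ k ∧ G.Adj (f l) (y m)
  · obtain ⟨l, hl, hlk, hly⟩ := hother
    have hlr := h.index_of_right_adj hf hm hno hzy hl (by omega) hly h.right_adj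
    obtain ⟨q, hq⟩ : ∃ q, (q = k ∧ l = k + 1) ∨ (q = l ∧ k = l + 1) := by
      rcases hlr.2.2.resolve_left hlk with h' | h'
      exacts [⟨l, by omega⟩, ⟨k, by omega⟩]
    refine union_mem_solids_of_edge_edge hf h.isIndPath (fun i hi => h.disj _ (hmem i hi)) hm
      (k := q) (by omega) (by omega) fun i hi j hj => ⟨fun hij => ?_, ?_⟩
    · rcases eq_zero_or_eq_of_adj hno (hmem i hi) hj hij with rfl | rfl
      · exact Or.inl ⟨rfl, (h.adj_left_iff hf hm hzy hi).1 hij⟩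
      · have := h.index_of_right_adj hf hm hno hzy hi (by omega) hij h.right_adj
        have := h.index_of_right_adj hf hm hno hzy hi hl hij hly
        omega
    · rintro (⟨rfl, hi0⟩ | ⟨rfl, hik⟩)
      · exact (h.adj_left_iff hf hm hzy hi).2 hi0
      · rcases (show i = k ∨ i = l by omega) with rfl | rfl
        exacts [h.right_adj, hly]
  · refine union_mem_solids_of_edge_single hf h.isIndPath (fun i hi => h.disj _ (hmem i hi))
      (by omega) hkn fun i hi j hj => ⟨fun hij => ?_, ?_⟩
    · rcases eq_zero_or_eq_of_adj hno (hmem i hi) hj hij with rfl | rfl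
      · exact Or.inl ⟨rfl, (h.adj_left_iff hf hm hzy hi).1 hij⟩
      · exact Or.inr ⟨rfl, of_not_not fun hik => hother ⟨i, hi, hik, hij⟩⟩
    · rintro (⟨rfl, hi0⟩ | ⟨rfl, rfl⟩)
      exacts [(h.adj_left_iff hf hm hzy hi).2 hi0, h.right_adj]

theorem union_mem_solids_of_unique (h : IsConnector G D m y a b) (hD : D ∈ G.inducedCycles)
    (hno : ∀ c ∈ D, ∀ i < m, ∀ j ≤ m, 1 ≤ j → G.Adj c (y i) → ¬ G.Adj c (y j))
    (hleft : ∀ z ∈ D, G.Adj z (y 0) → z = a) (hright : ∀ z ∈ D, G.Adj z (y m) → z = b) :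
    D ∪ y '' Set.Iic m ∈ G.solids := by
  obtain ⟨n, f, hf, rfl, rfl⟩ := exists_isIndCycle_start hD h.left_mem
  obtain ⟨k, hk, hkn, rfl⟩ := h.exists_right_eq hf
  refine union_mem_solids_of_single_single hf h.isIndPath (fun i hi => h.disj _ ⟨i, hi, rfl⟩) hk
    hkn fun i hi j hj => ⟨fun hij => ?_, ?_⟩
  · rcases eq_zero_or_eq_of_adj hno ⟨i, hi, rfl⟩ hj hij with rfl | rfl
    · exact Or.inl ⟨hf.inj i hi 0 (by omega) (hleft _ ⟨i, hi, rfl⟩ hij), rfl⟩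
    · exact Or.inr ⟨hf.inj i hi k (by omega) (hright _ ⟨i, hi, rfl⟩ hij), rfl⟩
  · rintro (⟨rfl, rfl⟩ | ⟨rfl, rfl⟩)
    exacts [h.left_adj, h.right_adj]

theorem union_mem_solids (h : IsConnector G D m y a b) (hD : D ∈ G.inducedCycles) :
    D ∪ y '' Set.Iic m ∈ G.solids := by
  rcases Nat.eq_zero_or_pos m with rfl | hm
  · exact h.union_mem_solids_of_zero hD
  by_cases hno : ∀ c ∈ D, ∀ i < m, ∀ j ≤ m, 1 ≤ j → G.Adj c (y i) → ¬ G.Adj c (y j)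
  · by_cases hleft : ∀ z ∈ D, G.Adj z (y 0) → z = a
    · by_cases hright : ∀ z ∈ D, G.Adj z (y m) → z = b
      · exact h.union_mem_solids_of_unique hD hno hleft hright
      · push Not at hright
        obtain ⟨z, hz, hzy, hzb⟩ := hright
        rw [← image_sub_Iic]
        exact h.reverse.union_mem_solids_of_edge hD hm
          (fun c hc i hi j hj hj1 hci hcj =>
            hno c hc _ (by omega) _ (Nat.sub_le m i) (by omega) hcj hci) hz hzb hzy
    · push Not at hleft
      obtain ⟨z, hz, hzy, hza⟩ := hleft
      exact h.union_mem_solids_of_edge hD hm hno hz hza hzy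
  · push Not at hno
    obtain ⟨c, hc, i, hi, j, hj, hj1, hci, hcj⟩ := hno
    exact h.union_mem_solids_of_common hD hc hi hj hj1 hci hcj

end IsConnector

theorem union_mem_solids_of_minimal [Finite V] (hD : D ∈ G.inducedCycles) (hdis : Disjoint D Y)
    (hY : Minimal (fun Y => ConnectedOn G Y ∧ Spread G D Y) Y) : D ∪ Y ∈ G.solids := by
  obtain ⟨m, y, a, b, h, rfl⟩ := exists_isConnector_of_minimal hdis hY
  exact h.union_mem_solids hD

end Spread

section Detour

variable {V : Type*} {G : SimpleGraph V}

theorem ConnectedOn.sdiff_of_forall_eq_or_adj {T Z : Set V} (hT : ConnectedOn G T) {a : V}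
    (haT : a ∈ T) (haZ : a ∉ Z)
    (hatt : ∀ u ∈ T \ Z, ∀ v ∈ T \ Z, ∀ y ∈ Z, ∀ z ∈ Z, G.Adj u y → G.Adj v z →
      u = v ∨ G.Adj u v) : ConnectedOn G (T \ Z) := by
  refine connectedOn_of_closed ⟨haT, haZ⟩ fun U haU hU => ?_
  by_cases h : ∃ d ∈ U, d ∈ T \ Z ∧ ∃ z ∈ Z, G.Adj d z
  · obtain ⟨d, hdU, hdT, z, hz, hdz⟩ := h
    have hsub : T ⊆ U ∪ Z := hT.subset_of_closed (U ∪ Z) haT (Or.inl haU) <| by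
      intro u hu huT v hvT huv
      by_cases hvZ : v ∈ Z
      · exact Or.inr hvZ
      left
      by_cases huZ : u ∈ Z
      · rcases hatt d hdT v ⟨hvT, hvZ⟩ z hz u huZ hdz huv.symm with rfl | h
        · exact hdU
        · exact hU d hdU hdT v ⟨hvT, hvZ⟩ h
      · exact hU u (hu.resolve_right huZ) ⟨huT, huZ⟩ v ⟨hvT, hvZ⟩ huv
    exact fun v hv => (hsub hv.1).resolve_right hv.2
  · have hsub : T ⊆ U \ Z := hT.subset_of_closed (U \ Z) haT ⟨haU, haZ⟩ <| by
      intro u hu huT v hvT huv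
      have hvZ : v ∉ Z := fun hvZ => h ⟨u, hu.1, ⟨huT, hu.2⟩, v, hvZ, huv⟩
      exact ⟨hU u hu.1 ⟨huT, hu.2⟩ v ⟨hvT, hvZ⟩ huv, hvZ⟩
    exact fun v hv => (hsub hv.1).1

theorem ConnectedOn.exists_adj_component {Y Y' : Set V} (hY : ConnectedOn G Y)
    (hY' : Y'.Nonempty) (hsub : Y' ⊆ Y) {u : V} (hu : u ∈ Y \ Y') :
    ∃ Z ⊆ Y \ Y', u ∈ Z ∧ ConnectedOn G Z ∧ ∃ z ∈ Z, ∃ y ∈ Y', G.Adj z y := by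
  obtain ⟨Z, hZ, huZ⟩ := exists_isComponent G hu
  refine ⟨Z, hZ.subset, huZ, hZ.connectedOn, ?_⟩
  by_contra! h
  have hYZ : Y ⊆ Z := hY.subset_of_closed Z hu.1 huZ fun z hz _ y hy hzy =>
    hZ.closed z hz y ⟨hy, fun hy' => h z hz y hy' hzy⟩ hzy
  obtain ⟨y, hy⟩ := hY'
  exact (hZ.subset (hYZ (hsub hy))).2 hy

theorem IsPathSet.subset_of_minimal_spread {a b : V} {D T Y : Set V} (hT : IsPathSet G a b T)
    (hD : IsPathSet G a b D) (hdis : Disjoint D Y)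
    (hY : Minimal (fun Y => ConnectedOn G Y ∧ Spread G D Y) Y) (hTDY : T ⊆ D ∪ Y) (hne : T ≠ D) :
    Y ⊆ T := by
  have hTD : ¬ T ⊆ D := fun h => hne (hD.eq_of_subset hT.left_mem hT.right_mem hT.connectedOn h)
  obtain ⟨t, htT, htD⟩ := Set.not_subset.1 hTD
  obtain ⟨Z, hZ, htZ⟩ :=
    exists_isComponent G (s := T ∩ Y) ⟨htT, (hTDY htT).resolve_left htD⟩
  have hZs : Spread G D Z := by
    by_contra hZs
    have hatt : ∀ u ∈ T \ Z, ∀ z ∈ Z, G.Adj u z → u ∈ D := fun u hu z hz huz =>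
      (hTDY hu.1).resolve_right fun huY => hu.2 (hZ.closed z hz u ⟨hu.1, huY⟩ huz.symm)
    have ha : a ∉ Z := fun h => Set.disjoint_left.1 hdis hD.left_mem (hZ.subset h).2
    have hb : b ∉ Z := fun h => Set.disjoint_left.1 hdis hD.right_mem (hZ.subset h).2
    have hTZ : ConnectedOn G (T \ Z) := hT.connectedOn.sdiff_of_forall_eq_or_adj hT.left_mem ha
      fun u hu v hv y hy z hz huy hvz =>
        eq_or_adj_of_not_spread hZs (hatt u hu y hy huy) (hatt v hv z hz hvz) hy hz huy hvz
    have heq : T \ Z = T :=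
      hT.eq_of_subset ⟨hT.left_mem, ha⟩ ⟨hT.right_mem, hb⟩ hTZ Set.sdiff_subset
    exact (heq.symm ▸ htT : t ∈ T \ Z).2 htZ
  exact (hY.2 ⟨hZ.connectedOn, hZs⟩ fun z hz => (hZ.subset hz).2).trans fun z hz => (hZ.subset hz).1

variable {n : ℕ} {p : ℕ → V}

theorem IsIndPath.subset_image_Iio (hp : IsIndPath G n p) {l : ℕ} (hl : l ≤ n) {T : Set V}
    (hT : ConnectedOn G T) (h0 : p 0 ∈ T) (hlT : p l ∉ T)
    (hclosed : ∀ k < l, ∀ v ∈ T, G.Adj (p k) v → v ∈ p '' Set.Iic n) : T ⊆ p '' Set.Iio l := by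
  have hl0 : 0 < l := Nat.pos_of_ne_zero fun h => hlT (h ▸ h0)
  refine hT.subset_of_closed _ h0 ⟨0, hl0, rfl⟩ ?_
  rintro _ ⟨k, hk : k < l, rfl⟩ - v hv hkv
  obtain ⟨k', hk' : k' ≤ n, rfl⟩ := hclosed k hk v hv hkv
  have hadj := (hp.adj k (by omega) k' hk').1 hkv
  have hne : k' ≠ l := fun h => hlT (h ▸ hv)
  exact ⟨k', Set.mem_Iio.2 (by omega), rfl⟩

theorem IsIndPath.subset_image_Ioc (hp : IsIndPath G n p) {l : ℕ} (hl : l ≤ n) {T : Set V}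
    (hT : ConnectedOn G T) (hn : p n ∈ T) (hlT : p l ∉ T)
    (hclosed : ∀ k ≤ n, l < k → ∀ v ∈ T, G.Adj (p k) v → v ∈ p '' Set.Iic n) :
    T ⊆ p '' Set.Ioc l n := by
  have hsub := hp.reverse.subset_image_Iio (Nat.sub_le n l) hT (by rwa [Nat.sub_zero])
    (by rwa [Nat.sub_sub_self hl]) fun k hk v hv hkv =>
      image_sub_Iic n p ▸ hclosed (n - k) (Nat.sub_le n k) (by omega) v hv hkv
  intro v hv
  obtain ⟨k, hk : k < n - l, rfl⟩ := hsub hv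
  exact ⟨n - k, ⟨by omega, Nat.sub_le n k⟩, rfl⟩

/-- The connected set `Y` is disjoint from the induced path `p 0, …, p n`, and its first and last
neighbours on the path, `p i` and `p j`, are not adjacent. The path can then be rerouted
through `Y`, see `detour`. -/
structure IsDetour (G : SimpleGraph V) (n : ℕ) (p : ℕ → V) (Y : Set V) (i j : ℕ) : Prop where
  isIndPath : IsIndPath G n p
  connectedOn : ConnectedOn G Y
  notMem : ∀ l ≤ n, p l ∉ Y
  add_two_le : i + 2 ≤ j
  le : j ≤ n
  left_adj : ∃ y ∈ Y, G.Adj (p i) y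
  right_adj : ∃ y ∈ Y, G.Adj (p j) y
  between : ∀ l ≤ n, ∀ y ∈ Y, G.Adj (p l) y → i ≤ l ∧ l ≤ j

/-- The path `p 0, …, p n` with its part strictly between `p i` and `p j` replaced by `Y`. -/
def detour (n : ℕ) (p : ℕ → V) (Y : Set V) (i j : ℕ) : Set V :=
  p '' Set.Icc 0 i ∪ Y ∪ p '' Set.Icc j n

theorem IsIndPath.exists_isDetour (hp : IsIndPath G n p) {Y : Set V} (hYc : ConnectedOn G Y)
    (hYs : Spread G (p '' Set.Iic n) Y) (hdis : Disjoint (p '' Set.Iic n) Y) :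
    ∃ i j, IsDetour G n p Y i j := by
  classical
  let N : Finset ℕ := {l ∈ Finset.range (n + 1) | ∃ y ∈ Y, G.Adj (p l) y}
  have hN : ∀ l, l ∈ N ↔ l ≤ n ∧ ∃ y ∈ Y, G.Adj (p l) y := by simp [N]
  obtain ⟨_, ⟨k, hk : k ≤ n, rfl⟩, _, ⟨l, hl : l ≤ n, rfl⟩, hne, hnadj, hkY, hlY⟩ := hYs
  have hkN : k ∈ N := (hN k).2 ⟨hk, hkY⟩
  have hlN : l ∈ N := (hN l).2 ⟨hl, hlY⟩
  have hkl : k ≠ l := fun h => hne (h ▸ rfl)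
  rw [hp.adj k hk l hl] at hnadj
  have hmin : ∀ m ∈ N, N.min' ⟨k, hkN⟩ ≤ m := fun m => N.min'_le m
  have hmax : ∀ m ∈ N, m ≤ N.max' ⟨k, hkN⟩ := fun m => N.le_max' m
  have hk' := And.intro (hmin k hkN) (hmax k hkN)
  have hl' := And.intro (hmin l hlN) (hmax l hlN)
  exact ⟨N.min' ⟨k, hkN⟩, N.max' ⟨k, hkN⟩, {
    isIndPath := hp
    connectedOn := hYc
    notMem := fun m hm => Set.disjoint_left.1 hdis ⟨m, hm, rfl⟩
    add_two_le := by omega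
    le := ((hN _).1 (N.max'_mem _)).1
    left_adj := ((hN _).1 (N.min'_mem _)).2
    right_adj := ((hN _).1 (N.max'_mem _)).2
    between := fun m hm y hy hmy =>
      have hmN := (hN m).2 ⟨hm, y, hy, hmy⟩
      ⟨hmin m hmN, hmax m hmN⟩ }⟩

namespace IsDetour

variable {Y T : Set V} {i j l : ℕ}

theorem reverse (h : IsDetour G n p Y i j) :
    IsDetour G n (fun k => p (n - k)) Y (n - j) (n - i) where
  isIndPath := h.isIndPath.reverse
  connectedOn := h.connectedOn
  notMem k _ := h.notMem _ (Nat.sub_le n k)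
  add_two_le := by
    have := h.add_two_le
    have := h.le
    omega
  le := Nat.sub_le n i
  left_adj := by simpa only [Nat.sub_sub_self h.le] using h.right_adj
  right_adj := by
    simpa only [Nat.sub_sub_self ((Nat.le_add_right i 2).trans (h.add_two_le.trans h.le))]
      using h.left_adj
  between k hk y hy hky := by
    have := h.between _ (Nat.sub_le n k) y hy hky
    omega

theorem left_lt (h : IsDetour G n p Y i j) : i < n := by
  have := h.add_two_le
  have := h.le
  omega

theorem detour_subset (h : IsDetour G n p Y i j) : detour n p Y i j ⊆ p '' Set.Iic n ∪ Y := by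
  rintro v ((⟨k, hk, rfl⟩ | hv) | ⟨k, hk, rfl⟩)
  exacts [Or.inl ⟨k, hk.2.trans h.left_lt.le, rfl⟩, Or.inr hv, Or.inl ⟨k, hk.2, rfl⟩]

theorem mem_detour_iff (h : IsDetour G n p Y i j) (hl : l ≤ n) :
    p l ∈ detour n p Y i j ↔ l ≤ i ∨ j ≤ l := by
  constructor
  · rintro ((⟨k, hk, hkl⟩ | hlY) | ⟨k, hk, hkl⟩)
    · exact Or.inl (h.isIndPath.inj k (hk.2.trans h.left_lt.le) l hl hkl ▸ hk.2)
    · exact absurd hlY (h.notMem l hl)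
    · exact Or.inr (h.isIndPath.inj k hk.2 l hl hkl ▸ hk.1)
  · rintro (hli | hjl)
    exacts [Or.inl (Or.inl ⟨l, ⟨l.zero_le, hli⟩, rfl⟩), Or.inr ⟨l, ⟨hjl, hl⟩, rfl⟩]

theorem subset_detour : Y ⊆ detour n p Y i j := fun _ hy => Or.inl (Or.inr hy)

theorem union_detour (h : IsDetour G n p Y i j) :
    p '' Set.Iic n ∪ detour n p Y i j = p '' Set.Iic n ∪ Y :=
  (Set.union_subset Set.subset_union_left h.detour_subset).antisymm
    (Set.union_subset_union_right _ subset_detour)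

theorem not_subset_detour (h : IsDetour G n p Y i j) : ¬ p '' Set.Iic n ⊆ detour n p Y i j := by
  intro hsub
  have hlt := h.left_lt
  have hgap := h.add_two_le
  have := (h.mem_detour_iff hlt).1 (hsub ⟨i + 1, hlt, rfl⟩)
  omega

theorem connectedOn_left (h : IsDetour G n p Y i j) : ConnectedOn G (p '' Set.Icc 0 i ∪ Y) :=
  let ⟨_, hy, hiy⟩ := h.left_adj
  (h.isIndPath.connectedOn_Icc i.zero_le h.left_lt.le).union_of_adj h.connectedOn
    ⟨i, ⟨i.zero_le, le_rfl⟩, rfl⟩ hy hiy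

theorem connectedOn_right (h : IsDetour G n p Y i j) : ConnectedOn G (Y ∪ p '' Set.Icc j n) :=
  let ⟨_, hy, hjy⟩ := h.right_adj
  h.connectedOn.union_of_adj (h.isIndPath.connectedOn_Icc h.le le_rfl) hy
    ⟨j, ⟨le_rfl, h.le⟩, rfl⟩ hjy.symm

theorem connectedOn_detour (h : IsDetour G n p Y i j) : ConnectedOn G (detour n p Y i j) :=
  let ⟨_, hy, hjy⟩ := h.right_adj
  h.connectedOn_left.union_of_adj (h.isIndPath.connectedOn_Icc h.le le_rfl) (Or.inr hy)
    ⟨j, ⟨le_rfl, h.le⟩, rfl⟩ hjy.symm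

theorem image_Icc_left_subset (h : IsDetour G n p Y i j) (hT : ConnectedOn G T) (h0 : p 0 ∈ T)
    (hn : p n ∈ T) (hTY : T ⊆ p '' Set.Iic n ∪ Y) : p '' Set.Icc 0 i ⊆ T := by
  rintro _ ⟨l, ⟨-, hli⟩, rfl⟩
  by_contra hlT
  have hin := h.left_lt
  have hclosed : ∀ k < l, ∀ v ∈ T, G.Adj (p k) v → v ∈ p '' Set.Iic n := by
    intro k hk v hv hkv
    refine (hTY hv).resolve_right fun hvY => ?_
    have := h.between k (by omega) v hvY hkv
    omega
  obtain ⟨k, hk : k < l, hkn⟩ := h.isIndPath.subset_image_Iio (by omega) hT h0 hlT hclosed hn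
  have := h.isIndPath.inj k (by omega) n le_rfl hkn
  omega

theorem image_Icc_right_subset (h : IsDetour G n p Y i j) (hT : ConnectedOn G T) (h0 : p 0 ∈ T)
    (hn : p n ∈ T) (hTY : T ⊆ p '' Set.Iic n ∪ Y) : p '' Set.Icc j n ⊆ T := by
  rintro _ ⟨l, ⟨hjl, hln⟩, rfl⟩
  have hsub := h.reverse.image_Icc_left_subset hT (by rwa [Nat.sub_zero]) (by rwa [Nat.sub_self])
    (by rwa [image_sub_Iic])
  simpa only [Nat.sub_sub_self hln] using
    hsub ⟨n - l, ⟨Nat.zero_le _, Nat.sub_le_sub_left hjl n⟩, rfl⟩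

theorem detour_subset_of_isPathSet (h : IsDetour G n p Y i j)
    (hY : Minimal (fun Y => ConnectedOn G Y ∧ Spread G (p '' Set.Iic n) Y) Y)
    (hT : IsPathSet G (p 0) (p n) T) (hTY : T ⊆ p '' Set.Iic n ∪ Y) (hne : T ≠ p '' Set.Iic n) :
    detour n p Y i j ⊆ T := by
  have hdis : Disjoint (p '' Set.Iic n) Y := Set.disjoint_left.2 fun v ⟨k, hk, hkv⟩ =>
    hkv ▸ h.notMem k hk
  refine Set.union_subset (Set.union_subset ?_ ?_) ?_
  · exact h.image_Icc_left_subset hT.connectedOn hT.left_mem hT.right_mem hTY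
  · exact hT.subset_of_minimal_spread h.isIndPath.isPathSet hdis hY hTY hne
  · exact h.image_Icc_right_subset hT.connectedOn hT.left_mem hT.right_mem hTY

theorem left_mem_detour : p 0 ∈ detour n p Y i j := Or.inl (Or.inl ⟨0, ⟨le_rfl, i.zero_le⟩, rfl⟩)

theorem right_mem_detour (h : IsDetour G n p Y i j) : p n ∈ detour n p Y i j :=
  Or.inr ⟨n, ⟨h.le, le_rfl⟩, rfl⟩

theorem isPathSet_detour [Finite V] (h : IsDetour G n p Y i j)
    (hY : Minimal (fun Y => ConnectedOn G Y ∧ Spread G (p '' Set.Iic n) Y) Y) :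
    IsPathSet G (p 0) (p n) (detour n p Y i j) := by
  obtain ⟨T, hTR, hT⟩ := h.connectedOn_detour.exists_isPathSet left_mem_detour h.right_mem_detour
  have hne : T ≠ p '' Set.Iic n := fun heq => h.not_subset_detour (heq ▸ hTR)
  have hRT := h.detour_subset_of_isPathSet hY hT (hTR.trans h.detour_subset) hne
  exact hTR.antisymm hRT ▸ hT

theorem eq_or_eq_detour (h : IsDetour G n p Y i j)
    (hY : Minimal (fun Y => ConnectedOn G Y ∧ Spread G (p '' Set.Iic n) Y) Y)
    (hT : IsPathSet G (p 0) (p n) T) (hTY : T ⊆ p '' Set.Iic n ∪ Y) :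
    T = p '' Set.Iic n ∨ T = detour n p Y i j :=
  or_iff_not_imp_left.2 fun hne => (hT.eq_of_subset left_mem_detour h.right_mem_detour
    h.connectedOn_detour (h.detour_subset_of_isPathSet hY hT hTY hne)).symm

end IsDetour

end Detour

section Swap

variable {V : Type*} {G : SimpleGraph V}

theorem Spread.of_insert {x : V} {P Y : Set V} (hx : ∀ y ∈ Y, ¬ G.Adj x y)
    (h : Spread G (insert x P) Y) : Spread G P Y := by
  obtain ⟨d₁, h₁, d₂, h₂, hne, hadj, ⟨y₁, hy₁, e₁⟩, y₂, hy₂, e₂⟩ := h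
  refine ⟨d₁, h₁.resolve_left ?_, d₂, h₂.resolve_left ?_, hne, hadj, ⟨y₁, hy₁, e₁⟩, y₂, hy₂, e₂⟩
  · rintro rfl
    exact hx _ hy₁ e₁
  · rintro rfl
    exact hx _ hy₂ e₂

theorem minimal_spread_insert_iff {x : V} {P Y : Set V} (hx : ∀ y ∈ Y, ¬ G.Adj x y) :
    Minimal (fun Y => ConnectedOn G Y ∧ Spread G (insert x P) Y) Y ↔
      Minimal (fun Y => ConnectedOn G Y ∧ Spread G P Y) Y := by
  have hiff : ∀ Z ⊆ Y, Spread G (insert x P) Z ↔ Spread G P Z := fun Z hZ =>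
    ⟨fun h => h.of_insert fun z hz => hx z (hZ hz), fun h => h.mono (Set.subset_insert x P) le_rfl⟩
  exact ⟨fun h => ⟨⟨h.1.1, (hiff Y le_rfl).1 h.1.2⟩,
      fun Z hZ hZY => h.2 ⟨hZ.1, (hiff Z hZY).2 hZ.2⟩ hZY⟩,
    fun h => ⟨⟨h.1.1, (hiff Y le_rfl).2 h.1.2⟩,
      fun Z hZ hZY => h.2 ⟨hZ.1, (hiff Z hZY).1 hZ.2⟩ hZY⟩⟩

/-- The set `Y` has a neighbour in a connected subset of `P \ {z}` that contains `a`. If `P` is a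
path through `z` that starts in `a`, this says that `Y` has a neighbour on `P` before `z`. -/
def Attaches (G : SimpleGraph V) (a z : V) (P Y : Set V) : Prop :=
  ∃ C ⊆ P \ {z}, a ∈ C ∧ ConnectedOn G C ∧ ∃ u ∈ C, ∃ y ∈ Y, G.Adj u y

section IsIndPath

variable {n l : ℕ} {p : ℕ → V} {P Y : Set V}

theorem IsIndPath.attaches_left (hp : IsIndPath G n p) {k : ℕ} (hkl : k < l) (hl : l ≤ n)
    (hP : p '' Set.Icc 0 k ⊆ P) {y : V} (hy : y ∈ Y) (hky : G.Adj (p k) y) :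
    Attaches G (p 0) (p l) P Y := by
  refine ⟨p '' Set.Icc 0 k, fun v hv => ⟨hP hv, ?_⟩, ⟨0, ⟨le_rfl, k.zero_le⟩, rfl⟩,
    hp.connectedOn_Icc k.zero_le (by omega), p k, ⟨k, ⟨k.zero_le, le_rfl⟩, rfl⟩, y, hy, hky⟩
  obtain ⟨m, hm, rfl⟩ := hv
  intro hml
  have := hm.2
  have := hp.inj m (by omega) l hl hml
  omega

theorem IsIndPath.attaches_right (hp : IsIndPath G n p) {k : ℕ} (hlk : l < k) (hk : k ≤ n)
    (hP : p '' Set.Icc k n ⊆ P) {y : V} (hy : y ∈ Y) (hky : G.Adj (p k) y) :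
    Attaches G (p n) (p l) P Y := by
  refine ⟨p '' Set.Icc k n, fun v hv => ⟨hP hv, ?_⟩, ⟨n, ⟨hk, le_rfl⟩, rfl⟩,
    hp.connectedOn_Icc hk le_rfl, p k, ⟨k, ⟨le_rfl, hk⟩, rfl⟩, y, hy, hky⟩
  obtain ⟨m, hm, rfl⟩ := hv
  intro hml
  have := hm.1
  have := hp.inj m hm.2 l (by omega) hml
  omega

theorem IsIndPath.exists_lt_adj_of_attaches (hp : IsIndPath G n p) (hl : l ≤ n)
    (h : Attaches G (p 0) (p l) (p '' Set.Iic n) Y) : ∃ k < l, ∃ y ∈ Y, G.Adj (p k) y := by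
  obtain ⟨C, hC, h0, hCc, u, hu, huY⟩ := h
  obtain ⟨k, hk, rfl⟩ := hp.subset_image_Iio hl hCc h0 (fun h => (hC h).2 rfl)
    (fun _ _ v hv _ => (hC hv).1) hu
  exact ⟨k, hk, huY⟩

theorem IsIndPath.exists_gt_adj_of_attaches (hp : IsIndPath G n p) (hl : l ≤ n)
    (h : Attaches G (p n) (p l) (p '' Set.Iic n) Y) :
    ∃ k ≤ n, l < k ∧ ∃ y ∈ Y, G.Adj (p k) y := by
  obtain ⟨C, hC, hn, hCc, u, hu, huY⟩ := h
  obtain ⟨k, hk, rfl⟩ := hp.subset_image_Ioc hl hCc hn (fun h => (hC h).2 rfl)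
    (fun _ _ _ v hv _ => (hC hv).1) hu
  exact ⟨k, hk.2, hk.1, huY⟩

theorem IsIndPath.spread_of_attaches (hp : IsIndPath G n p) (hl : l ≤ n)
    (h₀ : Attaches G (p 0) (p l) (p '' Set.Iic n) Y)
    (hₙ : Attaches G (p n) (p l) (p '' Set.Iic n) Y) : Spread G (p '' Set.Iic n) Y := by
  obtain ⟨k, hkl, hk⟩ := hp.exists_lt_adj_of_attaches hl h₀
  obtain ⟨m, hmn, hlm, hm⟩ := hp.exists_gt_adj_of_attaches hl hₙ
  refine ⟨p k, ⟨k, (hkl.trans_le hl).le, rfl⟩, p m, ⟨m, hmn, rfl⟩, fun hkm => ?_, fun hkm => ?_,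
    hk, hm⟩
  · have := hp.inj k (by omega) m hmn hkm
    omega
  · have := (hp.adj k (by omega) m hmn).1 hkm
    omega

variable {Y' : Set V} {i j : ℕ}

theorem image_sub_Icc (p : ℕ → V) {l r n : ℕ} (hl : l ≤ n) (hr : r ≤ n) :
    (fun k => p (n - k)) '' Set.Icc (n - r) (n - l) = p '' Set.Icc l r := by
  ext v
  constructor
  · rintro ⟨k, ⟨hrk, hkl⟩, rfl⟩
    exact ⟨n - k, ⟨by omega, by omega⟩, rfl⟩
  · rintro ⟨k, ⟨hlk, hkr⟩, rfl⟩
    exact ⟨n - k, ⟨by omega, by omega⟩, congrArg p (Nat.sub_sub_self (hkr.trans hr))⟩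

theorem IsDetour.detour_reverse (h : IsDetour G n p Y i j) :
    detour n (fun k => p (n - k)) Y (n - j) (n - i) = detour n p Y i j := by
  have hi := h.left_lt
  have hj := h.le
  have hleft := image_sub_Icc p (Nat.zero_le n) (r := i) (by omega)
  have hright := image_sub_Icc p hj le_rfl
  rw [Nat.sub_zero] at hleft
  rw [Nat.sub_self] at hright
  unfold detour
  rw [hleft, hright, Set.union_comm, Set.union_comm _ Y, Set.union_assoc]

theorem IsDetour.exists_attaches_of_le (h : IsDetour G n p Y' i j) (hY : ConnectedOn G Y)
    (hY'Y : Y' ⊆ Y) (hli : l ≤ i) (hl₀ : Attaches G (p 0) (p l) (p '' Set.Iic n) Y) :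
    ∃ Z ⊆ Y \ Y', ConnectedOn G Z ∧ Attaches G (p 0) (p l) (detour n p Y' i j) Z ∧
      Attaches G (p n) (p l) (detour n p Y' i j) Z := by
  have hgap := h.add_two_le
  have hi := h.left_lt
  obtain ⟨k, hkl, y, hy, hky⟩ := h.isIndPath.exists_lt_adj_of_attaches (by omega) hl₀
  have hyY' : y ∉ Y' := fun hyY' => by
    have := h.between k (by omega) y hyY' hky
    omega
  obtain ⟨Z, hZ, hyZ, hZc, z, hz, y', hy', hzy'⟩ :=
    hY.exists_adj_component h.connectedOn.nonempty hY'Y ⟨hy, hyY'⟩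
  refine ⟨Z, hZ, hZc, h.isIndPath.attaches_left hkl (by omega) ?_ hyZ hky,
    Y' ∪ p '' Set.Icc j n, ?_, Or.inr ⟨n, ⟨h.le, le_rfl⟩, rfl⟩, h.connectedOn_right, y',
    Or.inl hy', z, hz, hzy'.symm⟩
  · rintro _ ⟨m, hm, rfl⟩
    have := hm.2
    exact Or.inl (Or.inl ⟨m, ⟨hm.1, by omega⟩, rfl⟩)
  · rintro v (hv | ⟨m, ⟨hjm, hmn⟩, rfl⟩)
    · exact ⟨Or.inl (Or.inr hv), fun hvl => h.notMem l (by omega) (hvl ▸ hv)⟩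
    · refine ⟨Or.inr ⟨m, ⟨hjm, hmn⟩, rfl⟩, fun hml => ?_⟩
      have := h.isIndPath.inj m hmn l (by omega) hml
      omega

theorem IsDetour.exists_attaches (h : IsDetour G n p Y' i j) (hY : ConnectedOn G Y)
    (hY'Y : Y' ⊆ Y) (hl : l ≤ n) (hlmem : p l ∈ detour n p Y' i j)
    (hl₀ : Attaches G (p 0) (p l) (p '' Set.Iic n) Y)
    (hlₙ : Attaches G (p n) (p l) (p '' Set.Iic n) Y) :
    ∃ Z ⊆ Y \ Y', ConnectedOn G Z ∧ Attaches G (p 0) (p l) (detour n p Y' i j) Z ∧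
      Attaches G (p n) (p l) (detour n p Y' i j) Z := by
  rcases (h.mem_detour_iff hl).1 hlmem with hli | hjl
  · exact h.exists_attaches_of_le hY hY'Y hli hl₀
  · have hrev := h.reverse.exists_attaches_of_le hY hY'Y (Nat.sub_le_sub_left hjl n)
    simp only [Nat.sub_zero, Nat.sub_self, Nat.sub_sub_self hl, image_sub_Iic, h.detour_reverse]
      at hrev
    obtain ⟨Z, hZ, hZc, hZn, hZ0⟩ := hrev hlₙ
    exact ⟨Z, hZ, hZc, hZ0, hZn⟩

end IsIndPath

/-- The vertex sets of the induced `a`–`b` paths inside `W`. -/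
def pathsIn (G : SimpleGraph V) (a b : V) (W : Set V) : Set (Set V) :=
  {P | IsPathSet G a b P ∧ P ⊆ W}

/-- Two induced `a`–`b` paths are adjacent if their union forms a solid together with `x`
and contains no third such path, so that the solid determines the two paths. -/
def swapGraph (G : SimpleGraph V) (x a b : V) (W : Set V) : SimpleGraph (pathsIn G a b W) where
  Adj P R := P ≠ R ∧ insert x (P ∪ R : Set V) ∈ G.solids ∧
    ∀ T : pathsIn G a b W, (T : Set V) ⊆ P ∪ R → T = P ∨ T = R
  symm := ⟨fun P R ⟨hne, hsolid, huniq⟩ => by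
    rw [Set.union_comm] at hsolid huniq
    exact ⟨hne.symm, hsolid, fun T hT => (huniq T hT).symm⟩⟩
  loopless := ⟨fun _ h => h.1 rfl⟩

variable [Finite V] {x a b : V} {W : Set V}

theorem IsDetour.swapGraph_adj {n i j : ℕ} {p : ℕ → V} {Y : Set V} (h : IsDetour G n p Y i j)
    (hne : p 0 ≠ p n) (hxW : x ∉ W) (hW : ∀ v ∈ W, (G.Adj x v ↔ v = p 0 ∨ v = p n))
    (hY : Minimal (fun Y => ConnectedOn G Y ∧ Spread G (p '' Set.Iic n) Y) Y) (hYW : Y ⊆ W)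
    (hP : p '' Set.Iic n ∈ pathsIn G (p 0) (p n) W)
    (hR : detour n p Y i j ∈ pathsIn G (p 0) (p n) W) :
    (swapGraph G x (p 0) (p n) W).Adj ⟨_, hP⟩ ⟨_, hR⟩ := by
  have hxY : ∀ y ∈ Y, ¬ G.Adj x y := by
    intro y hy hxy
    rcases (hW y (hYW hy)).1 hxy with rfl | rfl
    exacts [h.notMem 0 n.zero_le hy, h.notMem n le_rfl hy]
  have hdis : Disjoint (insert x (p '' Set.Iic n)) Y := by
    rw [Set.disjoint_left]
    rintro v (rfl | ⟨k, hk, rfl⟩) hv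
    exacts [hxW (hYW hv), h.notMem k hk hv]
  refine ⟨fun heq => h.not_subset_detour (congrArg Subtype.val heq).le, ?_, fun T hT => ?_⟩
  · change insert x (p '' Set.Iic n ∪ detour n p Y i j) ∈ G.solids
    rw [h.union_detour, ← Set.insert_union]
    exact union_mem_solids_of_minimal (hP.1.insert_mem_inducedCycles hne
      (fun v hv => hW v (hP.2 hv)) fun hx => hxW (hP.2 hx)) hdis
      ((minimal_spread_insert_iff hxY).2 hY)
  · simpa only [Subtype.ext_iff] using h.eq_or_eq_detour hY T.2.1 (h.union_detour ▸ hT)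

theorem exists_reachable_avoiding (hab : a ≠ b) (hxW : x ∉ W)
    (hW : ∀ v ∈ W, (G.Adj x v ↔ v = a ∨ v = b)) {z : V} {Y : Set V} (hYc : ConnectedOn G Y)
    (hYW : Y ⊆ W) (P : pathsIn G a b W) (hzP : z ∈ (P : Set V)) (hdis : Disjoint (P : Set V) Y)
    (ha : Attaches G a z P Y) (hb : Attaches G b z P Y) :
    ∃ P' : pathsIn G a b W, (P' : Set V) ⊆ P ∪ Y ∧ z ∉ (P' : Set V) ∧
      (swapGraph G x a b W).Reachable P P' := by
  induction Y using WellFoundedLT.induction generalizing P with | _ Y ih => ?_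
  obtain ⟨P, hP, hPW⟩ := P
  obtain ⟨n, p, rfl, rfl, rfl, hp⟩ := hP.exists_isIndPath
  obtain ⟨l, hl, rfl⟩ := hzP
  obtain ⟨Y', hY'Y, hY'⟩ := Finite.exists_le_minimal
    (p := fun Y => ConnectedOn G Y ∧ Spread G (p '' Set.Iic n) Y)
    ⟨hYc, hp.spread_of_attaches hl ha hb⟩
  obtain ⟨i, j, h⟩ := hp.exists_isDetour hY'.1.1 hY'.1.2 (hdis.mono_right hY'Y)
  have hRY : detour n p Y' i j ⊆ p '' Set.Iic n ∪ Y :=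
    h.detour_subset.trans (Set.union_subset_union_right _ hY'Y)
  have hR : detour n p Y' i j ∈ pathsIn G (p 0) (p n) W :=
    ⟨h.isPathSet_detour hY', hRY.trans (Set.union_subset hPW hYW)⟩
  have hadj := (h.swapGraph_adj hab hxW hW hY' (hY'Y.trans hYW) ⟨hP, hPW⟩ hR).reachable
  by_cases hlR : p l ∈ detour n p Y' i j
  swap
  · exact ⟨⟨_, hR⟩, hRY, hlR, hadj⟩
  obtain ⟨Z, hZ, hZc, hZ₀, hZₙ⟩ := h.exists_attaches hYc hY'Y hl hlR ha hb
  have hZY : Z ⊂ Y := by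
    obtain ⟨y, hy⟩ := h.connectedOn.nonempty
    exact ⟨fun z hz => (hZ hz).1, fun hYZ => (hZ (hYZ (hY'Y hy))).2 hy⟩
  have hZR : Disjoint (detour n p Y' i j) Z :=
    Set.disjoint_left.2 fun v hvR hvZ => (h.detour_subset hvR).elim
      (fun hvP => Set.disjoint_left.1 hdis hvP (hZ hvZ).1) (hZ hvZ).2
  obtain ⟨P', hP', hlP', hreach⟩ := ih Z hZY hZc (hZY.1.trans hYW) ⟨_, hR⟩ hlR hZR hZ₀ hZₙ
  exact ⟨P', hP'.trans (Set.union_subset hRY (hZY.1.trans Set.subset_union_right)), hlP',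
    hadj.trans hreach⟩

end Swap

section SwapCount

variable {V : Type*} {G : SimpleGraph V}

theorem IsIndPath.subset_of_forall_not_adj {n l : ℕ} {p : ℕ → V} (hp : IsIndPath G n p)
    (hl : l ≤ n) {T : Set V} (hT : ConnectedOn G T) (h₀ : p 0 ∈ T) (hlT : p l ∉ T)
    (hsep : ∀ Y ⊆ T \ p '' Set.Iic n, ConnectedOn G Y → (∃ k < l, ∃ y ∈ Y, G.Adj (p k) y) →
      ∀ m, l < m → m ≤ n → ∀ y ∈ Y, ¬ G.Adj y (p m)) :
    T ⊆ p '' Set.Iio l ∪ T \ p '' Set.Iic n := by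
  have hsub : T ⊆ p '' Set.Iio l ∪ {v | ∃ Y ⊆ T \ p '' Set.Iic n, v ∈ Y ∧ ConnectedOn G Y ∧
      ∃ k < l, ∃ y ∈ Y, G.Adj (p k) y} := by
    refine hT.subset_of_closed _ h₀ (Or.inl ⟨0, Nat.pos_of_ne_zero ?_, rfl⟩) ?_
    · exact fun h => hlT (h ▸ h₀)
    rintro v hv - w hwT hvw
    by_cases hw : w ∈ p '' Set.Iic n
    · obtain ⟨m, hm, rfl⟩ := hw
      have hml : m ≠ l := fun hml => hlT (hml ▸ hwT)
      refine Or.inl ⟨m, lt_of_le_of_ne (not_lt.1 fun hlm => ?_) hml, rfl⟩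
      rcases hv with ⟨k, hk, rfl⟩ | ⟨Y, hYT, hvY, hY, hYl⟩
      · have hk' : k < l := hk
        have := (hp.adj k (by omega) m hm).1 hvw
        omega
      · exact hsep Y hYT hY hYl m hlm hm v hvY hvw
    · rcases hv with ⟨k, hk, rfl⟩ | ⟨Y, hYT, hvY, hY, k, hk, y, hy, hky⟩
      · exact Or.inr ⟨{w}, Set.singleton_subset_iff.2 ⟨hwT, hw⟩, rfl, connectedOn_singleton w,
          k, hk, w, rfl, hvw⟩
      · exact Or.inr ⟨insert w Y, Set.insert_subset ⟨hwT, hw⟩ hYT, Or.inl rfl,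
          hY.insert_of_adj hvY hvw, k, hk, y, Or.inr hy, hky⟩
  exact hsub.trans (Set.union_subset_union_right _ fun v ⟨_, hYT, hvY, _⟩ => hYT hvY)

theorem IsIndPath.exists_attaches_of_connectedOn {n l : ℕ} {p : ℕ → V} (hp : IsIndPath G n p)
    (hl : l ≤ n) {T : Set V} (hT : ConnectedOn G T) (h₀ : p 0 ∈ T) (hₙ : p n ∈ T)
    (hlT : p l ∉ T) :
    ∃ Y ⊆ T \ p '' Set.Iic n, ConnectedOn G Y ∧ Attaches G (p 0) (p l) (p '' Set.Iic n) Y ∧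
      Attaches G (p n) (p l) (p '' Set.Iic n) Y := by
  by_contra! hno
  have hsub : T ⊆ p '' Set.Iio l ∪ T \ p '' Set.Iic n := by
    refine hp.subset_of_forall_not_adj hl hT h₀ hlT ?_
    rintro Y hYT hY ⟨k, hk, y, hy, hky⟩ m hlm hmn z hz hzm
    refine hno Y hYT hY (hp.attaches_left hk hl ?_ hy hky)
      (hp.attaches_right hlm hmn ?_ hz hzm.symm)
    · exact Set.image_mono fun i hi => hi.2.trans (hk.le.trans hl)
    · exact Set.image_mono fun i hi => hi.2
  rcases hsub hₙ with ⟨k, hk, hkn⟩ | hn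
  · have hk' : k < l := hk
    have := hp.inj k (by omega) n le_rfl hkn
    omega
  · exact hn.2 ⟨n, Set.mem_Iic.2 le_rfl, rfl⟩

variable {x a b : V} {W : Set V}

/-- The solids inside `insert x W` that contain `x`, `a` and `b`. -/
def solidsAt (G : SimpleGraph V) (x a b : V) (W : Set V) : Set (Set V) :=
  {s | s ∈ G.solids ∧ s ⊆ insert x W ∧ x ∈ s ∧ a ∈ s ∧ b ∈ s}

theorem swapGraph_eq_of_subset {P R P' R' : pathsIn G a b W} (h : (swapGraph G x a b W).Adj P R)
    (h' : P' ≠ R') (hsub : (P' ∪ R' : Set V) ⊆ P ∪ R) : s(P, R) = s(P', R') := by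
  have hP' := h.2.2 P' (Set.subset_union_left.trans hsub)
  have hR' := h.2.2 R' (Set.subset_union_right.trans hsub)
  grind

theorem IsPathSet.exists_attaches_of_connectedOn {z : V} {P T : Set V} (hP : IsPathSet G a b P)
    (hT : ConnectedOn G T) (ha : a ∈ T) (hb : b ∈ T) (hzP : z ∈ P) (hzT : z ∉ T) :
    ∃ Y ⊆ T \ P, ConnectedOn G Y ∧ Attaches G a z P Y ∧ Attaches G b z P Y := by
  obtain ⟨n, p, rfl, rfl, rfl, hp⟩ := hP.exists_isIndPath
  obtain ⟨l, hl, rfl⟩ := hzP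
  exact hp.exists_attaches_of_connectedOn hl hT ha hb hzT

variable [Finite V]

theorem swapGraph_preconnected (hab : a ≠ b) (hxW : x ∉ W)
    (hW : ∀ v ∈ W, (G.Adj x v ↔ v = a ∨ v = b)) : (swapGraph G x a b W).Preconnected := by
  intro P R
  induction hU : (P ∪ R : Set V) using WellFoundedLT.induction generalizing P with | _ U ih => ?_
  by_cases hPR : (P : Set V) ⊆ R
  · rw [Subtype.ext (R.2.1.eq_of_subset P.2.1.left_mem P.2.1.right_mem P.2.1.connectedOn hPR)]
  obtain ⟨z, hzP, hzR⟩ := Set.not_subset.1 hPR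
  obtain ⟨Y, hYR, hY, ha, hb⟩ := P.2.1.exists_attaches_of_connectedOn R.2.1.connectedOn
    R.2.1.left_mem R.2.1.right_mem hzP hzR
  obtain ⟨P', hP'Y, hzP', hreach⟩ := exists_reachable_avoiding hab hxW hW hY
    (fun y hy => R.2.2 (hYR hy).1) P hzP (Set.disjoint_left.2 fun v hv hvY => (hYR hvY).2 hv) ha hb
  refine hreach.trans (ih _ ?_ P' rfl)
  subst hU
  refine ⟨Set.union_subset (hP'Y.trans ?_) Set.subset_union_right, fun h => ?_⟩
  · exact Set.union_subset_union_right _ fun y hy => (hYR hy).1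
  · exact (h (Or.inl hzP)).elim hzP' hzR

theorem ncard_pathsIn_le (hab : a ≠ b) (hxW : x ∉ W)
    (hW : ∀ v ∈ W, (G.Adj x v ↔ v = a ∨ v = b)) :
    (pathsIn G a b W).ncard ≤ (solidsAt G x a b W).ncard + 1 := by
  rcases (pathsIn G a b W).eq_empty_or_nonempty with h | hne
  · rw [h, Set.ncard_empty]
    exact Nat.zero_le _
  have hconn : (swapGraph G x a b W).Connected :=
    { preconnected := swapGraph_preconnected hab hxW hW, nonempty := hne.to_subtype }
  rw [← Nat.card_coe_set_eq, ← Nat.card_coe_set_eq]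
  refine hconn.card_vert_le_card_edgeSet_add_one.trans (Nat.add_le_add_right ?_ 1)
  let solidOf : Sym2 (pathsIn G a b W) → Set V := Sym2.lift
    ⟨fun P R => insert x (P ∪ R : Set V),
      fun P R => congrArg (insert x) (Set.union_comm _ _)⟩
  have solidOf_mem : ∀ e ∈ (swapGraph G x a b W).edgeSet, solidOf e ∈ solidsAt G x a b W := by
    rintro ⟨P, R⟩ h
    exact ⟨h.2.1, Set.insert_subset_insert (Set.union_subset P.2.2 R.2.2), Or.inl rfl,
      Or.inr (Or.inl P.2.1.left_mem), Or.inr (Or.inl P.2.1.right_mem)⟩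
  refine Nat.card_le_card_of_injective
    (fun e : (swapGraph G x a b W).edgeSet => (⟨solidOf e, solidOf_mem e e.2⟩ : solidsAt G x a b W))
    ?_
  rintro ⟨⟨P, R⟩, h : (swapGraph G x a b W).Adj P R⟩
    ⟨⟨P', R'⟩, h' : (swapGraph G x a b W).Adj P' R'⟩ heq
  have hunion : insert x (P ∪ R : Set V) = insert x (P' ∪ R' : Set V) := congrArg Subtype.val heq
  refine Subtype.ext (swapGraph_eq_of_subset h h'.ne fun v hv => ?_)
  exact (hunion ▸ Or.inr hv : v ∈ insert x (P ∪ R : Set V)).resolve_left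
    fun hvx => hxW (hvx ▸ Set.union_subset P'.2.2 R'.2.2 hv)

end SwapCount

section SolidOfTriple

variable {V : Type*} {G : SimpleGraph V} {W : Set V} {x a b c : V}

/-- Some connected subset of `W` contains `a` and `b`, that is, `W` contains an `a`–`b` path. -/
def LinkedIn (G : SimpleGraph V) (W : Set V) (a b : V) : Prop :=
  ∃ C ⊆ W, ConnectedOn G C ∧ a ∈ C ∧ b ∈ C

theorem LinkedIn.symm (h : LinkedIn G W a b) : LinkedIn G W b a :=
  let ⟨C, hCW, hC, ha, hb⟩ := h
  ⟨C, hCW, hC, hb, ha⟩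

theorem LinkedIn.left_mem (h : LinkedIn G W a b) : a ∈ W :=
  let ⟨_, hCW, _, ha, _⟩ := h
  hCW ha

theorem LinkedIn.mono {W' : Set V} (h : LinkedIn G W a b) (hW : W ⊆ W') : LinkedIn G W' a b :=
  let ⟨C, hCW, hC⟩ := h
  ⟨C, hCW.trans hW, hC⟩

theorem LinkedIn.exists_isPathSet [Finite V] (h : LinkedIn G W a b) :
    ∃ P ⊆ W, IsPathSet G a b P :=
  let ⟨_, hCW, hC, ha, hb⟩ := h
  let ⟨P, hPC, hP⟩ := hC.exists_isPathSet ha hb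
  ⟨P, hPC.trans hCW, hP⟩

theorem isPathSet_pair (hab : G.Adj a b) : IsPathSet G a b {a, b} :=
  ⟨⟨Or.inl rfl, Or.inr rfl, (connectedOn_singleton b).insert_of_adj rfl hab.symm⟩,
    fun _ hQ _ => Set.insert_subset hQ.1 (Set.singleton_subset_iff.2 hQ.2.1)⟩

theorem LinkedIn.of_adj (hab : G.Adj a b) (hW : {a, b} ⊆ W) : LinkedIn G W a b :=
  ⟨{a, b}, hW, (isPathSet_pair hab).connectedOn, Or.inl rfl, Or.inr rfl⟩

theorem triangle_mem_inducedCycles (hab : G.Adj a b) (hac : G.Adj a c) (hbc : G.Adj b c) :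
    ({a, b, c} : Set V) ∈ G.inducedCycles := by
  refine (isPathSet_pair hbc).insert_mem_inducedCycles hbc.ne ?_ ?_
  · rintro v (rfl | rfl)
    · simp [hab]
    · simp [hac]
  · rintro (rfl | rfl)
    exacts [hab.ne rfl, hac.ne rfl]

theorem IsComponent.exists_adj_of_linkedIn {P Y : Set V} (hY : IsComponent G (W \ P) Y)
    (hcY : c ∈ Y) (hbP : b ∈ P) (h : LinkedIn G (W \ {a}) b c) :
    ∃ u ∈ P, u ∈ W ∧ u ≠ a ∧ ∃ y ∈ Y, G.Adj u y := by
  obtain ⟨C, hCW, hC, hbC, hcC⟩ := h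
  by_contra! hno
  have hCY : C ⊆ Y := hC.subset_of_closed Y hcC hcY fun y hy _ v hv hyv => by
    obtain ⟨hvW, hva⟩ := hCW hv
    by_cases hvP : v ∈ P
    · exact absurd hyv.symm (hno v hvP hvW hva y hy)
    · exact hY.closed y hy v ⟨hvW, hvP⟩ hyv
  exact (hY.subset (hCY hbC)).2 hbP

variable [Finite V]

theorem exists_solid_of_minimal_spread (hxW : x ∉ W) (hne : a ≠ b)
    (hW : ∀ v ∈ W, (G.Adj x v ↔ v = a ∨ v = b ∨ v = c)) {P Y : Set V} (hP : IsPathSet G a b P)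
    (hPW : P ⊆ W \ {c}) (hcY : c ∈ Y) (hYW : Y ⊆ W) (hdis : Disjoint P Y)
    (hY : Minimal (fun Y => ConnectedOn G Y ∧ Spread G (insert x P) Y) Y) :
    ∃ s ∈ G.solids, s ⊆ insert x W ∧ {x, a, b, c} ⊆ s := by
  have hcycle : insert x P ∈ G.inducedCycles := hP.insert_mem_inducedCycles hne
    (fun v hv => by have := hW v (hPW hv).1; have : v ≠ c := (hPW hv).2; tauto)
    fun h => hxW (hPW h).1
  have hdis' : Disjoint (insert x P) Y := Set.disjoint_insert_left.2 ⟨fun h => hxW (hYW h), hdis⟩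
  refine ⟨insert x P ∪ Y, union_mem_solids_of_minimal hcycle hdis' hY, ?_, ?_⟩
  · rw [Set.insert_union]
    exact Set.insert_subset_insert (Set.union_subset (fun v hv => (hPW hv).1) hYW)
  · rintro v (rfl | rfl | rfl | rfl)
    exacts [Or.inl (Or.inl rfl), Or.inl (Or.inr hP.left_mem), Or.inl (Or.inr hP.right_mem),
      Or.inr hcY]

theorem exists_solid_of_isPathSet (hxW : x ∉ W) (hne : a ≠ b)
    (hW : ∀ v ∈ W, (G.Adj x v ↔ v = a ∨ v = b ∨ v = c)) {P Y : Set V} (hP : IsPathSet G a b P)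
    (hPW : P ⊆ W \ {c}) (hY : ConnectedOn G Y) (hcY : c ∈ Y) (hYW : Y ⊆ W) (hdis : Disjoint P Y)
    (hs : Spread G (insert x P) Y) :
    ∃ s ∈ G.solids, s ⊆ insert x W ∧ {x, a, b, c} ⊆ s := by
  induction Y using WellFoundedLT.induction generalizing P with | _ Y ih => ?_
  obtain ⟨Y', hY'Y, hY'⟩ := Finite.exists_le_minimal
    (p := fun Y => ConnectedOn G Y ∧ Spread G (insert x P) Y) ⟨hY, hs⟩
  have hcx : G.Adj x c := (hW c (hYW hcY)).2 (Or.inr (Or.inr rfl))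
  by_cases hcY' : c ∈ Y'
  · exact exists_solid_of_minimal_spread hxW hne hW hP hPW hcY' (hY'Y.trans hYW)
      (hdis.mono_right hY'Y) hY'
  have hxY' : ∀ y ∈ Y', ¬ G.Adj x y := by
    intro y hy hxy
    rcases (hW y (hYW (hY'Y hy))).1 hxy with rfl | rfl | rfl
    exacts [Set.disjoint_left.1 hdis hP.left_mem (hY'Y hy),
      Set.disjoint_left.1 hdis hP.right_mem (hY'Y hy), hcY' hy]
  obtain ⟨Z, hZ, hcZ, hZc, z, hz, y, hy, hzy⟩ :=
    hY.exists_adj_component hY'.1.1.nonempty hY'Y ⟨hcY, hcY'⟩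
  obtain ⟨n, p, rfl, rfl, rfl, hp⟩ := hP.exists_isIndPath
  have hY'P := (minimal_spread_insert_iff hxY').1 hY'
  obtain ⟨i, j, hdetour⟩ := hp.exists_isDetour hY'.1.1 hY'P.1.2 (hdis.mono_right hY'Y)
  have hyW : y ∈ W := hYW (hY'Y hy)
  refine ih Z ⟨fun z hz => (hZ hz).1, fun h => (hZ (h (hY'Y hy))).2 hy⟩
    (hdetour.isPathSet_detour hY'P)
    (hdetour.detour_subset.trans (Set.union_subset hPW fun v hv =>
      ⟨hYW (hY'Y hv), fun h => hcY' (h ▸ hv)⟩))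
    hZc hcZ (fun v hv => hYW (hZ hv).1) ?_ ?_
  · exact Set.disjoint_left.2 fun v hv hvZ => (hdetour.detour_subset hv).elim
      (fun h => Set.disjoint_left.1 hdis h (hZ hvZ).1) (hZ hvZ).2
  · exact ⟨x, Or.inl rfl, y, Or.inr (IsDetour.subset_detour hy), fun h => hxW (h ▸ hyW), hxY' y hy,
      ⟨c, hcZ, hcx⟩, z, hz, hzy.symm⟩

theorem exists_solid_of_not_adj (hab : ¬ G.Adj a b) (hxW : x ∉ W) (hne : a ≠ b)
    (hW : ∀ v ∈ W, (G.Adj x v ↔ v = a ∨ v = b ∨ v = c)) (hlab : LinkedIn G (W \ {c}) a b)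
    (hlac : LinkedIn G (W \ {b}) a c) (hlbc : LinkedIn G (W \ {a}) b c) :
    ∃ s ∈ G.solids, s ⊆ insert x W ∧ {x, a, b, c} ⊆ s := by
  obtain ⟨P, hPW, hP⟩ := hlab.exists_isPathSet
  have hcW : c ∈ W := hlac.symm.left_mem.1
  obtain ⟨Y, hY, hcY⟩ := exists_isComponent G (s := W \ P) ⟨hcW, fun h => (hPW h).2 rfl⟩
  refine exists_solid_of_isPathSet hxW hne hW hP hPW hY.connectedOn hcY
    (fun v hv => (hY.subset hv).1) (Set.disjoint_left.2 fun v hv hvY => (hY.subset hvY).2 hv) ?_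
  have spread_of_adj : ∀ u ∈ P, u ∈ W → u ≠ a → u ≠ b → (∃ y ∈ Y, G.Adj u y) →
      Spread G (insert x P) Y := by
    intro u huP huW hua hub huY
    refine ⟨x, Or.inl rfl, u, Or.inr huP, fun h => hxW (h ▸ huW), fun h => ?_,
      ⟨c, hcY, (hW c hcW).2 (Or.inr (Or.inr rfl))⟩, huY⟩
    rcases (hW u huW).1 h with h | h | h
    exacts [hua h, hub h, (hPW huP).2 h]
  obtain ⟨u, huP, huW, hua, huY⟩ := hY.exists_adj_of_linkedIn hcY hP.right_mem hlbc
  obtain ⟨u', hu'P, hu'W, hu'b, hu'Y⟩ := hY.exists_adj_of_linkedIn hcY hP.left_mem hlac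
  by_cases hub : u = b
  swap
  · exact spread_of_adj u huP huW hua hub huY
  by_cases hu'a : u' = a
  swap
  · exact spread_of_adj u' hu'P hu'W hu'a hu'b hu'Y
  subst hub hu'a
  exact ⟨u', Or.inr hu'P, u, Or.inr huP, hne, hab, hu'Y, huY⟩

theorem exists_solid_of_linkedIn (hxW : x ∉ W) (hab : a ≠ b) (hac : a ≠ c) (hbc : b ≠ c)
    (hW : ∀ v ∈ W, (G.Adj x v ↔ v = a ∨ v = b ∨ v = c)) (hlab : LinkedIn G (W \ {c}) a b)
    (hlac : LinkedIn G (W \ {b}) a c) (hlbc : LinkedIn G (W \ {a}) b c) :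
    ∃ s ∈ G.solids, s ⊆ insert x W ∧ {x, a, b, c} ⊆ s := by
  by_cases eab : G.Adj a b
  swap
  · exact exists_solid_of_not_adj eab hxW hab hW hlab hlac hlbc
  by_cases eac : G.Adj a c
  swap
  · rw [Set.pair_comm b c]
    exact exists_solid_of_not_adj eac hxW hac (fun v hv => (hW v hv).trans (by tauto)) hlac hlab
      hlbc.symm
  by_cases ebc : G.Adj b c
  swap
  · rw [Set.insert_comm a b, Set.pair_comm a c]
    exact exists_solid_of_not_adj ebc hxW hbc (fun v hv => (hW v hv).trans (by tauto)) hlbc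
      hlab.symm hlac.symm
  have hsub : ({a, b, c} : Set V) ⊆ W := by
    rintro v (rfl | rfl | rfl)
    exacts [hlab.left_mem.1, hlbc.left_mem.1, hlac.symm.left_mem.1]
  have hxabc : ∀ v ∈ ({a, b, c} : Set V), G.Adj x v := fun v hv => (hW v (hsub hv)).2 hv
  exact ⟨insert x {a, b, c}, insert_mem_solids_of_pyramid (triangle_mem_inducedCycles eab eac ebc)
    (fun h => hxW (hsub h)) (by simp) (by simp) (by simp) hab hac hbc (hxabc a (by simp))
    (hxabc b (by simp)) (hxabc c (by simp)), Set.insert_subset_insert hsub, le_rfl⟩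

end SolidOfTriple

section Avoidable

variable {V : Type*} {G : SimpleGraph V} {A T T' s : Set V} {x a b : V}

/-- The vertices of `A` outside the closed neighbourhood of `x`, together with the neighbours of
`x` in `A` that belong to `T`. -/
def awayFrom (G : SimpleGraph V) (A : Set V) (x : V) (T : Set V) : Set V :=
  {v | v ∈ A ∧ v ≠ x ∧ (G.Adj x v → v ∈ T)}

theorem awayFrom_subset : awayFrom G A x T ⊆ A := fun _ hv => hv.1

theorem notMem_awayFrom : x ∉ awayFrom G A x T := fun h => h.2.1 rfl

theorem awayFrom_mono (h : T ⊆ T') : awayFrom G A x T ⊆ awayFrom G A x T' :=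
  fun _ hv => ⟨hv.1, hv.2.1, fun hxv => h (hv.2.2 hxv)⟩

theorem not_adj_of_mem_awayFrom_empty (h : a ∈ awayFrom G A x ∅) : ¬ G.Adj x a := h.2.2

theorem adj_iff_of_mem_awayFrom (hT : T ⊆ A ∩ G.neighborSet x) :
    ∀ v ∈ awayFrom G A x T, (G.Adj x v ↔ v ∈ T) :=
  fun _ hv => ⟨hv.2.2, fun h => (hT h).2⟩

theorem subset_awayFrom (hT : T ⊆ A ∩ G.neighborSet x) : T ⊆ awayFrom G A x T :=
  fun _ hv => ⟨(hT hv).1, (hT hv).2.ne', fun _ => hv⟩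

theorem inter_neighborSet_eq (hT : T ⊆ A ∩ G.neighborSet x) (hTs : T ⊆ s)
    (hs : s ⊆ insert x (awayFrom G A x T)) : s ∩ (A ∩ G.neighborSet x) = T :=
  Set.Subset.antisymm
    (fun _ ⟨hvs, _, hxv⟩ => ((hs hvs).resolve_left (G.ne_of_adj hxv).symm).2.2 hxv)
    (Set.subset_inter hTs hT)

/-- A vertex `x` is avoidable in `A` if any two of its neighbours in `A` are joined by a path in
`A` that contains neither `x` nor any other neighbour of `x`. -/
def Avoidable (G : SimpleGraph V) (A : Set V) (x : V) : Prop :=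
  ∀ a ∈ A ∩ G.neighborSet x, ∀ b ∈ A ∩ G.neighborSet x, a ≠ b →
    LinkedIn G (awayFrom G A x {a, b}) a b

theorem linkedIn_awayFrom_of_adj (ha : a ∈ A ∩ G.neighborSet x) (hb : b ∈ A ∩ G.neighborSet x)
    (hab : G.Adj a b) : LinkedIn G (awayFrom G A x {a, b}) a b :=
  .of_adj hab (subset_awayFrom (Set.pair_subset ha hb))

theorem linkedIn_awayFrom_of_isComponent {W : Set V} (ha : a ∈ A ∩ G.neighborSet x)
    (hb : b ∈ A ∩ G.neighborSet x) (hW : IsComponent G (awayFrom G A x ∅) W)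
    (haW : ∃ w ∈ W, G.Adj w a) (hbW : ∃ w ∈ W, G.Adj w b) :
    LinkedIn G (awayFrom G A x {a, b}) a b := by
  obtain ⟨u, hu, hua⟩ := haW
  obtain ⟨w, hw, hwb⟩ := hbW
  obtain ⟨ha', hb'⟩ := Set.pair_subset_iff.1 (subset_awayFrom (Set.pair_subset ha hb))
  exact ⟨insert b (insert a W),
    Set.insert_subset hb' (Set.insert_subset ha' (hW.subset.trans (awayFrom_mono
      (Set.empty_subset _)))),
    (hW.connectedOn.insert_of_adj hu hua).insert_of_adj (Or.inr hw) hwb, Or.inr (Or.inl rfl),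
    Or.inl rfl⟩

theorem Avoidable.linkedIn_awayFrom_sdiff {c : V} (hx : Avoidable G A x)
    (ha : a ∈ A ∩ G.neighborSet x) (hb : b ∈ A ∩ G.neighborSet x) (hc : G.Adj x c) (hab : a ≠ b)
    (hac : a ≠ c) (hbc : b ≠ c) (hT : {a, b} ⊆ T) : LinkedIn G (awayFrom G A x T \ {c}) a b := by
  refine (hx a ha b hb hab).mono (Set.subset_sdiff_singleton (awayFrom_mono hT) fun h => ?_)
  rcases h.2.2 hc with h | h
  exacts [hac h.symm, hbc h.symm]

theorem exists_adj_mem_awayFrom [Finite V]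
    (hdeg : (A ∩ G.neighborSet x).ncard ≤ (A ∩ G.neighborSet a).ncard)
    (ha : a ∈ A ∩ G.neighborSet x) (hb : b ∈ A ∩ G.neighborSet x) (hab : a ≠ b)
    (hadj : ¬ G.Adj a b) : ∃ u ∈ awayFrom G A x ∅, G.Adj a u := by
  by_contra! hno
  have hsub : A ∩ G.neighborSet a ⊆ insert x ((A ∩ G.neighborSet x) \ {a, b}) := by
    rintro u ⟨huA, hau⟩
    by_cases hux : u = x
    · exact Or.inl hux
    refine Or.inr ⟨⟨huA, by_contra fun hxu => hno u ⟨huA, hux, fun h => (hxu h).elim⟩ hau⟩, ?_⟩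
    rintro (rfl | rfl)
    exacts [G.irrefl hau, hadj hau]
  have hpair : ({a, b} : Set V) ⊆ A ∩ G.neighborSet x := Set.pair_subset ha hb
  have hcard := Set.ncard_sdiff_add_ncard_of_subset hpair
  rw [Set.ncard_pair hab] at hcard
  have hle := (Set.ncard_le_ncard hsub).trans (Set.ncard_insert_le _ _)
  omega

theorem mem_component_of_minimal {v u : V} {K W : Set V} (hv : v ∈ A)
    (hK : IsComponent G (awayFrom G A v ∅) K)
    (hmin : ∀ y ∈ A, ∀ K', IsComponent G (awayFrom G A y ∅) K' → ¬ K' ⊂ K) (hx : x ∈ K)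
    (hW : IsComponent G (awayFrom G A x ∅) W) (hvW : v ∈ W) (ha : a ∈ K)
    (hu : u ∈ awayFrom G A x ∅) (hau : G.Adj a u) : u ∈ W := by
  obtain ⟨K', hK', huK'⟩ := exists_isComponent G hu
  by_cases hmeet : ∃ w ∈ K', w = v ∨ G.Adj v w
  · obtain ⟨w, hw, hwv⟩ := hmeet
    have hwW : w ∈ W := by
      rcases hwv with rfl | hvw
      exacts [hvW, hW.closed v hvW w (hK'.subset hw) hvw]
    exact hW.subset_of_mem hK'.connectedOn hK'.subset hw hwW huK'
  · push Not at hmeet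
    have hK'v : K' ⊆ awayFrom G A v ∅ := fun w hw =>
      ⟨(hK'.subset hw).1, (hmeet w hw).1, fun h => ((hmeet w hw).2 h).elim⟩
    have hK'K : K' ⊆ K := hK.subset_of_mem hK'.connectedOn hK'v huK'
      (hK.closed a ha u (hK'v huK') hau)
    exact absurd ⟨hK'K, fun h => notMem_awayFrom (hK'.subset (h hx))⟩
      (hmin x (hK.subset hx).1 K' hK')

theorem exists_avoidable_of_not_adj [Finite V] {v w : V} (hv : v ∈ A)
    (hw : w ∈ awayFrom G A v ∅) : ∃ x ∈ A, Avoidable G A x := by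
  obtain ⟨K₀, hK₀, -⟩ := exists_isComponent G hw
  obtain ⟨K, -, ⟨v, hv, hK⟩, hmin⟩ := Finite.exists_le_minimal
    (p := fun K => ∃ v ∈ A, IsComponent G (awayFrom G A v ∅) K) ⟨v, hv, hK₀⟩
  replace hmin : ∀ y ∈ A, ∀ K', IsComponent G (awayFrom G A y ∅) K' → ¬ K' ⊂ K :=
    fun y hy K' hK' hlt => hlt.2 (hmin ⟨y, hy, hK'⟩ hlt.1)
  obtain ⟨x, hxK, hxmin⟩ := Set.exists_min_image K (fun x => (A ∩ G.neighborSet x).ncard)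
    K.toFinite hK.connectedOn.nonempty
  have hvx : v ∈ awayFrom G A x ∅ :=
    ⟨hv, (hK.subset hxK).2.1.symm, fun h => (hK.subset hxK).2.2 h.symm⟩
  obtain ⟨W, hW, hvW⟩ := exists_isComponent G hvx
  have exists_adj_W : ∀ a ∈ A ∩ G.neighborSet x, ∀ b ∈ A ∩ G.neighborSet x, a ≠ b →
      ¬ G.Adj a b → ∃ u ∈ W, G.Adj u a := by
    intro a ha b hb hab hadj
    by_cases hva : G.Adj v a
    · exact ⟨v, hvW, hva⟩
    have hav : a ≠ v := by
      rintro rfl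
      exact not_adj_of_mem_awayFrom_empty hvx ha.2
    have haK : a ∈ K := hK.closed x hxK a ⟨ha.1, hav, fun h => (hva h).elim⟩ ha.2
    obtain ⟨u, hu, hau⟩ := exists_adj_mem_awayFrom (hxmin a haK) ha hb hab hadj
    exact ⟨u, mem_component_of_minimal hv hK hmin hxK hW hvW haK hu hau, hau.symm⟩
  refine ⟨x, (hK.subset hxK).1, fun a ha b hb hab => ?_⟩
  by_cases hadj : G.Adj a b
  · exact linkedIn_awayFrom_of_adj ha hb hadj
  · exact linkedIn_awayFrom_of_isComponent ha hb hW (exists_adj_W a ha b hb hab hadj)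
      (exists_adj_W b hb a ha hab.symm fun h => hadj h.symm)

theorem exists_avoidable [Finite V] (hA : A.Nonempty) : ∃ x ∈ A, Avoidable G A x := by
  by_cases hcomplete : ∃ v ∈ A, (awayFrom G A v ∅).Nonempty
  · obtain ⟨v, hv, w, hw⟩ := hcomplete
    exact exists_avoidable_of_not_adj hv hw
  · obtain ⟨x, hx⟩ := hA
    refine ⟨x, hx, fun a ha b hb hab => linkedIn_awayFrom_of_adj ha hb (by_contra fun hadj => ?_)⟩
    exact hcomplete ⟨a, ha.1, b, hb.1, hab.symm, fun h => (hadj h).elim⟩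

theorem ConnectedOn.inter_neighborSet_nonempty {y : V} (hA : ConnectedOn G A) (hx : x ∈ A)
    (hy : y ∈ A) (hxy : x ≠ y) : (A ∩ G.neighborSet x).Nonempty := by
  by_contra hno
  rw [Set.not_nonempty_iff_eq_empty] at hno
  have hAx : A ⊆ {x} := hA.subset_of_closed {x} hx rfl fun u hu _ v hv huv =>
    absurd (Set.mem_inter hv (hu ▸ huv : G.Adj x v)) (hno ▸ Set.notMem_empty v)
  exact hxy (hAx hy).symm

theorem Avoidable.connectedOn_sdiff (hx : Avoidable G A x) (hA : ConnectedOn G A)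
    (ha : a ∈ A ∩ G.neighborSet x) : ConnectedOn G (A \ {x}) := by
  refine connectedOn_of_closed (u := a) ⟨ha.1, ha.2.ne'⟩ fun U haU hU => ?_
  have neighbors_subset : ∀ b ∈ A, G.Adj x b → b ∈ U := by
    intro b hb hxb
    by_cases hab : a = b
    · exact hab ▸ haU
    obtain ⟨C, hCW, hC, haC, hbC⟩ := hx a ha b ⟨hb, hxb⟩ hab
    have hCA : C ⊆ A \ {x} := fun v hv => ⟨(hCW hv).1, (hCW hv).2.1⟩
    exact hC.subset_of_closed U haC haU
      (fun u hu huC v hv huv => hU u hu (hCA huC) v (hCA hv) huv) hbC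
  have hAU : A ⊆ insert x U := by
    refine hA.subset_of_closed (insert x U) ha.1 (Or.inr haU) fun u hu huA v hv huv => ?_
    by_cases hvx : v = x
    · exact Or.inl hvx
    by_cases hux : u = x
    · exact Or.inr (neighbors_subset v hv (hux ▸ huv))
    · exact Or.inr (hU u (hu.resolve_left hux) ⟨huA, hux⟩ v ⟨hv, hvx⟩ huv)
  exact fun v hv => (hAU hv.1).resolve_left hv.2

end Avoidable

section Coloring

variable {V : Type*} {G : SimpleGraph V} {A : Set V} {x : V} {k : ℕ}

/-- The subgraph of `G` induced by `A` has a proper colouring with the colours `0, …, k - 1`. The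
colours outside `A` are irrelevant, which lets colourings be extended vertex by vertex. -/
def ColorableOn (G : SimpleGraph V) (A : Set V) (k : ℕ) : Prop :=
  ∃ c : V → ℕ, (∀ v ∈ A, c v < k) ∧ ∀ u ∈ A, ∀ v ∈ A, G.Adj u v → c u ≠ c v

theorem ColorableOn.chromaticNumber_le (h : ColorableOn G Set.univ k) : G.chromaticNumber ≤ k := by
  obtain ⟨c, hc, hcol⟩ := h
  refine Colorable.chromaticNumber_le ⟨Coloring.mk (fun v => (⟨c v, hc v trivial⟩ : Fin k)) ?_⟩
  exact fun huv h => hcol _ trivial _ trivial huv (congrArg Fin.val h)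

theorem colorableOn_empty (G : SimpleGraph V) (k : ℕ) : ColorableOn G ∅ k :=
  ⟨fun _ => 0, by simp, by simp⟩

theorem colorableOn_singleton (G : SimpleGraph V) (x : V) (hk : k ≠ 0) : ColorableOn G {x} k := by
  refine ⟨fun _ => 0, fun _ _ => Nat.pos_of_ne_zero hk, ?_⟩
  rintro u rfl v rfl huv
  exact (G.irrefl huv).elim

theorem not_colorableOn_zero (hA : A.Nonempty) : ¬ ColorableOn G A 0 :=
  fun ⟨_, hc, _⟩ => let ⟨v, hv⟩ := hA; Nat.not_lt_zero _ (hc v hv)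

theorem colorableOn_of_coloring_sdiff {c : V → ℕ} {i : ℕ} (hc : ∀ v ∈ A \ {x}, c v < k)
    (hcol : ∀ u ∈ A \ {x}, ∀ v ∈ A \ {x}, G.Adj u v → c u ≠ c v) (hi : i < k)
    (hne : ∀ v ∈ A ∩ G.neighborSet x, c v ≠ i) : ColorableOn G A k := by
  classical
  refine ⟨Function.update c x i, fun v hv => ?_, fun u hu v hv huv => ?_⟩
  · by_cases hvx : v = x
    · rwa [hvx, Function.update_self]
    · rw [Function.update_of_ne hvx]
      exact hc v ⟨hv, hvx⟩
  by_cases hux : u = x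
  · subst hux
    rw [Function.update_self, Function.update_of_ne huv.ne']
    exact (hne v ⟨hv, huv⟩).symm
  by_cases hvx : v = x
  · subst hvx
    rw [Function.update_self, Function.update_of_ne hux]
    exact hne u ⟨hu, huv.symm⟩
  · rw [Function.update_of_ne hux, Function.update_of_ne hvx]
    exact hcol u ⟨hu, hux⟩ v ⟨hv, hvx⟩ huv

theorem ColorableOn.succ (h : ColorableOn G (A \ {x}) k) : ColorableOn G A (k + 1) := by
  obtain ⟨c, hc, hcol⟩ := h
  exact colorableOn_of_coloring_sdiff (fun v hv => (hc v hv).trans k.lt_succ_self) hcol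
    k.lt_succ_self fun v hv => (hc v ⟨hv.1, hv.2.ne'⟩).ne

variable [Finite V]

theorem ColorableOn.of_ncard_lt (h : ColorableOn G (A \ {x}) k)
    (hd : (A ∩ G.neighborSet x).ncard < k) : ColorableOn G A k := by
  obtain ⟨c, hc, hcol⟩ := h
  obtain ⟨i, hi, hiN⟩ : ∃ i ∈ Set.Iio k, i ∉ c '' (A ∩ G.neighborSet x) := by
    refine Set.exists_mem_notMem_of_ncard_lt_ncard ?_
    rw [Set.ncard_Iio_nat]
    exact (Set.ncard_image_le).trans_lt hd
  exact colorableOn_of_coloring_sdiff hc hcol hi fun v hv h => hiN ⟨v, hv, h⟩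

theorem choose_le_of_avoidable {β : Set V → ℤ} {r : ℕ} (hβ : ∀ x, 0 ≤ β {x})
    (hstep : ∀ A, ∀ x ∈ A, Avoidable G A x → (A ∩ G.neighborSet x).Nonempty →
      β (A \ {x}) + ((A ∩ G.neighborSet x).ncard - 1).choose r ≤ β A)
    (hA : ConnectedOn G A) (hk : ¬ ColorableOn G A k) : (k.choose (r + 1) : ℤ) ≤ β A := by
  induction A using WellFoundedLT.induction generalizing k with | _ A ih => ?_
  obtain ⟨x, hxA, hx⟩ := exists_avoidable (G := G) hA.nonempty
  by_cases hy : ∃ y ∈ A, x ≠ y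
  swap
  · push Not at hy
    obtain rfl : A = {x} := Set.eq_singleton_iff_unique_mem.2 ⟨hxA, fun y hyA => (hy y hyA).symm⟩
    obtain rfl : k = 0 := by_contra fun hk0 => hk (colorableOn_singleton G x hk0)
    simpa using hβ x
  obtain ⟨y, hyA, hxy⟩ := hy
  obtain ⟨a, ha⟩ := hA.inter_neighborSet_nonempty hxA hyA hxy
  have hlt : A \ {x} < A := Set.sdiff_singleton_ssubset.2 hxA
  have hconn := hx.connectedOn_sdiff hA ha
  have hle := hstep A x hxA hx ⟨a, ha⟩
  by_cases hdk : (A ∩ G.neighborSet x).ncard < k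
  · have := ih _ hlt hconn fun h => hk (h.of_ncard_lt hdk)
    omega
  cases k with
  | zero =>
    have := ih _ hlt hconn (not_colorableOn_zero hconn.nonempty)
    omega
  | succ k =>
    have hchoose : k.choose r ≤ ((A ∩ G.neighborSet x).ncard - 1).choose r :=
      Nat.choose_le_choose r (by omega)
    have := ih _ hlt hconn fun h => hk h.succ
    rw [Nat.choose_succ_succ']
    omega

end Coloring

section Counting

variable {V : Type*} [Finite V]

theorem ncard_setOf_subset_ncard_eq (N : Set V) (r : ℕ) :
    {t | t ⊆ N ∧ t.ncard = r}.ncard = N.ncard.choose r := by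
  classical
  have := Fintype.ofFinite V
  have himage : {t | t ⊆ N ∧ t.ncard = r} =
      (fun t : Finset V => (t : Set V)) '' (N.toFinset.powersetCard r : Finset (Finset V)) := by
    ext t
    constructor
    · rintro ⟨htN, rfl⟩
      exact ⟨t.toFinset, Finset.mem_coe.2 (Finset.mem_powersetCard.2
        ⟨Set.toFinset_subset_toFinset.2 htN, (Set.ncard_eq_toFinset_card' t).symm⟩), by simp⟩
    · rintro ⟨t, ht, rfl⟩
      obtain ⟨htN, hcard⟩ := Finset.mem_powersetCard.1 (Finset.mem_coe.1 ht)
      exact ⟨fun v hv => Set.mem_toFinset.1 (htN hv), (Set.ncard_coe_finset t).trans hcard⟩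
  rw [himage, Set.ncard_image_of_injective _ Finset.coe_injective, Set.ncard_coe_finset,
    Finset.card_powersetCard, Set.ncard_eq_toFinset_card']

theorem choose_le_ncard_of_forall_inter_eq {F : Set (Set V)} {N : Set V} {r : ℕ}
    (h : ∀ t ⊆ N, t.ncard = r → ∃ s ∈ F, s ∩ N = t) : N.ncard.choose r ≤ F.ncard := by
  rw [← ncard_setOf_subset_ncard_eq]
  exact (Set.ncard_le_ncard fun t ht => h t ht.1 ht.2).trans (Set.ncard_image_le (f := (· ∩ N)))

theorem ncard_eq_sum_ncard_fiber {α β : Type*} [Finite α] {F : Set α} {f : α → β} {T : Finset β}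
    (h : ∀ s ∈ F, f s ∈ T) : F.ncard = ∑ t ∈ T, {s ∈ F | f s = t}.ncard := by
  classical
  have := Fintype.ofFinite α
  rw [Set.ncard_eq_toFinset_card', Finset.card_eq_sum_card_fiberwise (f := f) (t := T)
    fun s hs => h s (Set.mem_toFinset.1 hs)]
  refine Finset.sum_congr rfl fun t _ => ?_
  rw [Set.ncard_eq_toFinset_card']
  congr 1
  ext s
  simp

theorem ncard_le_ncard_add_choose {F S : Set (Set V)} {N : Set V} {r : ℕ}
    (hF : ∀ s ∈ F, (s ∩ N).ncard = r)
    (h : ∀ t ⊆ N, t.ncard = r → {s ∈ F | s ∩ N = t}.ncard ≤ {s ∈ S | s ∩ N = t}.ncard + 1) :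
    F.ncard ≤ {s ∈ S | (s ∩ N).ncard = r}.ncard + N.ncard.choose r := by
  set T := (Set.toFinite {t | t ⊆ N ∧ t.ncard = r}).toFinset
  have mem_T : ∀ t, t ∈ T ↔ t ⊆ N ∧ t.ncard = r := fun t => Set.Finite.mem_toFinset _
  have card_T : T.card = N.ncard.choose r := by
    rw [← ncard_setOf_subset_ncard_eq, Set.ncard_eq_toFinset_card]
  rw [ncard_eq_sum_ncard_fiber (F := F) (T := T) (f := (· ∩ N))
      fun s hs => (mem_T _).2 ⟨Set.inter_subset_right, hF s hs⟩,
    ncard_eq_sum_ncard_fiber (F := {s ∈ S | (s ∩ N).ncard = r}) (T := T) (f := (· ∩ N))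
      fun s hs => (mem_T _).2 ⟨Set.inter_subset_right, hs.2⟩, ← card_T, Finset.card_eq_sum_ones,
    ← Finset.sum_add_distrib]
  refine Finset.sum_le_sum fun t ht => ?_
  obtain ⟨htN, htr⟩ := (mem_T t).1 ht
  refine (h t htN htr).trans (Nat.add_le_add_right (Set.ncard_le_ncard fun s hs => ?_) 1)
  exact ⟨⟨hs.1, (congrArg Set.ncard hs.2).trans htr⟩, hs.2⟩

theorem ncard_inter_powerset_eq (F : Set (Set V)) (A : Set V) (x : V) :
    (F ∩ 𝒫 A).ncard = (F ∩ 𝒫 (A \ {x})).ncard + {s ∈ F ∩ 𝒫 A | x ∈ s}.ncard := by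
  rw [← Set.ncard_inter_add_ncard_sdiff_eq_ncard (F ∩ 𝒫 A) {s | x ∈ s}, add_comm]
  congr 2
  ext s
  simp only [Set.mem_sdiff, Set.mem_inter_iff, Set.mem_powerset_iff, Set.mem_ofPred_eq,
    Set.subset_sdiff, Set.disjoint_singleton_right, and_assoc]

end Counting

section EdgesIn

variable {V : Type*} {G : SimpleGraph V} {A : Set V} {x : V}

/-- The edges of `G` with both ends in `A`. -/
def edgesIn (G : SimpleGraph V) (A : Set V) : Set (Sym2 V) := {e | e ∈ G.edgeSet ∧ ∀ v ∈ e, v ∈ A}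

theorem edgesIn_univ : edgesIn G Set.univ = G.edgeSet := by simp [edgesIn]

theorem edgesIn_singleton : edgesIn G {x} = ∅ := by
  refine Set.eq_empty_iff_forall_notMem.2 fun e => ?_
  induction e with | _ u v => ?_
  rintro ⟨huv, hx⟩
  exact huv.ne ((hx u (Sym2.mem_mk_left u v)).trans (hx v (Sym2.mem_mk_right u v)).symm)

theorem edgesIn_eq_union (hx : x ∈ A) :
    edgesIn G A = edgesIn G (A \ {x}) ∪ (fun u => s(x, u)) '' (A ∩ G.neighborSet x) := by
  ext e
  induction e with | _ u v => ?_
  simp only [edgesIn, Set.mem_ofPred_eq, Sym2.mem_iff, forall_eq_or_imp, forall_eq, mem_edgeSet,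
    Set.mem_union, Set.mem_sdiff, Set.mem_singleton_iff, Set.mem_image, Sym2.eq_iff]
  constructor
  · rintro ⟨huv, hu, hv⟩
    by_cases hux : u = x
    · subst hux
      exact Or.inr ⟨v, ⟨hv, huv⟩, by simp⟩
    by_cases hvx : v = x
    · subst hvx
      exact Or.inr ⟨u, ⟨hu, huv.symm⟩, by simp⟩
    · exact Or.inl ⟨huv, ⟨hu, hux⟩, hv, hvx⟩
  · rintro (⟨huv, ⟨hu, -⟩, hv, -⟩ | ⟨w, ⟨hw, hxw⟩, ⟨rfl, rfl⟩ | ⟨rfl, rfl⟩⟩)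
    exacts [⟨huv, hu, hv⟩, ⟨hxw, hx, hw⟩, ⟨hxw.symm, hw, hx⟩]

theorem ncard_edgesIn [Finite V] (hx : x ∈ A) :
    (edgesIn G A).ncard = (edgesIn G (A \ {x})).ncard + (A ∩ G.neighborSet x).ncard := by
  have hinj : Function.Injective fun u => s(x, u) := fun u v h => Sym2.congr_right.1 h
  rw [edgesIn_eq_union hx, Set.ncard_union_eq, Set.ncard_image_of_injective _ hinj]
  refine Set.disjoint_left.2 ?_
  rintro e he ⟨u, -, rfl⟩
  exact (he.2 x (Sym2.mem_mk_left x u)).2 rfl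

end EdgesIn

section Increments

variable {V : Type*} {G : SimpleGraph V} {A : Set V} {x a b c : V}

theorem exists_isPathSet_of_mem_inducedCycles_inter {s : Set V}
    (hs : s ∈ {s ∈ G.inducedCycles ∩ 𝒫 A | x ∈ s}) : ∃ a b, a ≠ b ∧ IsPathSet G a b (s \ {x}) ∧
      s ∩ (A ∩ G.neighborSet x) = {a, b} := by
  obtain ⟨⟨hs, hsA⟩, hxs⟩ := hs
  obtain ⟨a, b, hab, hP, hadj⟩ := exists_isPathSet_of_mem_inducedCycles hs hxs
  refine ⟨a, b, hab, hP, Set.Subset.antisymm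
    (fun v hv => (hadj v ⟨hv.1, hv.2.2.ne'⟩).1 hv.2.2) fun v hv => ?_⟩
  have hvs : v ∈ s \ {x} := by
    rcases hv with rfl | rfl
    exacts [hP.left_mem, hP.right_mem]
  exact ⟨hvs.1, hsA hvs.1, (hadj v hvs).2 hv⟩

variable [Finite V]

theorem Avoidable.exists_mem_inducedCycles (hx : Avoidable G A x) (hxA : x ∈ A)
    (ha : a ∈ A ∩ G.neighborSet x) (hb : b ∈ A ∩ G.neighborSet x) (hab : a ≠ b) :
    ∃ s ∈ {s ∈ G.inducedCycles ∩ 𝒫 A | x ∈ s}, s ∩ (A ∩ G.neighborSet x) = {a, b} := by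
  obtain ⟨P, hPW, hP⟩ := (hx a ha b hb hab).exists_isPathSet
  have hT : {a, b} ⊆ A ∩ G.neighborSet x := Set.pair_subset ha hb
  exact ⟨insert x P, ⟨⟨hP.insert_mem_inducedCycles hab
      (fun v hv => adj_iff_of_mem_awayFrom hT v (hPW hv)) fun h => notMem_awayFrom (hPW h),
      Set.insert_subset hxA (hPW.trans awayFrom_subset)⟩, Or.inl rfl⟩,
    inter_neighborSet_eq hT
      ((Set.pair_subset hP.left_mem hP.right_mem).trans (Set.subset_insert _ _))
      (Set.insert_subset_insert hPW)⟩

theorem Avoidable.choose_two_le (hx : Avoidable G A x) (hxA : x ∈ A) :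
    (A ∩ G.neighborSet x).ncard.choose 2 ≤ {s ∈ G.inducedCycles ∩ 𝒫 A | x ∈ s}.ncard := by
  refine choose_le_ncard_of_forall_inter_eq fun t ht htcard => ?_
  obtain ⟨a, b, hab, rfl⟩ := Set.ncard_eq_two.1 htcard
  obtain ⟨ha, hb⟩ := Set.pair_subset_iff.1 ht
  exact hx.exists_mem_inducedCycles hxA ha hb hab

theorem Avoidable.exists_mem_solids (hx : Avoidable G A x) (hxA : x ∈ A)
    (ha : a ∈ A ∩ G.neighborSet x) (hb : b ∈ A ∩ G.neighborSet x) (hc : c ∈ A ∩ G.neighborSet x)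
    (hab : a ≠ b) (hac : a ≠ c) (hbc : b ≠ c) :
    ∃ s ∈ {s ∈ G.solids ∩ 𝒫 A | x ∈ s}, s ∩ (A ∩ G.neighborSet x) = {a, b, c} := by
  have hT : {a, b, c} ⊆ A ∩ G.neighborSet x := Set.insert_subset ha (Set.pair_subset hb hc)
  obtain ⟨s, hs, hsW, hmem⟩ := exists_solid_of_linkedIn
    (W := awayFrom G A x {a, b, c}) notMem_awayFrom hab hac hbc
    (adj_iff_of_mem_awayFrom hT)
    (hx.linkedIn_awayFrom_sdiff ha hb hc.2 hab hac hbc (by grind))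
    (hx.linkedIn_awayFrom_sdiff ha hc hb.2 hac hab hbc.symm (by grind))
    (hx.linkedIn_awayFrom_sdiff hb hc ha.2 hbc hab.symm hac.symm (by grind))
  obtain ⟨hxs, hTs⟩ := Set.insert_subset_iff.1 hmem
  exact ⟨s, ⟨⟨hs, hsW.trans (Set.insert_subset hxA awayFrom_subset)⟩, hxs⟩,
    inter_neighborSet_eq hT hTs hsW⟩

theorem ncard_inducedCycles_inter_eq_pair_le (hxA : x ∈ A) (ha : a ∈ A ∩ G.neighborSet x)
    (hb : b ∈ A ∩ G.neighborSet x) (hab : a ≠ b) :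
    {s ∈ {s ∈ G.inducedCycles ∩ 𝒫 A | x ∈ s} | s ∩ (A ∩ G.neighborSet x) = {a, b}}.ncard ≤
      {s ∈ {s ∈ G.solids ∩ 𝒫 A | x ∈ s} | s ∩ (A ∩ G.neighborSet x) = {a, b}}.ncard + 1 := by
  have hT : {a, b} ⊆ A ∩ G.neighborSet x := Set.pair_subset ha hb
  set W := awayFrom G A x {a, b}
  calc _ ≤ (pathsIn G a b W).ncard := by
        refine Set.ncard_le_ncard_of_injOn (· \ {x}) (fun s hs => ⟨?_, fun v hv =>
          ⟨hs.1.1.2 hv.1, hv.2, fun hxv => hs.2.subset ⟨hv.1, hs.1.1.2 hv.1, hxv⟩⟩⟩) ?_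
        · obtain ⟨a', b', -, hP, hs'⟩ := exists_isPathSet_of_mem_inducedCycles_inter hs.1
          rcases Set.pair_eq_pair_iff.1 (hs'.symm.trans hs.2) with ⟨rfl, rfl⟩ | ⟨rfl, rfl⟩
          exacts [hP, hP.symm]
        · intro s hs s' hs' heq
          rw [← Set.insert_sdiff_self_of_mem hs.1.2, ← Set.insert_sdiff_self_of_mem hs'.1.2]
          exact congrArg (insert x) heq
    _ ≤ (solidsAt G x a b W).ncard + 1 :=
        ncard_pathsIn_le hab notMem_awayFrom (adj_iff_of_mem_awayFrom hT)
    _ ≤ _ := by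
        refine Nat.add_le_add_right (Set.ncard_le_ncard ?_) 1
        rintro s ⟨hs, hsW, hxs, has, hbs⟩
        exact ⟨⟨⟨hs, hsW.trans (Set.insert_subset hxA awayFrom_subset)⟩, hxs⟩,
          inter_neighborSet_eq hT (Set.pair_subset has hbs) hsW⟩

theorem Avoidable.choose_three_add_le (hx : Avoidable G A x) (hxA : x ∈ A) :
    (A ∩ G.neighborSet x).ncard.choose 3 + {s ∈ G.inducedCycles ∩ 𝒫 A | x ∈ s}.ncard ≤
      {s ∈ G.solids ∩ 𝒫 A | x ∈ s}.ncard + (A ∩ G.neighborSet x).ncard.choose 2 := by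
  set N := A ∩ G.neighborSet x
  set S := {s ∈ G.solids ∩ 𝒫 A | x ∈ s}
  have hpairs : {s ∈ G.inducedCycles ∩ 𝒫 A | x ∈ s}.ncard ≤
      {s ∈ S | (s ∩ N).ncard = 2}.ncard + N.ncard.choose 2 := by
    refine ncard_le_ncard_add_choose (fun s hs => ?_) fun t ht htcard => ?_
    · obtain ⟨a, b, hab, -, hsN⟩ := exists_isPathSet_of_mem_inducedCycles_inter hs
      exact (congrArg Set.ncard hsN).trans (Set.ncard_pair hab)
    · obtain ⟨a, b, hab, rfl⟩ := Set.ncard_eq_two.1 htcard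
      obtain ⟨ha, hb⟩ := Set.pair_subset_iff.1 ht
      exact ncard_inducedCycles_inter_eq_pair_le hxA ha hb hab
  have htriples : N.ncard.choose 3 ≤ {s ∈ S | (s ∩ N).ncard = 3}.ncard := by
    refine choose_le_ncard_of_forall_inter_eq fun t ht htcard => ?_
    obtain ⟨a, b, c, hab, hac, hbc, rfl⟩ := Set.ncard_eq_three.1 htcard
    obtain ⟨ha, hbc'⟩ := Set.insert_subset_iff.1 ht
    obtain ⟨hb, hc⟩ := Set.pair_subset_iff.1 hbc'
    obtain ⟨s, hs, hsN⟩ := hx.exists_mem_solids hxA ha hb hc hab hac hbc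
    exact ⟨s, ⟨hs, (congrArg Set.ncard hsN).trans htcard⟩, hsN⟩
  have hdisjoint : Disjoint {s ∈ S | (s ∩ N).ncard = 2} {s ∈ S | (s ∩ N).ncard = 3} :=
    Set.disjoint_left.2 fun s h2 h3 => by simpa using h2.2.symm.trans h3.2
  have hsolids : {s ∈ S | (s ∩ N).ncard = 2}.ncard + {s ∈ S | (s ∩ N).ncard = 3}.ncard ≤
      S.ncard := by
    rw [← Set.ncard_union_eq hdisjoint]
    exact Set.ncard_le_ncard (Set.union_subset (Set.sep_subset _ _) (Set.sep_subset _ _))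
  omega

end Increments

section LowerBounds

variable {V : Type*} {G : SimpleGraph V} {A : Set V} {x : V} {k : ℕ}

theorem inducedCycles_inter_powerset_singleton : G.inducedCycles ∩ 𝒫 {x} = ∅ := by
  refine Set.eq_empty_iff_forall_notMem.2 fun s ⟨hs, hsx⟩ => ?_
  obtain ⟨n, f, hf, rfl⟩ := exists_isIndCycle hs
  have hn := hf.three_le
  have hfx : ∀ i < n, f i = x := fun i hi => hsx ⟨i, hi, rfl⟩
  have := hf.inj 0 (by omega) 1 (by omega) ((hfx 0 (by omega)).trans (hfx 1 (by omega)).symm)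
  omega

variable [Finite V]

theorem choose_two_le_of_not_colorableOn (hA : ConnectedOn G A) (hk : ¬ ColorableOn G A k) :
    (k.choose 2 : ℤ) ≤ (edgesIn G A).ncard - A.ncard + 1 := by
  refine choose_le_of_avoidable (β := fun A => (edgesIn G A).ncard - A.ncard + 1)
    (fun x => by simp) (fun A x hxA _ hN => ?_) hA hk
  have hpos := hN.ncard_pos
  have hcard := Set.ncard_sdiff_singleton_add_one hxA
  have hedges := ncard_edgesIn (G := G) hxA
  rw [Nat.choose_one_right]
  omega

theorem choose_three_le_of_not_colorableOn (hA : ConnectedOn G A) (hk : ¬ ColorableOn G A k) :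
    (k.choose 3 : ℤ) ≤
      (G.inducedCycles ∩ 𝒫 A).ncard - (edgesIn G A).ncard + A.ncard - 1 := by
  refine choose_le_of_avoidable (β := fun A =>
    (G.inducedCycles ∩ 𝒫 A).ncard - (edgesIn G A).ncard + A.ncard - 1)
    (fun x => by simp [edgesIn_singleton]) (fun A x hxA hx hN => ?_) hA hk
  have hcard := Set.ncard_sdiff_singleton_add_one hxA
  have hedges := ncard_edgesIn (G := G) hxA
  have hcycles := ncard_inter_powerset_eq G.inducedCycles A x
  have hgain := hx.choose_two_le hxA
  obtain ⟨d, hd⟩ := Nat.exists_eq_add_one.2 hN.ncard_pos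
  have hpascal : (d + 1).choose 2 = d.choose 1 + d.choose 2 := Nat.choose_succ_succ' d 1
  rw [hd] at hedges hgain ⊢
  rw [Nat.choose_one_right] at hpascal
  rw [Nat.add_sub_cancel]
  omega

theorem choose_four_le_of_not_colorableOn (hA : ConnectedOn G A) (hk : ¬ ColorableOn G A k) :
    (k.choose 4 : ℤ) ≤ (G.solids ∩ 𝒫 A).ncard - (G.inducedCycles ∩ 𝒫 A).ncard +
      (edgesIn G A).ncard - A.ncard + 1 := by
  refine choose_le_of_avoidable (β := fun A => (G.solids ∩ 𝒫 A).ncard -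
    (G.inducedCycles ∩ 𝒫 A).ncard + (edgesIn G A).ncard - A.ncard + 1)
    (fun x => ?_) (fun A x hxA hx hN => ?_) hA hk
  · rw [edgesIn_singleton, inducedCycles_inter_powerset_singleton]
    simp
  have hcard := Set.ncard_sdiff_singleton_add_one hxA
  have hedges := ncard_edgesIn (G := G) hxA
  have hcycles := ncard_inter_powerset_eq G.inducedCycles A x
  have hsolids := ncard_inter_powerset_eq G.solids A x
  have hgain := hx.choose_three_add_le hxA
  obtain ⟨d, hd⟩ := Nat.exists_eq_add_one.2 hN.ncard_pos
  have hpascal₂ : (d + 1).choose 2 = d.choose 1 + d.choose 2 := Nat.choose_succ_succ' d 1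
  have hpascal₃ : (d + 1).choose 3 = d.choose 2 + d.choose 3 := Nat.choose_succ_succ' d 2
  rw [hd] at hedges hgain ⊢
  rw [Nat.choose_one_right] at hpascal₂
  rw [Nat.add_sub_cancel]
  omega

end LowerBounds

section CompleteGraph

variable {V : Type*} {s : Set V}

theorem mem_inducedCycles_top_iff : s ∈ (⊤ : SimpleGraph V).inducedCycles ↔ s.ncard = 3 := by
  constructor
  · intro hs
    obtain ⟨n, f, hf, rfl⟩ := exists_isIndCycle hs
    have hn := hf.three_le
    have h02 : f 0 ≠ f 2 := fun h => by
      have := hf.inj 0 (by omega) 2 (by omega) h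
      omega
    have hadj := (hf.adj 0 (by omega) 2 (by omega)).1 h02
    have hinj : Set.InjOn f (Set.Iio n) := fun i hi j hj hij => hf.inj i hi j hj hij
    rw [hinj.ncard_image, Set.ncard_Iio_nat]
    omega
  · intro hs
    obtain ⟨a, b, c, hab, hac, hbc, rfl⟩ := Set.ncard_eq_three.1 hs
    exact triangle_mem_inducedCycles hab hac hbc

theorem card_eq_four_of_isPyramid_top [Finite V] (h : (⊤ : SimpleGraph V).IsPyramid) :
    Nat.card V = 4 := by
  obtain ⟨w, hw, -⟩ := h
  have hcycle : ({w}ᶜ : Set V).ncard = 3 := mem_inducedCycles_top_iff.1 hw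
  rw [← Set.ncard_add_ncard_compl {w}, hcycle, Set.ncard_singleton]

theorem not_isTrihedron_top : ¬ (⊤ : SimpleGraph V).IsTrihedron := by
  rintro ⟨x, y, p, hxy, hp, -, htop⟩
  have hadj : (⊤ : (⊤ : SimpleGraph V).Subgraph).Adj x y := hxy
  rw [← htop, Subgraph.iSup_adj] at hadj
  obtain ⟨i, hi⟩ := hadj
  obtain ⟨k, hk, hkl⟩ := (Walk.toSubgraph_adj_iff _).1 hi
  obtain ⟨hpath, hlength⟩ := hp i
  rcases Sym2.eq_iff.1 hk with ⟨hx, hy⟩ | ⟨hy, -⟩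
  · rw [hpath.getVert_eq_start_iff hkl.le] at hx
    rw [hpath.getVert_eq_end_iff (by omega)] at hy
    omega
  · rw [hpath.getVert_eq_end_iff hkl.le] at hy
    omega

theorem eq_or_mem_range_of_stamp_top {a : Fin 3 → V} {x : V}
    {p : ∀ i, (⊤ : SimpleGraph V).Walk (a i) x} (hax : ∀ i, a i ≠ x)
    (hdisj : ∀ i j, i ≠ j → ∀ z ∈ (p i).support, z ∈ (p j).support → z = x)
    (htop : (⊤ : (⊤ : SimpleGraph V).Subgraph).induce (Set.range a) ⊔ (⨆ i, (p i).toSubgraph) = ⊤)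
    (v : V) : v = x ∨ v ∈ Set.range a := by
  by_contra! hv
  obtain ⟨hvx, hva⟩ := hv
  have hverts : v ∈ (⊤ : (⊤ : SimpleGraph V).Subgraph).verts := trivial
  rw [← htop, Subgraph.verts_sup, Subgraph.verts_iSup, Set.mem_union, Set.mem_iUnion] at hverts
  obtain ⟨i, hi⟩ := hverts.resolve_left hva
  have hadj : (⊤ : (⊤ : SimpleGraph V).Subgraph).Adj v (a (i + 1)) := fun h => hva ⟨_, h.symm⟩
  rw [← htop, Subgraph.sup_adj, Subgraph.iSup_adj] at hadj
  obtain ⟨k, hk⟩ := hadj.resolve_left fun h => hva h.1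
  have hvk := (Walk.mem_verts_toSubgraph _).1 hk.fst_mem
  obtain rfl : k = i := by_contra fun hki =>
    hvx (hdisj k i hki v hvk ((Walk.mem_verts_toSubgraph _).1 hi))
  have hne : k ≠ k + 1 := by fin_cases k <;> simp
  exact hax (k + 1) (hdisj k (k + 1) hne _ ((Walk.mem_verts_toSubgraph _).1 hk.snd_mem)
    (Walk.start_mem_support _))

theorem card_eq_four_of_isStamp_top (h : (⊤ : SimpleGraph V).IsStamp) : Nat.card V = 4 := by
  obtain ⟨a, x, p, ha, hp, hdisj, htop⟩ := h
  have hax : ∀ i, a i ≠ x := fun i hi => by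
    have hlength := ((hp i).1.getVert_eq_end_iff (Nat.zero_le _)).1 ((p i).getVert_zero.trans hi)
    have hpos := (hp i).2
    omega
  have hrange : (Set.range a).ncard = 3 := by
    have hinj : Function.Injective a := fun i j hij => by_contra fun hne => ha i j hne hij
    rw [← Set.image_univ, Set.ncard_image_of_injective _ hinj, Set.ncard_univ, Nat.card_fin]
  have huniv : Set.univ = insert x (Set.range a) :=
    (Set.eq_univ_of_forall (eq_or_mem_range_of_stamp_top hax hdisj htop)).symm
  rw [← Set.ncard_univ, huniv, Set.ncard_insert_of_notMem, hrange]
  exact fun ⟨i, hi⟩ => hax i hi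

theorem not_isPrism_top : ¬ (⊤ : SimpleGraph V).IsPrism := by
  rintro ⟨a, b, p, -, -, hab, -, hdisj, htop⟩
  have hadj : (⊤ : (⊤ : SimpleGraph V).Subgraph).Adj (a 0) (b 1) := hab 0 1
  rw [← htop, Subgraph.sup_adj, Subgraph.sup_adj, Subgraph.iSup_adj] at hadj
  rcases hadj with (⟨-, ⟨j, hj⟩, -⟩ | ⟨⟨j, hj⟩, -⟩) | ⟨k, hk⟩
  · exact hab j 1 hj
  · exact hab 0 j hj.symm
  have ha := (Walk.mem_verts_toSubgraph _).1 hk.fst_mem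
  have hb := (Walk.mem_verts_toSubgraph _).1 hk.snd_mem
  by_cases hk0 : k = 0
  · subst hk0
    exact hdisj 0 1 (by decide) _ hb (Walk.end_mem_support _)
  · exact hdisj k 0 hk0 _ ha (Walk.start_mem_support _)

variable [Finite V]

theorem card_eq_four_of_isSolidGraph_top (h : (⊤ : SimpleGraph V).IsSolidGraph) :
    Nat.card V = 4 := by
  rcases h with h | h | h | h
  exacts [card_eq_four_of_isPyramid_top h, (not_isTrihedron_top h).elim,
    card_eq_four_of_isStamp_top h, (not_isPrism_top h).elim]

theorem ncard_edgeSet_top : (⊤ : SimpleGraph V).edgeSet.ncard = (Nat.card V).choose 2 := by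
  classical
  have := Fintype.ofFinite V
  rw [← coe_edgeFinset, Set.ncard_coe_finset, card_edgeFinset_top_eq_card_choose_two,
    Nat.card_eq_fintype_card]

theorem ncard_inducedCycles_top :
    (⊤ : SimpleGraph V).inducedCycles.ncard = (Nat.card V).choose 3 := by
  rw [← Set.ncard_univ, ← ncard_setOf_subset_ncard_eq]
  congr 1
  ext s
  exact mem_inducedCycles_top_iff.trans (and_iff_right (Set.subset_univ s)).symm

theorem ncard_solids_top_le : (⊤ : SimpleGraph V).solids.ncard ≤ (Nat.card V).choose 4 := by
  rw [← Set.ncard_univ, ← ncard_setOf_subset_ncard_eq]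
  refine Set.ncard_le_ncard fun s hs => ⟨Set.subset_univ s, ?_⟩
  have hs' : (⊤ : SimpleGraph s).IsSolidGraph := by
    rw [← completeGraph_eq_top, ← induce_top]
    exact hs
  exact (Nat.card_coe_set_eq s).symm.trans (card_eq_four_of_isSolidGraph_top hs')

end CompleteGraph

section Characteristics

variable {V : Type*} {G : SimpleGraph V} {k n : ℕ}

theorem connectedOn_univ (hG : G.Connected) : ConnectedOn G Set.univ :=
  (induceUnivIso G).connected_iff.2 hG

variable [Finite V]

theorem beth1_top (hV : Nat.card V = n + 1) : (⊤ : SimpleGraph V).beth1 = n.choose 2 - 1 := by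
  have hpascal : (n + 1).choose 2 = n.choose 1 + n.choose 2 := Nat.choose_succ_succ' n 1
  rw [Nat.choose_one_right] at hpascal
  rw [beth1, ncard_edgeSet_top, hV]
  omega

theorem beth2_top (hV : Nat.card V = n + 1) : (⊤ : SimpleGraph V).beth2 = n.choose 3 + 1 := by
  have hpascal₂ : (n + 1).choose 2 = n.choose 1 + n.choose 2 := Nat.choose_succ_succ' n 1
  have hpascal₃ : (n + 1).choose 3 = n.choose 2 + n.choose 3 := Nat.choose_succ_succ' n 2
  rw [Nat.choose_one_right] at hpascal₂
  rw [beth2, ncard_inducedCycles_top, ncard_edgeSet_top, hV]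
  omega

theorem beth3_top_le (hV : Nat.card V = n + 1) :
    (⊤ : SimpleGraph V).beth3 ≤ n.choose 4 - 1 := by
  have hpascal₂ : (n + 1).choose 2 = n.choose 1 + n.choose 2 := Nat.choose_succ_succ' n 1
  have hpascal₃ : (n + 1).choose 3 = n.choose 2 + n.choose 3 := Nat.choose_succ_succ' n 2
  have hpascal₄ : (n + 1).choose 4 = n.choose 3 + n.choose 4 := Nat.choose_succ_succ' n 3
  have hsolids := ncard_solids_top_le (V := V)
  rw [Nat.choose_one_right] at hpascal₂
  rw [hV] at hsolids
  rw [beth3, ncard_inducedCycles_top, ncard_edgeSet_top, hV]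
  omega

theorem choose_two_le_beth1 (hG : G.Connected) (hk : ¬ ColorableOn G Set.univ k) :
    k.choose 2 ≤ G.beth1 + 1 := by
  simpa only [beth1, edgesIn_univ, Set.ncard_univ] using
    choose_two_le_of_not_colorableOn (connectedOn_univ hG) hk

theorem choose_three_le_beth2 (hG : G.Connected) (hk : ¬ ColorableOn G Set.univ k) :
    k.choose 3 ≤ G.beth2 - 1 := by
  simpa only [beth2, edgesIn_univ, Set.ncard_univ, Set.powerset_univ, Set.inter_univ] using
    choose_three_le_of_not_colorableOn (connectedOn_univ hG) hk

theorem choose_four_le_beth3 (hG : G.Connected) (hk : ¬ ColorableOn G Set.univ k) :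
    k.choose 4 ≤ G.beth3 + 1 := by
  simpa only [beth3, edgesIn_univ, Set.ncard_univ, Set.powerset_univ, Set.inter_univ] using
    choose_four_le_of_not_colorableOn (connectedOn_univ hG) hk

theorem colorableOn_of_beth_eq (hG : G.Connected) (hk : 4 ≤ k)
    (h : (completeGraph (Fin k)).beth1 = G.beth1 ∨ (completeGraph (Fin k)).beth2 = G.beth2 ∨
      (completeGraph (Fin k)).beth3 = G.beth3) : ColorableOn G Set.univ k := by
  by_contra hcol
  obtain ⟨n, rfl⟩ : ∃ n, k = n + 1 := ⟨k - 1, by omega⟩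
  have choose_lt : ∀ r ≠ 0, r ≤ n + 1 → n.choose r < (n + 1).choose r := fun r hr hrn => by
    obtain ⟨r, rfl⟩ := Nat.exists_eq_succ_of_ne_zero hr
    rw [Nat.choose_succ_succ]
    exact Nat.lt_add_of_pos_left (Nat.choose_pos (by omega))
  have hcard : Nat.card (Fin (n + 1)) = n + 1 := Nat.card_fin _
  rcases h with h | h | h
  · have hle := choose_two_le_beth1 hG hcol
    have hlt := choose_lt 2 two_ne_zero (by omega)
    rw [← h, completeGraph_eq_top, beth1_top hcard] at hle
    omega
  · have hle := choose_three_le_beth2 hG hcol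
    have hlt := choose_lt 3 three_ne_zero (by omega)
    rw [← h, completeGraph_eq_top, beth2_top hcard] at hle
    omega
  · have hle := choose_four_le_beth3 hG hcol
    have hlt := choose_lt 4 four_ne_zero (by omega)
    have htop := beth3_top_le hcard
    rw [← h, completeGraph_eq_top] at hle
    omega

end Characteristics

section CompleteMinor

variable {V : Type*} {G : SimpleGraph V}

/-- Disjoint vertex sets joined by an edge, the relation required between any two branch sets of a
complete minor. -/
def Touching (G : SimpleGraph V) (X Y : Set V) : Prop :=
  Disjoint X Y ∧ ∃ x ∈ X, ∃ y ∈ Y, G.Adj x y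

theorem Touching.symm {X Y : Set V} (h : Touching G X Y) : Touching G Y X :=
  let ⟨hdisj, x, hx, y, hy, hxy⟩ := h
  ⟨hdisj.symm, y, hy, x, hx, hxy.symm⟩

theorem length_le_hadwigerNumber [Finite V] {B : List (Set V)} (hB : ∀ X ∈ B, ConnectedOn G X)
    (htouch : B.Pairwise (Touching G)) : B.length ≤ G.hadwigerNumber := by
  have touching_get : ∀ i j, i ≠ j → Touching G (B.get i) (B.get j) := by
    intro i j hij
    rcases lt_or_gt_of_ne hij with h | h
    exacts [List.pairwise_iff_get.1 htouch i j h, (List.pairwise_iff_get.1 htouch j i h).symm]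
  refine le_csSup ⟨Nat.card V, ?_⟩ ⟨B.get, fun i => hB _ (List.get_mem B i),
    fun i j hij => (touching_get i j hij).1, fun i j hij => (touching_get i j hij).2⟩
  rintro s ⟨B, hB, hdisj, -⟩
  choose f hf using fun i => ConnectedOn.nonempty (hB i)
  have hinj : Function.Injective f := fun i j hij => by_contra fun hne =>
    Set.disjoint_left.1 (hdisj i j hne) (hf i) (hij ▸ hf j)
  simpa using Nat.card_le_card_of_injective f hinj

theorem IsIndCycle.connectedOn_Icc {n l r : ℕ} {f : ℕ → V} (hf : IsIndCycle G n f) (hlr : l ≤ r)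
    (hr : r < n) : ConnectedOn G (f '' Set.Icc l r) :=
  connectedOn_image_Icc f hlr fun i _ hir =>
    (hf.adj i (by omega) (i + 1) (by omega)).2 (Or.inl rfl)

theorem IsIndCycle.touching_Icc {n l r l' r' : ℕ} {f : ℕ → V} (hf : IsIndCycle G n f)
    (hlr : l ≤ r) (hrl : r < l') (hlr' : l' ≤ r') (hr' : r' < n)
    (h : l' = r + 1 ∨ l = 0 ∧ r' = n - 1) :
    Touching G (f '' Set.Icc l r) (f '' Set.Icc l' r') := by
  constructor
  · rw [Set.disjoint_left]
    rintro _ ⟨i, ⟨-, hi⟩, rfl⟩ ⟨j, ⟨hj, hjr⟩, hij⟩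
    have := hf.inj j (by omega) i (by omega) hij
    omega
  · rcases h with rfl | ⟨rfl, rfl⟩
    · exact ⟨f r, ⟨r, ⟨hlr, le_rfl⟩, rfl⟩, f (r + 1), ⟨r + 1, ⟨le_rfl, hlr'⟩, rfl⟩,
        (hf.adj _ (by omega) _ (by omega)).2 (by omega)⟩
    · exact ⟨f 0, ⟨0, ⟨le_rfl, hlr⟩, rfl⟩, f (n - 1), ⟨n - 1, ⟨hlr', le_rfl⟩, rfl⟩,
        (hf.adj _ (by omega) _ (by omega)).2 (by omega)⟩

theorem touching_image_Icc {n l r k : ℕ} {f : ℕ → V} {Y : Set V} (hY : Disjoint (f '' Set.Iio n) Y)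
    (hr : r < n) (hk : k ∈ Set.Icc l r) (hadj : ∃ y ∈ Y, G.Adj (f k) y) :
    Touching G (f '' Set.Icc l r) Y :=
  ⟨hY.mono_left (Set.image_mono fun _ hi => hi.2.trans_lt hr), f k, ⟨k, hk, rfl⟩, hadj⟩

variable [Finite V]

theorem three_le_hadwigerNumber {D : Set V} (hD : D ∈ G.inducedCycles) :
    3 ≤ G.hadwigerNumber := by
  obtain ⟨n, f, hf, rfl⟩ := exists_isIndCycle hD
  have hn := hf.three_le
  refine length_le_hadwigerNumber (B := [f '' Set.Icc 0 0, f '' Set.Icc 1 1,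
    f '' Set.Icc 2 (n - 1)]) ?_ ?_
  · simp only [List.forall_mem_cons, List.not_mem_nil, false_imp_iff,
      implies_true, and_true]
    exact ⟨hf.connectedOn_Icc le_rfl (by omega), hf.connectedOn_Icc le_rfl (by omega),
      hf.connectedOn_Icc (by omega) (by omega)⟩
  · simp only [List.pairwise_cons, List.forall_mem_cons, List.not_mem_nil, false_imp_iff,
      implies_true, List.Pairwise.nil, and_true]
    refine ⟨⟨?_, ?_⟩, ?_⟩ <;> exact hf.touching_Icc (by omega) (by omega) (by omega) (by omega)
      (by omega)

theorem four_le_hadwigerNumber {D Y : Set V} (hD : D ∈ G.inducedCycles) (hY : ConnectedOn G Y)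
    (hDY : Disjoint D Y) {a b c : V} (ha : a ∈ D) (hb : b ∈ D) (hc : c ∈ D) (hab : a ≠ b)
    (hac : a ≠ c) (hbc : b ≠ c) (haY : ∃ y ∈ Y, G.Adj a y) (hbY : ∃ y ∈ Y, G.Adj b y)
    (hcY : ∃ y ∈ Y, G.Adj c y) : 4 ≤ G.hadwigerNumber := by
  obtain ⟨n, f, hf, rfl, rfl⟩ := exists_isIndCycle_start hD ha
  obtain ⟨k, l, hk, hkl, hln, hkY, hlY⟩ : ∃ k l, 0 < k ∧ k < l ∧ l < n ∧
      (∃ y ∈ Y, G.Adj (f k) y) ∧ ∃ y ∈ Y, G.Adj (f l) y := by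
    obtain ⟨k, hk, rfl⟩ := hb
    obtain ⟨l, hl, rfl⟩ := hc
    have hk0 : 0 < k := Nat.pos_of_ne_zero fun h => hab (h ▸ rfl)
    have hl0 : 0 < l := Nat.pos_of_ne_zero fun h => hac (h ▸ rfl)
    rcases lt_or_gt_of_ne fun h : k = l => hbc (congrArg f h) with h | h
    exacts [⟨k, l, hk0, h, hl, hbY, hcY⟩, ⟨l, k, hl0, h, hk, hcY, hbY⟩]
  refine length_le_hadwigerNumber (B := [f '' Set.Icc 0 (k - 1), f '' Set.Icc k (l - 1),
    f '' Set.Icc l (n - 1), Y]) ?_ ?_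
  · simp only [List.forall_mem_cons, List.not_mem_nil, false_imp_iff,
      implies_true, and_true]
    exact ⟨hf.connectedOn_Icc (by omega) (by omega), hf.connectedOn_Icc (by omega) (by omega),
      hf.connectedOn_Icc (by omega) (by omega), hY⟩
  · simp only [List.pairwise_cons, List.forall_mem_cons, List.not_mem_nil, false_imp_iff,
      implies_true, List.Pairwise.nil, and_true]
    refine ⟨⟨?_, ?_, touching_image_Icc hDY (by omega) ⟨le_rfl, by omega⟩ haY⟩,
      ⟨?_, touching_image_Icc hDY (by omega) ⟨le_rfl, by omega⟩ hkY⟩,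
      touching_image_Icc hDY (by omega) ⟨le_rfl, by omega⟩ hlY⟩ <;>
    exact hf.touching_Icc (by omega) (by omega) (by omega) (by omega) (by omega)

end CompleteMinor

section MinimumDegree

variable {V : Type*} {G : SimpleGraph V} {A D s t Y : Set V} {q x : V} {k : ℕ}

theorem ncard_inter_neighborSet_le_two_of_mem_inducedCycles (hD : D ∈ G.inducedCycles)
    (hx : x ∈ D) : (D ∩ G.neighborSet x).ncard ≤ 2 := by
  obtain ⟨a, b, hab, -, hadj⟩ := exists_isPathSet_of_mem_inducedCycles hD hx
  rw [← Set.ncard_pair hab]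
  exact Set.ncard_le_ncard fun u hu => (hadj u ⟨hu.1, hu.2.ne'⟩).1 hu.2

theorem three_le_ncard_of_mem_inducedCycles (hD : D ∈ G.inducedCycles) : 3 ≤ D.ncard := by
  obtain ⟨n, f, hf, rfl⟩ := exists_isIndCycle hD
  rw [Set.InjOn.ncard_image (s := Set.Iio n) fun i hi j hj => hf.inj i hi j hj,
    ← Finset.coe_Iio, Set.ncard_coe_finset, Nat.card_Iio]
  exact hf.three_le

/-- The vertices of `t` outside `Y` that have a neighbour in `Y`. -/
def attachments (G : SimpleGraph V) (t Y : Set V) : Set V :=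
  {u | u ∈ t \ Y ∧ ∃ y ∈ Y, G.Adj u y}

theorem attachments_nonempty (ht : ConnectedOn G t) (hY : Y.Nonempty) (hYt : Y ⊆ t)
    (hne : (t \ Y).Nonempty) : (attachments G t Y).Nonempty := by
  by_contra hno
  obtain ⟨y, hy⟩ := hY
  obtain ⟨d, hdt, hdY⟩ := hne
  exact hdY (ht.subset_of_closed Y (hYt hy) hy (fun u hu _ v hv huv => by_contra fun hvY =>
    hno ⟨v, ⟨hv, hvY⟩, u, hu, huv.symm⟩) hdt)

/-- `Y` is a connected subset of `t` whose removal from `t` leaves an induced cycle. -/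
structure LeavesCycle (G : SimpleGraph V) (t Y : Set V) : Prop where
  connectedOn : ConnectedOn G Y
  subset : Y ⊆ t
  exists_cycle : ∃ D ∈ G.inducedCycles, D ⊆ t \ Y

theorem attachments_subset_of_maximal (hY : Maximal (LeavesCycle G t) Y)
    (hD : D ∈ G.inducedCycles) (hDt : D ⊆ t \ Y) : attachments G t Y ⊆ D := by
  rintro p ⟨⟨hpt, hpY⟩, y, hy, hpy⟩
  by_contra hpD
  refine hpY (hY.2 ⟨hY.1.connectedOn.insert_of_adj hy hpy.symm, Set.insert_subset hpt hY.1.subset,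
    D, hD, fun v hv => ⟨(hDt hv).1, ?_⟩⟩ (Set.subset_insert p Y) (Set.mem_insert p Y))
  rintro (rfl | hvY)
  exacts [hpD hv, (hDt hv).2 hvY]

variable [Finite V]

theorem exists_le_degree_of_not_colorableOn (hA : ¬ ColorableOn G A k) :
    ∃ s : Set V, s.Nonempty ∧ ∀ x ∈ s, k ≤ (s ∩ G.neighborSet x).ncard := by
  obtain ⟨s, -, hs, hmin⟩ := Finite.exists_le_minimal (p := fun s => ¬ ColorableOn G s k) hA
  refine ⟨s, Set.nonempty_iff_ne_empty.2 fun h => hs (h ▸ colorableOn_empty G k),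
    fun x hx => not_lt.1 fun hd => hs (ColorableOn.of_ncard_lt (by_contra fun h => ?_) hd)⟩
  exact (hmin h Set.sdiff_subset hx).2 rfl

theorem exists_inducedCycle_of_two_le_degree (hs : (s \ {q}).Nonempty)
    (hdeg : ∀ x ∈ s \ {q}, 2 ≤ (s ∩ G.neighborSet x).ncard) : ∃ D ∈ G.inducedCycles, D ⊆ s := by
  induction s using WellFoundedLT.induction generalizing q with | _ s ih => ?_
  obtain ⟨w, hw⟩ := hs
  by_cases hall : ∀ x ∈ s, 2 ≤ (s ∩ G.neighborSet x).ncard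
  · obtain ⟨x, hxs, hx⟩ := exists_avoidable (G := G) ⟨w, hw.1⟩
    obtain ⟨a, ha, b, hb, hab⟩ := Set.one_lt_ncard_iff_nontrivial.1 (hall x hxs)
    obtain ⟨D, ⟨⟨hD, hDs⟩, -⟩, -⟩ := hx.exists_mem_inducedCycles hxs ha hb hab
    exact ⟨D, hD, hDs⟩
  push Not at hall
  obtain ⟨x, hxs, hx⟩ := hall
  obtain rfl : x = q := by_contra fun hxq => absurd (hdeg x ⟨hxs, hxq⟩) (by omega)
  have : Nonempty V := ⟨x⟩
  obtain ⟨q', hq'⟩ :=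
    (Set.ncard_le_one_iff_subset_singleton (Set.toFinite _)).1 (Nat.le_of_lt_succ hx)
  have hne : ((s \ {x}) \ {q'}).Nonempty := by
    by_cases hwq' : w = q'
    · obtain ⟨u, hu, hux⟩ := Set.exists_ne_of_one_lt_ncard (hdeg w hw) x
      exact ⟨u, ⟨hu.1, hux⟩, fun h => hu.2.ne (hwq'.trans h.symm)⟩
    · exact ⟨w, hw, hwq'⟩
  have hdeg' : ∀ v ∈ (s \ {x}) \ {q'}, 2 ≤ ((s \ {x}) ∩ G.neighborSet v).ncard := by
    rintro v ⟨hv, hvq'⟩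
    refine (hdeg v hv).trans (Set.ncard_le_ncard fun u hu => ⟨⟨hu.1, ?_⟩, hu.2⟩)
    rintro rfl
    exact hvq' (hq' ⟨hv.1, hu.2.symm⟩)
  obtain ⟨D, hD, hDs⟩ := ih (s \ {x}) (Set.sdiff_singleton_ssubset.2 hxs) hne hdeg'
  exact ⟨D, hD, hDs.trans Set.sdiff_subset⟩

theorem exists_connectedOn_le_degree (hs : s.Nonempty)
    (hdeg : ∀ x ∈ s, k ≤ (s ∩ G.neighborSet x).ncard) :
    ∃ t, ConnectedOn G t ∧ ∀ x ∈ t, k ≤ (t ∩ G.neighborSet x).ncard := by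
  obtain ⟨x, hx⟩ := hs
  obtain ⟨t, ht, -⟩ := exists_isComponent G hx
  exact ⟨t, ht.connectedOn, fun v hv => (hdeg v (ht.subset hv)).trans
    (Set.ncard_le_ncard fun u hu => ⟨ht.closed v hv u hu.1 hu.2, hu.2⟩)⟩

theorem exists_maximal_leavesCycle (ht : t.Nonempty)
    (hdeg : ∀ x ∈ t, 3 ≤ (t ∩ G.neighborSet x).ncard) : ∃ Y, Maximal (LeavesCycle G t) Y := by
  obtain ⟨x, hx⟩ := ht
  obtain ⟨u, hu, hux⟩ : (t ∩ G.neighborSet x).Nonempty :=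
    Set.nonempty_of_ncard_ne_zero (by have := hdeg x hx; omega)
  obtain ⟨D, hD, hDt⟩ := exists_inducedCycle_of_two_le_degree (q := x) ⟨u, hu, hux.ne'⟩
    fun v hv => (Nat.le_succ 2).trans (hdeg v hv.1)
  obtain ⟨y, hyt, hyD⟩ : ∃ y ∈ t, y ∉ D := by
    by_contra! hsub
    obtain rfl := hDt.antisymm hsub
    exact absurd ((hdeg x hx).trans (ncard_inter_neighborSet_le_two_of_mem_inducedCycles hD hx))
      (by norm_num)
  have hy : LeavesCycle G t {y} := ⟨connectedOn_singleton y, Set.singleton_subset_iff.2 hyt,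
    D, hD, Set.subset_sdiff_singleton hDt hyD⟩
  obtain ⟨Y, -, hY⟩ := Finite.exists_le_maximal hy
  exact ⟨Y, hY⟩

/-- If the maximal set `Y` had at most two attachments `p` and `q`, then `t \ Y` without `p` would
still have all degrees, except perhaps that of `q`, at least two, and so contain an induced cycle
avoiding the attachment `p`. -/
theorem two_lt_ncard_attachments_of_maximal (ht : ConnectedOn G t)
    (hdeg : ∀ x ∈ t, 3 ≤ (t ∩ G.neighborSet x).ncard) (hY : Maximal (LeavesCycle G t) Y) :
    2 < (attachments G t Y).ncard := by
  by_contra! hle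
  obtain ⟨D, hD, hDt⟩ := hY.1.exists_cycle
  have hD3 := three_le_ncard_of_mem_inducedCycles hD
  obtain ⟨d, hd⟩ := Set.nonempty_of_ncard_ne_zero (s := D) (by omega)
  obtain ⟨p, hp⟩ := attachments_nonempty ht hY.1.connectedOn.nonempty hY.1.subset ⟨d, hDt hd⟩
  have hcard := Set.ncard_sdiff_singleton_add_one hp
  have : Nonempty V := ⟨p⟩
  obtain ⟨q, hq⟩ := (Set.ncard_le_one_iff_subset_singleton (Set.toFinite _)).1
    (show (attachments G t Y \ {p}).ncard ≤ 1 by omega)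
  obtain ⟨w, hwD, hw⟩ := Set.exists_mem_notMem_of_ncard_lt_ncard (s := {p, q}) (t := D)
    (((Set.ncard_insert_le p {q}).trans_eq (by rw [Set.ncard_singleton])).trans_lt hD3)
  obtain ⟨hwp, hwq⟩ := not_or.1 hw
  have hdeg' : ∀ x ∈ ((t \ Y) \ {p}) \ {q}, 2 ≤ ((t \ Y) \ {p} ∩ G.neighborSet x).ncard := by
    rintro x ⟨⟨hx, hxp⟩, hxq⟩
    have hcover : t ∩ G.neighborSet x ⊆ insert p ((t \ Y) \ {p} ∩ G.neighborSet x) :=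
      fun u hu => or_iff_not_imp_left.2 fun hup =>
        ⟨⟨⟨hu.1, fun huY => hxq (hq ⟨⟨hx, u, huY, hu.2⟩, hxp⟩)⟩, hup⟩, hu.2⟩
    have := (hdeg x hx.1).trans ((Set.ncard_le_ncard hcover).trans (Set.ncard_insert_le _ _))
    omega
  have hne : (((t \ Y) \ {p}) \ {q}).Nonempty := ⟨w, ⟨hDt hwD, hwp⟩, hwq⟩
  obtain ⟨D', hD', hDt'⟩ := exists_inducedCycle_of_two_le_degree hne hdeg'
  exact (hDt' (attachments_subset_of_maximal hY hD' (hDt'.trans Set.sdiff_subset) hp)).2 rfl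

theorem four_le_hadwigerNumber_of_degree (hs : s.Nonempty)
    (hdeg : ∀ x ∈ s, 3 ≤ (s ∩ G.neighborSet x).ncard) : 4 ≤ G.hadwigerNumber := by
  obtain ⟨t, ht, htdeg⟩ := exists_connectedOn_le_degree hs hdeg
  obtain ⟨Y, hY⟩ := exists_maximal_leavesCycle ht.nonempty htdeg
  obtain ⟨D, hD, hDt⟩ := hY.1.exists_cycle
  obtain ⟨a, b, c, ha, hb, hc, hab, hac, hbc⟩ :=
    (Set.two_lt_ncard_iff (Set.toFinite _)).1 (two_lt_ncard_attachments_of_maximal ht htdeg hY)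
  have hsub := attachments_subset_of_maximal hY hD hDt
  exact four_le_hadwigerNumber hD hY.1.connectedOn
    (Set.disjoint_left.2 fun v hv => (hDt hv).2) (hsub ha) (hsub hb) (hsub hc) hab hac hbc
    ha.2 hb.2 hc.2

theorem lt_hadwigerNumber_of_degree (hk : k ≤ 3) (hs : s.Nonempty)
    (hdeg : ∀ x ∈ s, k ≤ (s ∩ G.neighborSet x).ncard) : k < G.hadwigerNumber := by
  obtain ⟨x, hx⟩ := hs
  have exists_neighbor (hpos : 0 < k) : (s ∩ G.neighborSet x).Nonempty :=
    Set.nonempty_of_ncard_ne_zero (hpos.trans_le (hdeg x hx)).ne'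
  interval_cases k
  · exact length_le_hadwigerNumber (B := [{x}]) (by simp [connectedOn_singleton]) (by simp)
  · obtain ⟨u, -, hxu⟩ := exists_neighbor one_pos
    exact length_le_hadwigerNumber (B := [{x}, {u}]) (by simp [connectedOn_singleton])
      (by simpa [Touching] using ⟨hxu.ne, hxu⟩)
  · obtain ⟨u, hu, hxu⟩ := exists_neighbor two_pos
    obtain ⟨D, hD, -⟩ := exists_inducedCycle_of_two_le_degree (q := x) ⟨u, hu, hxu.ne'⟩
      fun v hv => hdeg v hv.1
    exact three_le_hadwigerNumber hD
  · exact four_le_hadwigerNumber_of_degree ⟨x, hx⟩ hdeg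

theorem colorableOn_of_hadwigerNumber_le_three (h : G.hadwigerNumber ≤ 3) (A : Set V) :
    ColorableOn G A G.hadwigerNumber := by
  by_contra hA
  obtain ⟨s, hs, hdeg⟩ := exists_le_degree_of_not_colorableOn hA
  exact lt_irrefl _ (lt_hadwigerNumber_of_degree h hs hdeg)

end MinimumDegree

end SolidGraph

theorem theorem5p2p1 {V : Type*} [Finite V] (G : SimpleGraph V) (hG : G.Connected)
    (h : (SimpleGraph.completeGraph (Fin G.hadwigerNumber)).beth1 = G.beth1 ∨
      (SimpleGraph.completeGraph (Fin G.hadwigerNumber)).beth2 = G.beth2 ∨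
      (SimpleGraph.completeGraph (Fin G.hadwigerNumber)).beth3 = G.beth3) :
    G.chromaticNumber ≤ (G.hadwigerNumber : ℕ∞) := by
  refine SolidGraph.ColorableOn.chromaticNumber_le ?_
  by_cases hk : 4 ≤ G.hadwigerNumber
  · exact SolidGraph.colorableOn_of_beth_eq hG hk h
  · exact SolidGraph.colorableOn_of_hadwigerNumber_le_three (by omega) Set.univ
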